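/- Throughout, $D_n\subset\mathbb R^n$ is the closed Euclidean unit ball centred at the origin, $|A|$ is the volume of a set $A\subset\mathbb R^n$, and $|\partial A|$ is the surface area of $A$, i.e. the $(n-1)$-dimensional Hausdorff measure of its boundary. For compact sets $A,B$ put $\Delta_v(A,B)=|A\,\Delta\, B|$ and $\Delta_s(A,B)=|\partial(A\cup B)|-|\partial(A\cap B)|$. A polytope is a convex polytope in $\mathbb R^n$ with non-empty interior. A polytope with at most $N$ facets is called best-approximating for $D_n$ with respect to the surface area deviation if it minimizes $\Delta_s(\cdot,D_n)$ among all polytopes in $\mathbb R^n$ with at most $N$ facets. Let $$I=\int_0^1 t^{-1}\bigl(1-e^{-\ln(2)t}\bigr)\,dt,\qquad II=\int_0^\infty e^{-\ln(2)e^{t}}\,dt .$$ (1) There is an absolute constant $C$ such that for all integers $n\ge 2$ and $N\ge n^n$ the following holds. Every polytope $Q^b_{n,N}$ with at most $N$ facets that is best-approximating for $D_n$ with respect to the surface area deviation satisfies $$\Delta_s(Q^b_{n,N},D_n)\le\Bigl(2I+II+\tfrac12+C n^{-1/2}\Bigr)N^{-\frac{2}{n-1}}\,|\partial D_n| .$$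 Moreover, there is one polytope $P_{n,N}$ in $\mathbb R^n$ with at most $N$ facets that satisfies both $$\Delta_v(P_{n,N},D_n)\le\bigl(I+II+C n^{-1/2}\bigr)N^{-\frac{2}{n-1}}\,|D_n|$$ and $$\Delta_s(P_{n,N},D_n)\le\Bigl(2I+II+\tfrac12+C n^{-1/2}\Bigr)N^{-\frac{2}{n-1}}\,|\partial D_n| .$$ (2) There is an absolute constant $C$ such that for all integers $n\ge 2$ and $N\ge 10^n$ there is a polytope $P_{n,N}$ in $\mathbb R^n$ with at most $N$ facets that satisfies both $$\Delta_v(P_{n,N},D_n)\le C N^{-\frac{2}{n-1}}\,|D_n|\quad\text{and}\quad \Delta_s(P_{n,N},D_n)\le 4C N^{-\frac{2}{n-1}}\,|\partial D_n| ,$$ and every polytope $Q^b_{n,N}$ with at most $N$ facets that is best-approximating for $D_n$ with respect to the surface area deviation satisfies $\Delta_s(Q^b_{n,N},D_n)\le 4C N^{-\frac{2}{n-1}}\,|\partial D_n|$. -/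

import Mathlib

open MeasureTheory Set
open scoped symmDiff

/-- The closed Euclidean unit ball `D_n` of `ℝⁿ`, centred at the origin. -/
def unitBall (n : ℕ) : Set (EuclideanSpace ℝ (Fin n)) :=
  Metric.closedBall 0 1

/-- The volume (Lebesgue measure) of a subset of `ℝⁿ`. -/
noncomputable def vol {n : ℕ} (A : Set (EuclideanSpace ℝ (Fin n))) : ℝ :=
  (volume A).toReal

/-- The surface area `|∂A|` of a subset of `ℝⁿ`: the `(n-1)`-dimensional Hausdorff measure of its
topological boundary, normalized so as to be Lebesgue measure on `(n-1)`-dimensional flats. -/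
noncomputable def surfaceArea {n : ℕ} (A : Set (EuclideanSpace ℝ (Fin n))) : ℝ :=
  (Measure.euclideanHausdorffMeasure (n - 1) (frontier A)).toReal

/-- The symmetric volume difference `Δ_v(A, B)`. -/
noncomputable def volDiff {n : ℕ} (A B : Set (EuclideanSpace ℝ (Fin n))) : ℝ :=
  vol (A ∆ B)

/-- The surface area deviation `Δ_s(A, B)`. -/
noncomputable def surfDev {n : ℕ} (A B : Set (EuclideanSpace ℝ (Fin n))) : ℝ :=
  surfaceArea (A ∪ B) - surfaceArea (A ∩ B)

/-- A (full-dimensional, convex) polytope in `ℝⁿ`: a bounded intersection of finitely many closed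
half-spaces, with non-empty interior. -/
structure IsPolytope {n : ℕ} (P : Set (EuclideanSpace ℝ (Fin n))) : Prop where
  exists_halfspaces : ∃ s : Finset (EuclideanSpace ℝ (Fin n) × ℝ),
    (∀ p ∈ s, p.1 ≠ 0) ∧ P = {x | ∀ p ∈ s, inner ℝ p.1 x ≤ p.2}
  bounded : Bornology.IsBounded P
  interior_nonempty : (interior P).Nonempty

/-- The facets of `P`: its non-empty exposed faces of dimension `n - 1`. -/
def facets {n : ℕ} (P : Set (EuclideanSpace ℝ (Fin n))) :
    Set (Set (EuclideanSpace ℝ (Fin n))) :=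
  {F | F.Nonempty ∧ IsExposed ℝ P F ∧ Module.finrank ℝ (vectorSpan ℝ F) + 1 = n}

/-- The polytopes in `ℝⁿ` with at most `N` facets. -/
def polytopesWithAtMost (n N : ℕ) : Set (Set (EuclideanSpace ℝ (Fin n))) :=
  {P | IsPolytope P ∧ (facets P).encard ≤ N}

/-- `Q` is best-approximating for `D_n` with respect to the surface area deviation, among the
polytopes in `ℝⁿ` with at most `N` facets. -/
def IsBestSurfApprox (n N : ℕ) (Q : Set (EuclideanSpace ℝ (Fin n))) : Prop :=
  Q ∈ polytopesWithAtMost n N ∧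
    ∀ P ∈ polytopesWithAtMost n N, surfDev Q (unitBall n) ≤ surfDev P (unitBall n)

/-- `I = ∫₀¹ t⁻¹ (1 - e^{-ln(2) t}) dt`. -/
noncomputable def constI : ℝ :=
  ∫ t in (0 : ℝ)..1, t⁻¹ * (1 - Real.exp (-(Real.log 2) * t))

/-- `II = ∫₀^∞ e^{-ln(2) e^t} dt`. -/
noncomputable def constII : ℝ :=
  ∫ t in Ioi (0 : ℝ), Real.exp (-(Real.log 2) * Real.exp t)

/-- The rate `N^{-2/(n-1)}`. -/
noncomputable def rate (n N : ℕ) : ℝ :=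
  (N : ℝ) ^ (-(2 : ℝ) / ((n : ℝ) - 1))

/-!
The polytopes are random: `N - 2n` half-spaces whose normals point in independent uniform
directions, together with the `2n` half-spaces of a cube (which only serve to make the intersection
bounded), all at the same distance `t` from the origin. A point `x` lies in a random half-space
with probability `1 - G (t / ‖x‖)`, where `G` (`sectorFraction`) is the fraction of the ball
occupied by a spherical sector. The distance is chosen so that `G t = log 2 / (N - 2n)`
(`exists_sectorFraction_eq`), which makes `ε = 1 - t²` of order at most `(4n / N) ^ (2 / (n - 1))`.

*Volume.* By the first moment method (`exists_halfspaces_le`) some realization has at most the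
expected volume deviation. In polar coordinates this is a one-dimensional integral of
`1 - (1 - G (t / r)) ^ (N - 2n)` over `r < 1` and of `(1 - G (t / r)) ^ (N - 2n)` over `r > 1`.
The ratio `G (t / r) / G t` is compared with the ratio `v` of the base areas of the caps at heights
`t / r` and `t`: since `sectorProfile / sectionProfile` is antitone, it is at most `v` for `r ≤ 1`
and at least `v` for `r ≥ 1`. So the integrands are bounded by `1 - exp (-log 2 * v)`, up to an
error of order `1 / (N - 2n)`, and by `exp (-log 2 * v)`. Substituting `v`, respectively
`s = log v`, turns the integrals into `constI` and `constII`, up to the factor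
`n / (n - 1) * ε / (1 - ε)` and an error of relative order `ε + 1 / n` (`lintegral_inner_le`,
`jacobian_le`, `lintegral_outer_le`).

*Surface area.* The surface area of a part of the boundary of such a polytope is `n / t` times the
volume of the cone over it, because all facets lie at distance `t` (`circumPolytope_area_eq`); for
the sphere the factor is `n` (`sphere_area_eq`). Splitting the directions according to whether the
boundary of the polytope lies outside or inside the ball gives
`Δ_s ≤ n Δ_v + (1 / t - 1) n |P|` (`surfDev_circumPolytope_le`), and `1 / t - 1 ≤ ε / 2 + ε²`. So
one polytope has both deviations under control, even with `I + II + 1 / 2` in the second bound.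

The inequalities for best-approximating polytopes follow by comparison with this polytope. In the
finitely many cases with `n < 10` and `N < 10ⁿ`, a cube is good enough.
-/

open scoped ENNReal NNReal Pointwise

/-! ### Cones, hyperplanes and the sphere -/

/-- The Euclidean space `ℝⁿ`. -/
abbrev Euc (n : ℕ) := EuclideanSpace ℝ (Fin n)

/-- A Borel cone without its apex `0`, encoding a Borel set of directions. -/
structure IsConical {n : ℕ} (B : Set (Euc n)) : Prop where
  measurableSet : MeasurableSet B
  zero_notMem : (0 : Euc n) ∉ B
  smul_mem : ∀ c : ℝ, 0 < c → ∀ x ∈ B, c • x ∈ B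

namespace IsConical

variable {n : ℕ} {B B' : Set (Euc n)}

lemma smul_mem_iff (hB : IsConical B) {c : ℝ} (hc : 0 < c) {x : Euc n} :
    c • x ∈ B ↔ x ∈ B := by
  refine ⟨fun h => ?_, hB.smul_mem c hc x⟩
  have := hB.smul_mem c⁻¹ (inv_pos.2 hc) _ h
  rwa [smul_smul, inv_mul_cancel₀ hc.ne', one_smul] at this

lemma inter (hB : IsConical B) (hB' : IsConical B') : IsConical (B ∩ B') :=
  ⟨hB.measurableSet.inter hB'.measurableSet, fun h => hB.zero_notMem h.1,
    fun c hc x hx => ⟨hB.smul_mem c hc x hx.1, hB'.smul_mem c hc x hx.2⟩⟩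

lemma diff (hB : IsConical B) (hB' : IsConical B') : IsConical (B \ B') :=
  ⟨hB.measurableSet.diff hB'.measurableSet, fun h => hB.zero_notMem h.1,
    fun c hc x hx => ⟨hB.smul_mem c hc x hx.1, fun h => hx.2 ((hB'.smul_mem_iff hc).1 h)⟩⟩

lemma compl_zero : IsConical ({0}ᶜ : Set (Euc n)) :=
  ⟨(measurableSet_singleton _).compl, by simp, fun c hc x hx => by
    simp only [mem_compl_iff, mem_singleton_iff, smul_eq_zero, not_or] at hx ⊢
    exact ⟨hc.ne', hx⟩⟩

end IsConical

/-- An inequality between measures of conical sets may be checked on the pieces of a finite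
conical cover. -/
lemma measure_le_of_conical_cover {n : ℕ} {ι : Type*} (μ ν : Measure (Euc n))
    (C : ι → Set (Euc n)) (hC : ∀ i, IsConical (C i))
    (h : ∀ i, ∀ B, IsConical B → B ⊆ C i → μ B ≤ ν B) (s : Finset ι) :
    ∀ B, IsConical B → B ⊆ ⋃ i ∈ s, C i → μ B ≤ ν B := by
  classical
  induction s using Finset.induction_on with
  | empty =>
    intro B _ hsub
    have : B = ∅ := by simpa using hsub
    simp [this]
  | insert a s _ ih =>
    intro B hB hsub
    rw [← measure_inter_add_sdiff B (hC a).measurableSet,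
      ← measure_inter_add_sdiff (μ := ν) B (hC a).measurableSet]
    refine add_le_add (h a _ (hB.inter (hC a)) inter_subset_right) (ih _ (hB.diff (hC a)) ?_)
    intro x hx
    have := hsub hx.1
    simp only [Finset.mem_insert, iUnion_iUnion_eq_or_left, mem_union] at this
    exact this.resolve_left hx.2

/-- Fubini's theorem: the volume is the integral of the areas of the parallel sections orthogonal
to a unit vector. -/
lemma volume_eq_lintegral_slices {n : ℕ} (e : Euc n) (he : ‖e‖ = 1) {T : Set (Euc n)}
    (hT : MeasurableSet T) :
    volume T = ∫⁻ y : ℝ,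
      Measure.euclideanHausdorffMeasure (n - 1) (T ∩ {x | inner ℝ e x = y}) := by
  have he0 : e ≠ 0 := fun h => by simp [h] at he
  have h := EuclideanGeometry.euclideanHausdorffMeasure_eq_lintegral (V := Euc n) (P := Euc n)
    (0 : Euc n) he0 hT
  rw [finrank_euclideanSpace_fin, EuclideanSpace.euclideanHausdorffMeasure_eq_volume] at h
  rw [h, show ‖e‖ₑ = 1 by rw [← ofReal_norm, he, ENNReal.ofReal_one], one_mul]
  congr 1
  ext y
  congr 2
  ext x
  simp only [vadd_eq_add, add_zero, SetLike.mem_coe, AffineSubspace.mem_mk', vsub_eq_sub,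
    mem_ofPred_eq, Submodule.mem_orthogonal_singleton_iff_inner_right, inner_sub_right,
    inner_smul_right, real_inner_self_eq_norm_sq, he]
  constructor <;> intro h <;> linarith

lemma lintegral_Ioc_pow_div {s : ℝ} (hs : 0 < s) {n : ℕ} (hn : 1 ≤ n) :
    (n : ℝ≥0∞) * ∫⁻ y in Ioc 0 s, ENNReal.ofReal ((y / s) ^ (n - 1)) = ENNReal.ofReal s := by
  rw [← ofReal_integral_eq_lintegral_ofReal, ← intervalIntegral.integral_of_le hs.le]
  · have h1 : ∫ y in (0 : ℝ)..s, (y / s) ^ (n - 1) = s / n := by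
      rw [intervalIntegral.integral_comp_div (fun y => y ^ (n - 1)) hs.ne']
      simp only [zero_div, div_self hs.ne', integral_pow, one_pow, smul_eq_mul]
      rw [Nat.sub_add_cancel hn, zero_pow (by omega)]
      have : ((n - 1 : ℕ) : ℝ) + 1 = n := by rw [Nat.cast_sub hn]; simp
      rw [this]; ring
    rw [h1, ← ENNReal.ofReal_natCast, ← ENNReal.ofReal_mul (by positivity)]
    congr 1
    field_simp
  · exact (Continuous.integrableOn_Icc (by fun_prop)).mono_set Ioc_subset_Icc_self
  · refine (ae_restrict_iff' measurableSet_Ioc).2 (.of_forall fun y hy => ?_)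
    have := hy.1
    positivity

/-- The volume of the cone over a subset of the hyperplane `{⟪e, x⟫ = s}` is base times height
divided by the dimension. -/
lemma volume_cone_hyperplane {n : ℕ} (hn : 1 ≤ n) {e : Euc n} (he : ‖e‖ = 1) {s : ℝ} (hs : 0 < s)
    {B : Set (Euc n)} (hB : IsConical B) :
    (n : ℝ≥0∞) * volume ({x | 0 < inner ℝ e x ∧ inner ℝ e x ≤ s} ∩ B) =
      ENNReal.ofReal s *
        Measure.euclideanHausdorffMeasure (n - 1) ({x | inner ℝ e x = s} ∩ B) := by
  have hm : MeasurableSet {x : Euc n | 0 < inner ℝ e x ∧ inner ℝ e x ≤ s} := by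
    have hi : Measurable fun x : Euc n => inner ℝ e x :=
      (by fun_prop : Continuous fun x : Euc n => inner ℝ e x).measurable
    exact (measurableSet_lt measurable_const hi).inter (measurableSet_le hi measurable_const)
  rw [volume_eq_lintegral_slices e he (hm.inter hB.measurableSet)]
  set c := Measure.euclideanHausdorffMeasure (n - 1) ({x | inner ℝ e x = s} ∩ B) with hc
  have key : ∀ y : ℝ, Measure.euclideanHausdorffMeasure (n - 1)
      (({x | 0 < inner ℝ e x ∧ inner ℝ e x ≤ s} ∩ B) ∩ {x | inner ℝ e x = y}) =
      (Ioc 0 s).indicator (fun y => ENNReal.ofReal ((y / s) ^ (n - 1)) * c) y := by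
    intro y
    by_cases hy : y ∈ Ioc 0 s
    · rw [indicator_of_mem hy]
      have hys : 0 < y / s := div_pos hy.1 hs
      have : ({x | 0 < inner ℝ e x ∧ inner ℝ e x ≤ s} ∩ B) ∩ {x | inner ℝ e x = y} =
          (y / s) • ({x | inner ℝ e x = s} ∩ B) := by
        ext x
        rw [mem_smul_set_iff_inv_smul_mem₀ hys.ne']
        simp only [mem_inter_iff, mem_ofPred_eq, inner_smul_right,
          hB.smul_mem_iff (inv_pos.2 hys)]
        have h0 := hy.1
        have h2 : ((y / s)⁻¹ * inner ℝ e x = s) ↔ inner ℝ e x = y := by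
          rw [inv_mul_eq_iff_eq_mul₀ hys.ne', div_mul_cancel₀ _ hs.ne']
        rw [h2]
        constructor
        · rintro ⟨⟨_, h⟩, h'⟩; exact ⟨h', h⟩
        · rintro ⟨h', h⟩; exact ⟨⟨by rw [h']; exact hy, h⟩, h'⟩
      rw [this, Measure.euclideanHausdorffMeasure_smul₀ _ hys.ne', ENNReal.smul_def, smul_eq_mul, hc]
      congr 1
      rw [ENNReal.ofReal_pow hys.le, ENNReal.coe_pow]
      congr 1
      rw [← Real.enorm_eq_ofReal hys.le]; rfl
    · rw [indicator_of_notMem hy]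
      convert measure_empty (μ := Measure.euclideanHausdorffMeasure (X := Euc n) (n - 1))
      ext x
      simp only [mem_inter_iff, mem_ofPred_eq, mem_empty_iff_false, iff_false, not_and]
      rintro ⟨h, -⟩ h'
      exact hy (h' ▸ h)
  simp_rw [key]
  rw [lintegral_indicator measurableSet_Ioc, lintegral_mul_const _ (by fun_prop), ← mul_assoc,
    lintegral_Ioc_pow_div hs hn]

lemma euclideanHausdorffMeasure_image_le_of_lipschitzOnWith {n : ℕ} {K : ℝ≥0} {f : Euc n → Euc n}
    {A : Set (Euc n)} (hf : LipschitzOnWith K f A) (d : ℕ) :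
    Measure.euclideanHausdorffMeasure d (f '' A) ≤
      (K : ℝ≥0∞) ^ d * Measure.euclideanHausdorffMeasure d A := by
  simp only [Measure.euclideanHausdorffMeasure_def, Measure.smul_apply]
  have := hf.hausdorffMeasure_image_le (d := d) (by positivity)
  rw [ENNReal.rpow_natCast] at this
  rw [ENNReal.smul_def, smul_eq_mul, ENNReal.smul_def, smul_eq_mul, mul_left_comm]
  gcongr

/-- Outside the open unit ball the radial projection onto the unit sphere is `1`-Lipschitz. -/
lemma lipschitzOnWith_radialProjection {n : ℕ} :
    LipschitzOnWith 1 (fun x : Euc n => ‖x‖⁻¹ • x) {x | 1 ≤ ‖x‖} := by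
  refine LipschitzOnWith.of_dist_le_mul fun x hx y hy => ?_
  simp only [mem_ofPred_eq] at hx hy
  have hx0 : 0 < ‖x‖ := by linarith
  have hy0 : 0 < ‖y‖ := by linarith
  rw [NNReal.coe_one, one_mul, dist_eq_norm, dist_eq_norm]
  refine le_of_sq_le_sq ?_ (norm_nonneg _)
  rw [norm_sub_sq_real, norm_sub_sq_real, norm_smul, norm_smul, norm_inv, norm_inv, norm_norm,
    norm_norm, inv_mul_cancel₀ hx0.ne', inv_mul_cancel₀ hy0.ne', real_inner_smul_left,
    real_inner_smul_right]
  have hcs := real_inner_le_norm x y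
  set i := inner ℝ x y
  have h1 : ‖x‖⁻¹ * (‖y‖⁻¹ * i) * (‖x‖ * ‖y‖) = i := by field_simp
  set j := ‖x‖⁻¹ * (‖y‖⁻¹ * i)
  have hj : j ≤ 1 := by
    by_contra hlt
    push Not at hlt
    nlinarith [mul_pos hx0 hy0]
  have h2 : 1 ≤ ‖x‖ * ‖y‖ := by nlinarith
  nlinarith [sq_nonneg (‖x‖ - ‖y‖)]

/-- The central projection of the spherical cap `{⟪u, x⟫ ≥ c}` to the tangent hyperplane at its
pole `u` is Lipschitz, with a constant tending to `1` as `c → 1`. -/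
lemma lipschitzOnWith_centralProjection {n : ℕ} {u : Euc n} (hu : ‖u‖ = 1) {c : ℝ} (hc : 0 < c)
    (hc1 : c < 1) :
    LipschitzOnWith (Real.toNNReal (Real.sqrt (1 / c ^ 2 + 8 * (1 - c) / c ^ 4)))
      (fun x : Euc n => (inner ℝ u x)⁻¹ • x) {x | ‖x‖ = 1 ∧ c ≤ inner ℝ u x} := by
  refine LipschitzOnWith.of_dist_le_mul fun x hx y hy => ?_
  obtain ⟨hx, hxc⟩ := hx
  obtain ⟨hy, hyc⟩ := hy
  rw [Real.coe_toNNReal _ (Real.sqrt_nonneg _), dist_eq_norm, dist_eq_norm]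
  have hd : ∀ z : Euc n, ‖z‖ = 1 → c ≤ inner ℝ u z → ‖u - z‖ ^ 2 ≤ 2 * (1 - c) := by
    intro z hz hzc
    rw [norm_sub_sq_real, hu, hz]; linarith
  have hdx := hd x hx hxc
  have hdy := hd y hy hyc
  have ha : 0 < inner ℝ u x := hc.trans_le hxc
  have hb : 0 < inner ℝ u y := hc.trans_le hyc
  -- `x - y` is orthogonal to `x + y`, and `u` is close to the midpoint `(x + y) / 2`.
  have hab : (inner ℝ u x - inner ℝ u y) ^ 2 ≤ 8 * (1 - c) * ‖x - y‖ ^ 2 := by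
    have h0 : inner ℝ (x + y) (x - y) = 0 := by
      rw [inner_add_left, inner_sub_right, inner_sub_right, real_inner_self_eq_norm_sq,
        real_inner_self_eq_norm_sq, hx, hy, real_inner_comm]; ring
    have h1 : 2 * (inner ℝ u x - inner ℝ u y) = inner ℝ ((u - x) + (u - y)) (x - y) := by
      have : (u - x) + (u - y) = (2 : ℝ) • u - (x + y) := by rw [two_smul]; abel
      rw [this, inner_sub_left, h0, real_inner_smul_left, inner_sub_right]; ring
    have h2 : ‖(u - x) + (u - y)‖ ^ 2 ≤ 8 * (1 - c) := by
      have := norm_add_le (u - x) (u - y)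
      nlinarith [norm_nonneg ((u - x) + (u - y)), sq_nonneg (‖u - x‖ - ‖u - y‖),
        norm_nonneg (u - x), norm_nonneg (u - y)]
    have h3 := abs_real_inner_le_norm ((u - x) + (u - y)) (x - y)
    rw [← h1] at h3
    have h4 : (2 * (inner ℝ u x - inner ℝ u y)) ^ 2 ≤
        (‖(u - x) + (u - y)‖ * ‖x - y‖) ^ 2 := sq_le_sq' (by linarith [neg_abs_le (2 * (inner ℝ u x - inner ℝ u y))]) (by linarith [le_abs_self (2 * (inner ℝ u x - inner ℝ u y))])
    rw [mul_pow] at h4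
    nlinarith [sq_nonneg ‖x - y‖, mul_le_mul_of_nonneg_right h2 (sq_nonneg ‖x - y‖),
      mul_nonneg (sub_nonneg.2 hc1.le) (sq_nonneg ‖x - y‖)]
  refine le_of_sq_le_sq ?_ (by positivity)
  rw [mul_pow, Real.sq_sqrt (by have := sub_pos.2 hc1; positivity)]
  set a := inner ℝ u x
  set b := inner ℝ u y
  have e1 : ‖a⁻¹ • x - b⁻¹ • y‖ ^ 2 = ‖x - y‖ ^ 2 / (a * b) + (a - b) ^ 2 / (a * b) ^ 2 := by
    rw [norm_sub_sq_real, norm_sub_sq_real, norm_smul, norm_smul, real_inner_smul_left,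
      real_inner_smul_right, hx, hy, norm_inv, norm_inv, Real.norm_of_nonneg ha.le,
      Real.norm_of_nonneg hb.le]
    field_simp
    ring
  have hab2 : c ^ 2 ≤ a * b := by nlinarith
  rw [e1, add_mul, one_div, div_eq_mul_inv, mul_comm (‖x - y‖ ^ 2)]
  have hc2 : 0 < c ^ 2 := by positivity
  refine add_le_add ?_ ?_
  · gcongr
  · calc (a - b) ^ 2 / (a * b) ^ 2 ≤ (8 * (1 - c) * ‖x - y‖ ^ 2) / (c ^ 2) ^ 2 := by
          have := sub_pos.2 hc1
          gcongr
      _ = _ := by ring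


lemma unitBall_eq {n : ℕ} : unitBall n = {x : Euc n | ‖x‖ ≤ 1} := by
  ext x; simp [unitBall]

/-- Comparison of area on the sphere and volume in the ball for a cone of small aperture, through
the section of the cone by the tangent hyperplane at `u`. Both constants tend to `1` as `c → 1`. -/
lemma sphere_cone_comparison {n : ℕ} (hn : 1 ≤ n) {u : Euc n} (hu : ‖u‖ = 1) {c : ℝ} (hc : 0 < c)
    (hc1 : c < 1) {B : Set (Euc n)} (hB : IsConical B)
    (hsub : B ⊆ {x | c * ‖x‖ < inner ℝ u x}) :
    ENNReal.ofReal c ^ n *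
        Measure.euclideanHausdorffMeasure (n - 1) (Metric.sphere (0 : Euc n) 1 ∩ B) ≤
      n * volume (unitBall n ∩ B) ∧
    n * volume (unitBall n ∩ B) ≤
      ENNReal.ofReal (Real.sqrt (1 / c ^ 2 + 8 * (1 - c) / c ^ 4)) ^ (n - 1) *
        Measure.euclideanHausdorffMeasure (n - 1) (Metric.sphere (0 : Euc n) 1 ∩ B) := by
  have hT := volume_cone_hyperplane hn hu one_pos hB
  rw [ENNReal.ofReal_one, one_mul] at hT
  set T := {x | 0 < inner ℝ u x ∧ inner ℝ u x ≤ 1} ∩ B with hTdef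
  set H := {x | inner ℝ u x = 1} ∩ B with hH
  have hpos : ∀ x ∈ B, 0 < inner ℝ u x := fun x hx =>
    (mul_nonneg hc.le (norm_nonneg _)).trans_lt (hsub hx)
  have hcs : ∀ x, inner ℝ u x ≤ ‖x‖ := fun x => by
    simpa [hu] using real_inner_le_norm u x
  have hne : ∀ x ∈ B, 0 < ‖x‖ := fun x hx => (hpos x hx).trans_le (hcs x)
  have h1 : volume (unitBall n ∩ B) ≤ volume T := by
    apply measure_mono
    rintro x ⟨hx, hxB⟩
    rw [unitBall_eq] at hx
    exact ⟨⟨hpos x hxB, (hcs x).trans hx⟩, hxB⟩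
  have h2 : ENNReal.ofReal c ^ n * volume T ≤ volume (unitBall n ∩ B) := by
    have : volume (c • T) = ENNReal.ofReal c ^ n * volume T := by
      rw [Measure.addHaar_smul, finrank_euclideanSpace_fin, abs_of_nonneg (by positivity),
        ENNReal.ofReal_pow hc.le]
    rw [← this]
    apply measure_mono
    rintro _ ⟨x, ⟨⟨_, hx1⟩, hxB⟩, rfl⟩
    refine ⟨?_, hB.smul_mem c hc x hxB⟩
    rw [unitBall_eq, mem_ofPred_eq]
    simp only [norm_smul, Real.norm_of_nonneg hc.le]
    exact (hsub hxB).le.trans hx1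
  have h3 : Measure.euclideanHausdorffMeasure (n - 1) (Metric.sphere (0 : Euc n) 1 ∩ B) ≤
      Measure.euclideanHausdorffMeasure (n - 1) H := by
    have hl := euclideanHausdorffMeasure_image_le_of_lipschitzOnWith
      ((lipschitzOnWith_radialProjection (n := n)).mono (s := H) (by
        rintro x ⟨hx, _⟩
        exact le_of_eq_of_le hx.symm (hcs x))) (n - 1)
    rw [ENNReal.coe_one, one_pow, one_mul] at hl
    refine (measure_mono ?_).trans hl
    rintro x ⟨hx, hxB⟩
    have hx1 : ‖x‖ = 1 := by simpa using hx
    have hp := hpos x hxB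
    refine ⟨(inner ℝ u x)⁻¹ • x, ⟨?_, hB.smul_mem _ (inv_pos.2 hp) x hxB⟩, ?_⟩
    · simp only [mem_ofPred_eq, inner_smul_right, inv_mul_cancel₀ hp.ne']
    · simp only [norm_smul, norm_inv, hx1, mul_one, inv_inv, Real.norm_of_nonneg hp.le, smul_smul,
        mul_inv_cancel₀ hp.ne', one_smul]
  have h4 : Measure.euclideanHausdorffMeasure (n - 1) H ≤
      ENNReal.ofReal (Real.sqrt (1 / c ^ 2 + 8 * (1 - c) / c ^ 4)) ^ (n - 1) *
        Measure.euclideanHausdorffMeasure (n - 1) (Metric.sphere (0 : Euc n) 1 ∩ B) := by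
    have hl := euclideanHausdorffMeasure_image_le_of_lipschitzOnWith
      ((lipschitzOnWith_centralProjection hu hc hc1).mono
        (s := Metric.sphere (0 : Euc n) 1 ∩ B) (by
        rintro x ⟨hx, hxB⟩
        have hx1 : ‖x‖ = 1 := by simpa using hx
        have := hsub hxB
        rw [mem_ofPred_eq, hx1, mul_one] at this
        exact ⟨hx1, this.le⟩)) (n - 1)
    refine (measure_mono ?_).trans hl
    rintro x ⟨hx, hxB⟩
    have hx1 : inner ℝ u x = 1 := hx
    have hp := hne x hxB
    refine ⟨‖x‖⁻¹ • x, ⟨?_, hB.smul_mem _ (inv_pos.2 hp) x hxB⟩, ?_⟩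
    · simp [norm_smul, hp.ne']
    · simp only [inner_smul_right, hx1, mul_one, inv_inv, smul_smul, mul_inv_cancel₀ hp.ne',
        one_smul]
  constructor
  · calc _ ≤ ENNReal.ofReal c ^ n * Measure.euclideanHausdorffMeasure (n - 1) H := by gcongr
      _ = n * (ENNReal.ofReal c ^ n * volume T) := by rw [← hT]; ring
      _ ≤ _ := by gcongr
  · calc _ ≤ n * volume T := by gcongr
      _ ≤ _ := hT ▸ h4

lemma isConical_cap {n : ℕ} (u : Euc n) (c : ℝ) :
    IsConical {x : Euc n | c * ‖x‖ < inner ℝ u x} := by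
  refine ⟨?_, by simp, fun a ha x hx => ?_⟩
  · have hi : Measurable fun x : Euc n => inner ℝ u x :=
      (by fun_prop : Continuous fun x : Euc n => inner ℝ u x).measurable
    exact measurableSet_lt (by fun_prop) hi
  · simp only [mem_ofPred_eq, norm_smul, inner_smul_right, Real.norm_of_nonneg ha.le] at hx ⊢
    nlinarith

lemma exists_finite_cap_cover (n : ℕ) {c : ℝ} (hc1 : c < 1) :
    ∃ s : Finset (Metric.sphere (0 : Euc n) 1),
      ({0}ᶜ : Set (Euc n)) ⊆ ⋃ u ∈ s, {x : Euc n | c * ‖x‖ < inner ℝ (u : Euc n) x} := by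
  obtain ⟨s, hs⟩ := (isCompact_sphere (0 : Euc n) 1).elim_finite_subcover
    (fun u : Metric.sphere (0 : Euc n) 1 => {x : Euc n | c < inner ℝ (u : Euc n) x})
    (fun u => isOpen_lt continuous_const (by fun_prop)) (by
      intro x hx
      refine mem_iUnion.2 ⟨⟨x, hx⟩, ?_⟩
      have hx1 : ‖x‖ = 1 := by simpa using hx
      simp [hx1, hc1])
  refine ⟨s, fun x hx => ?_⟩
  have hx0 : 0 < ‖x‖ := norm_pos_iff.2 hx
  have := hs (show ‖x‖⁻¹ • x ∈ Metric.sphere (0 : Euc n) 1 by simp [norm_smul, hx0.ne'])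
  simp only [mem_iUnion, mem_ofPred_eq, inner_smul_right, exists_prop] at this ⊢
  obtain ⟨u, hu, h⟩ := this
  refine ⟨u, hu, ?_⟩
  rwa [inv_mul_eq_div, lt_div_iff₀ hx0] at h

/-- The area of a Borel subset of the unit sphere is `n` times the volume of the cone over it. -/
lemma sphere_area_eq {n : ℕ} (hn : 1 ≤ n) {B : Set (Euc n)} (hB : IsConical B) :
    Measure.euclideanHausdorffMeasure (n - 1) (Metric.sphere (0 : Euc n) 1 ∩ B) =
      n * volume (unitBall n ∩ B) := by
  set μ : Measure (Euc n) :=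
    (Measure.euclideanHausdorffMeasure (n - 1)).restrict (Metric.sphere (0 : Euc n) 1) with hμ
  set ν : Measure (Euc n) := (n : ℝ≥0∞) • volume.restrict (unitBall n) with hν
  have hμB : ∀ B', IsConical B' → μ B' =
      Measure.euclideanHausdorffMeasure (n - 1) (Metric.sphere (0 : Euc n) 1 ∩ B') := fun B' h => by
    rw [hμ, Measure.restrict_apply h.measurableSet, inter_comm]
  have hνB : ∀ B', IsConical B' → ν B' = n * volume (unitBall n ∩ B') := fun B' h => by
    rw [hν, Measure.smul_apply, Measure.restrict_apply h.measurableSet, inter_comm, smul_eq_mul]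
  rw [← hμB B hB, ← hνB B hB]
  have hB0 : B ⊆ {0}ᶜ := fun x hx h => hB.zero_notMem (h ▸ hx)
  have key : ∀ c : ℝ, 0 < c → c < 1 → ENNReal.ofReal c ^ n * μ B ≤ ν B ∧
      ν B ≤ ENNReal.ofReal (Real.sqrt (1 / c ^ 2 + 8 * (1 - c) / c ^ 4)) ^ (n - 1) * μ B := by
    intro c hc hc1
    obtain ⟨s, hs⟩ := exists_finite_cap_cover n hc1
    constructor
    · refine measure_le_of_conical_cover (ENNReal.ofReal c ^ n • μ) ν _
        (fun u : Metric.sphere (0 : Euc n) 1 => isConical_cap (u : Euc n) c) ?_ s B hB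
        (hB0.trans hs)
      intro u B' hB' hsub
      rw [Measure.smul_apply, smul_eq_mul, hμB B' hB', hνB B' hB']
      exact (sphere_cone_comparison hn (by simp) hc hc1 hB' hsub).1
    · refine measure_le_of_conical_cover ν
        (ENNReal.ofReal (Real.sqrt (1 / c ^ 2 + 8 * (1 - c) / c ^ 4)) ^ (n - 1) • μ) _
        (fun u : Metric.sphere (0 : Euc n) 1 => isConical_cap (u : Euc n) c) ?_ s B hB
        (hB0.trans hs)
      intro u B' hB' hsub
      rw [hνB B' hB', Measure.smul_apply, smul_eq_mul, hμB B' hB']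
      exact (sphere_cone_comparison hn (by simp) hc hc1 hB' hsub).2
  have hev : ∀ᶠ c : ℝ in nhdsWithin 1 (Iio 1), 0 < c ∧ c < 1 := by
    filter_upwards [Ioo_mem_nhdsLT (show (0 : ℝ) < 1 by norm_num)] with c hc using hc
  have lim : ∀ (g : ℝ → ℝ) (k : ℕ), ContinuousAt g 1 → g 1 = 1 →
      Filter.Tendsto (fun c => ENNReal.ofReal (g c) ^ k * μ B) (nhdsWithin 1 (Iio 1))
        (nhds (μ B)) := by
    intro g k hg hg1
    have h1 : Filter.Tendsto (fun c => ENNReal.ofReal (g c) ^ k) (nhdsWithin 1 (Iio 1))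
        (nhds 1) := by
      have h := (ENNReal.tendsto_ofReal hg.tendsto).mono_left
        (nhdsWithin_le_nhds (s := Iio (1 : ℝ)))
      have := ((ENNReal.continuous_pow k).tendsto _).comp h
      simpa [hg1, Function.comp_def] using this
    simpa using ENNReal.Tendsto.mul_const h1 (Or.inl one_ne_zero) (b := μ B)
  apply le_antisymm
  · exact le_of_tendsto (lim (fun c => c) n continuousAt_id rfl)
      (hev.mono fun c hc => (key c hc.1 hc.2).1)
  · refine ge_of_tendsto (lim (fun c => Real.sqrt (1 / c ^ 2 + 8 * (1 - c) / c ^ 4)) (n - 1) ?_ ?_)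
      (hev.mono fun c hc => (key c hc.1 hc.2).2)
    · refine Real.continuous_sqrt.continuousAt.comp ?_
      refine ContinuousAt.add (ContinuousAt.div ?_ ?_ ?_) (ContinuousAt.div ?_ ?_ ?_) <;>
      first
        | fun_prop
        | norm_num
    · norm_num

/-! ### The surface area deviation of polytopes with equidistant facets -/

/-- The intersection of the half-spaces `{⟪u i, x⟫ ≤ t}`; for unit vectors `u i`, all its facets
lie at distance `t` from the origin. -/
def circumPolytope {n : ℕ} {ι : Type*} (u : ι → Euc n) (t : ℝ) : Set (Euc n) :=
  {x | ∀ i, inner ℝ (u i) x ≤ t}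

section circumPolytope

variable {n : ℕ} {ι : Type*} {u : ι → Euc n} {t : ℝ}

lemma isClosed_circumPolytope : IsClosed (circumPolytope u t) := by
  have : circumPolytope u t = ⋂ i, {x | inner ℝ (u i) x ≤ t} := by
    ext x; simp [circumPolytope]
  rw [this]
  exact isClosed_iInter fun i => isClosed_le (by fun_prop) continuous_const

lemma interior_circumPolytope [Finite ι] (ht : 0 < t) :
    interior (circumPolytope u t) = {x | ∀ i, inner ℝ (u i) x < t} := by
  apply Subset.antisymm
  · intro x hx i
    have hlim : Filter.Tendsto (fun r : ℝ => r • x) (nhdsWithin 1 (Ioi 1)) (nhds x) := by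
      have : Filter.Tendsto (fun r : ℝ => r • x) (nhds 1) (nhds ((1 : ℝ) • x)) :=
        (by fun_prop : Continuous fun r : ℝ => r • x).tendsto 1
      rw [one_smul] at this
      exact this.mono_left nhdsWithin_le_nhds
    obtain ⟨r, hr, hr1⟩ := ((hlim.eventually (mem_interior_iff_mem_nhds.1 hx)).and
      self_mem_nhdsWithin).exists
    have h1 := hr i
    have hr1 : 1 < r := hr1
    rw [inner_smul_right] at h1
    show inner ℝ (u i) x < t
    by_contra hlt
    push Not at hlt
    nlinarith
  · have ho : IsOpen {x : Euc n | ∀ i, inner ℝ (u i) x < t} := by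
      have : {x : Euc n | ∀ i, inner ℝ (u i) x < t} = ⋂ i, {x | inner ℝ (u i) x < t} := by
        ext x; simp
      rw [this]
      exact isOpen_iInter_of_finite fun i => isOpen_lt (by fun_prop) continuous_const
    exact interior_maximal (fun x hx i => (hx i).le) ho

lemma mem_frontier_circumPolytope [Finite ι] (ht : 0 < t) {x : Euc n} :
    x ∈ frontier (circumPolytope u t) ↔
      (∀ i, inner ℝ (u i) x ≤ t) ∧ ∃ i, inner ℝ (u i) x = t := by
  rw [frontier, isClosed_circumPolytope.closure_eq, interior_circumPolytope ht]
  constructor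
  · rintro ⟨h1, h2⟩
    simp only [mem_ofPred_eq, not_forall, not_lt] at h2
    obtain ⟨i, hi⟩ := h2
    exact ⟨h1, i, le_antisymm (h1 i) hi⟩
  · rintro ⟨h1, i, hi⟩
    exact ⟨h1, fun h => (h i).ne hi⟩

/-- In a bounded polytope every direction has positive inner product with some facet normal. -/
lemma exists_inner_pos_of_isBounded (hb : Bornology.IsBounded (circumPolytope u t)) (ht : 0 < t)
    {x : Euc n} (hx : x ≠ 0) : ∃ i, 0 < inner ℝ (u i) x := by
  by_contra hcon
  push Not at hcon
  obtain ⟨R, hR⟩ := hb.exists_norm_le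
  have hx0 : 0 < ‖x‖ := norm_pos_iff.2 hx
  have h := hR (((|R| + 1) / ‖x‖) • x) (fun i => by
    rw [inner_smul_right]
    have : 0 ≤ (|R| + 1) / ‖x‖ := by positivity
    nlinarith [hcon i])
  rw [norm_smul, Real.norm_of_nonneg (by positivity), div_mul_cancel₀ _ hx0.ne'] at h
  linarith [le_abs_self R]

/-- The nonzero points whose inner product with `u i` is largest among all `u j`: the directions
in which the boundary of `circumPolytope u t` is met in the `i`-th facet. -/
def normalCone (u : ι → Euc n) (i : ι) : Set (Euc n) :=
  {x | x ≠ 0 ∧ ∀ j, inner ℝ (u j) x ≤ inner ℝ (u i) x}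

lemma isConical_normalCone [Countable ι] (i : ι) : IsConical (normalCone u i) := by
  refine ⟨?_, fun h => h.1 rfl, fun c hc x hx => ⟨smul_ne_zero hc.ne' hx.1, fun j => ?_⟩⟩
  · have : normalCone u i = {0}ᶜ ∩ ⋂ j, {x : Euc n | inner ℝ (u j) x ≤ inner ℝ (u i) x} := by
      ext x; simp [normalCone]
    rw [this]
    exact (measurableSet_singleton _).compl.inter
      (MeasurableSet.iInter fun j => (isClosed_le (by fun_prop) (by fun_prop)).measurableSet)
  · simp only [inner_smul_right]
    exact mul_le_mul_of_nonneg_left (hx.2 j) hc.le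

/-- The area of a Borel subset of the boundary of a polytope all of whose facets have distance `t`
from the origin is `n / t` times the volume of the cone over it. -/
lemma circumPolytope_area_eq [Fintype ι] (hn : 1 ≤ n) (hu : ∀ i, ‖u i‖ = 1) (ht : 0 < t)
    (hb : Bornology.IsBounded (circumPolytope u t)) {B : Set (Euc n)} (hB : IsConical B) :
    ENNReal.ofReal t *
        Measure.euclideanHausdorffMeasure (n - 1) (frontier (circumPolytope u t) ∩ B) =
      n * volume (circumPolytope u t ∩ B) := by
  set μ : Measure (Euc n) := ENNReal.ofReal t •
    (Measure.euclideanHausdorffMeasure (n - 1)).restrict (frontier (circumPolytope u t)) with hμ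
  set ν : Measure (Euc n) := (n : ℝ≥0∞) • volume.restrict (circumPolytope u t) with hν
  have hμB : ∀ B', IsConical B' → μ B' = ENNReal.ofReal t *
      Measure.euclideanHausdorffMeasure (n - 1) (frontier (circumPolytope u t) ∩ B') :=
    fun B' h => by
      rw [hμ, Measure.smul_apply, Measure.restrict_apply h.measurableSet, inter_comm, smul_eq_mul]
  have hνB : ∀ B', IsConical B' → ν B' = n * volume (circumPolytope u t ∩ B') := fun B' h => by
    rw [hν, Measure.smul_apply, Measure.restrict_apply h.measurableSet, inter_comm, smul_eq_mul]
  rw [← hμB B hB, ← hνB B hB]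
  have hcover : B ⊆ ⋃ i ∈ (Finset.univ : Finset ι), normalCone u i := by
    intro x hx
    have hx0 : x ≠ 0 := fun h => hB.zero_notMem (h ▸ hx)
    obtain ⟨i₀, -⟩ := exists_inner_pos_of_isBounded hb ht hx0
    have : Nonempty ι := ⟨i₀⟩
    obtain ⟨i, hi⟩ := Finite.exists_max fun i => inner ℝ (u i) x
    exact mem_iUnion₂.2 ⟨i, Finset.mem_univ i, hx0, hi⟩
  have key : ∀ i, ∀ B', IsConical B' → B' ⊆ normalCone u i → μ B' = ν B' := by
    intro i B' hB' hsub
    rw [hμB B' hB', hνB B' hB']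
    have hmax : ∀ x ∈ B', 0 < inner ℝ (u i) x := fun x hx => by
      obtain ⟨j, hj⟩ := exists_inner_pos_of_isBounded hb ht (hsub hx).1
      exact hj.trans_le ((hsub hx).2 j)
    have h1 : circumPolytope u t ∩ B' =
        {x | 0 < inner ℝ (u i) x ∧ inner ℝ (u i) x ≤ t} ∩ B' := by
      ext x
      constructor
      · rintro ⟨h, hx⟩; exact ⟨⟨hmax x hx, h i⟩, hx⟩
      · rintro ⟨h, hx⟩; exact ⟨fun j => ((hsub hx).2 j).trans h.2, hx⟩
    have h2 : frontier (circumPolytope u t) ∩ B' = {x | inner ℝ (u i) x = t} ∩ B' := by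
      ext x
      constructor
      · rintro ⟨h, hx⟩
        obtain ⟨h, j, hj⟩ := (mem_frontier_circumPolytope ht).1 h
        exact ⟨le_antisymm (h i) (hj ▸ (hsub hx).2 j), hx⟩
      · rintro ⟨h, hx⟩
        have h : inner ℝ (u i) x = t := h
        exact ⟨(mem_frontier_circumPolytope ht).2 ⟨fun j => h ▸ (hsub hx).2 j, i, h⟩, hx⟩
    rw [h1, h2, volume_cone_hyperplane hn (hu i) ht hB']
  apply le_antisymm
  · exact measure_le_of_conical_cover μ ν _ isConical_normalCone
      (fun i B' h1 h2 => (key i B' h1 h2).le) _ B hB hcover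
  · exact measure_le_of_conical_cover ν μ _ isConical_normalCone
      (fun i B' h1 h2 => (key i B' h1 h2).ge) _ B hB hcover

/-- The directions in which the boundary of `circumPolytope u t` lies outside the unit ball. -/
def outerDirections (u : ι → Euc n) (t : ℝ) : Set (Euc n) :=
  {x | x ≠ 0 ∧ ∀ i, inner ℝ (u i) x < t * ‖x‖}

lemma isConical_outerDirections [Countable ι] : IsConical (outerDirections u t) := by
  refine ⟨?_, fun h => h.1 rfl, fun c hc x hx => ⟨smul_ne_zero hc.ne' hx.1, fun j => ?_⟩⟩
  · have : outerDirections u t = {0}ᶜ ∩ ⋂ j, {x : Euc n | inner ℝ (u j) x < t * ‖x‖} := by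
      ext x; simp [outerDirections]
    rw [this]
    exact (measurableSet_singleton _).compl.inter
      (MeasurableSet.iInter fun j => (isOpen_lt (by fun_prop) (by fun_prop)).measurableSet)
  · rw [inner_smul_right, norm_smul, Real.norm_of_nonneg hc.le, mul_left_comm]
    exact mul_lt_mul_of_pos_left (hx.2 j) hc

end circumPolytope

lemma interior_unitBall {n : ℕ} : interior (unitBall n) = Metric.ball (0 : Euc n) 1 :=
  interior_closedBall _ one_ne_zero

lemma frontier_unitBall {n : ℕ} : frontier (unitBall n) = Metric.sphere (0 : Euc n) 1 :=
  frontier_closedBall _ one_ne_zero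

lemma volume_unitBall_lt_top {n : ℕ} : volume (unitBall n) < ∞ :=
  measure_closedBall_lt_top

lemma vol_unitBall_pos (n : ℕ) : 0 < vol (unitBall n) :=
  ENNReal.toReal_pos (Metric.measure_closedBall_pos volume _ one_pos).ne' volume_unitBall_lt_top.ne

lemma surfaceArea_unitBall {n : ℕ} (hn : 1 ≤ n) :
    surfaceArea (unitBall n) = n * vol (unitBall n) := by
  have h := sphere_area_eq hn (IsConical.compl_zero (n := n))
  have h1 : Metric.sphere (0 : Euc n) 1 ∩ {0}ᶜ = Metric.sphere (0 : Euc n) 1 := by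
    refine inter_eq_left.2 fun x hx hx0 => ?_
    rw [mem_singleton_iff.1 hx0] at hx
    simp at hx
  have h2 : volume (unitBall n ∩ {0}ᶜ) = volume (unitBall n) := by
    have : Nonempty (Fin n) := ⟨⟨0, hn⟩⟩
    rw [← sdiff_eq, measure_sdiff_null (measure_singleton _)]
  rw [h1, h2] at h
  rw [surfaceArea, frontier_unitBall, h, vol, ENNReal.toReal_mul, ENNReal.toReal_natCast]

/-- For a polytope with all facets at distance `t` from the origin, the surface area deviation from
the ball is controlled by the volume deviation. -/
lemma surfDev_circumPolytope_le {n : ℕ} {ι : Type*} [Fintype ι] {u : ι → Euc n} {t : ℝ}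
    (hn : 1 ≤ n) (hu : ∀ i, ‖u i‖ = 1) (ht : 0 < t) (ht1 : t ≤ 1)
    (hb : Bornology.IsBounded (circumPolytope u t)) :
    surfDev (circumPolytope u t) (unitBall n) ≤
      n * volDiff (circumPolytope u t) (unitBall n) +
        (1 / t - 1) * n * (vol (unitBall n) + volDiff (circumPolytope u t) (unitBall n)) := by
  set P := circumPolytope u t with hP
  set D := unitBall n with hD
  set μ : Measure (Euc n) := Measure.euclideanHausdorffMeasure (n - 1) with hμ
  set S := Metric.sphere (0 : Euc n) 1 with hS
  set B := outerDirections u t with hBdef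
  have hB : IsConical B := isConical_outerDirections
  set B' := ({0}ᶜ : Set (Euc n)) \ B with hB'def
  have hB' : IsConical B' := IsConical.compl_zero.diff hB
  have hvP : volume P < ∞ := hb.measure_lt_top
  have hvD : volume D < ∞ := volume_unitBall_lt_top
  have hPc : IsClosed P := isClosed_circumPolytope
  have hDc : IsClosed D := Metric.isClosed_closedBall
  have hmemD : ∀ x, x ∈ D ↔ ‖x‖ ≤ 1 := fun x => by rw [hD, unitBall_eq]; rfl
  have hmemS : ∀ x, x ∈ S ↔ ‖x‖ = 1 := fun x => by simp [hS]
  -- The four pieces of the two boundaries, in terms of volumes.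
  have areaP : ∀ A, IsConical A → (μ (frontier P ∩ A)).toReal =
      n / t * (volume (P ∩ A)).toReal ∧ μ (frontier P ∩ A) < ∞ := by
    intro A hA
    have h := circumPolytope_area_eq hn hu ht hb hA
    have hfin : n * volume (P ∩ A) < ∞ :=
      ENNReal.mul_lt_top (by simp) ((measure_mono inter_subset_left).trans_lt hvP)
    constructor
    · have := congrArg ENNReal.toReal h
      rw [ENNReal.toReal_mul, ENNReal.toReal_mul, ENNReal.toReal_ofReal ht.le,
        ENNReal.toReal_natCast] at this
      field_simp
      linarith
    · rw [← h] at hfin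
      by_contra hcon
      rw [not_lt, top_le_iff] at hcon
      rw [hcon, ENNReal.mul_top (by simpa using ht)] at hfin
      exact lt_irrefl _ hfin
  have areaS : ∀ A, IsConical A → (μ (S ∩ A)).toReal = n * (volume (D ∩ A)).toReal ∧
      μ (S ∩ A) < ∞ := by
    intro A hA
    have h := sphere_area_eq hn hA
    rw [hμ, h, ENNReal.toReal_mul, ENNReal.toReal_natCast]
    exact ⟨rfl, ENNReal.mul_lt_top (by simp) ((measure_mono inter_subset_left).trans_lt hvD)⟩
  have hB'mem : ∀ x, x ∈ B' ↔ x ≠ 0 ∧ ∃ i, t * ‖x‖ ≤ inner ℝ (u i) x := by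
    intro x
    simp only [hB'def, hBdef, outerDirections, mem_sdiff, mem_compl_iff, mem_singleton_iff,
      mem_ofPred_eq, not_and, not_forall, not_lt]
    exact ⟨fun h => ⟨h.1, h.2 h.1⟩, fun h => ⟨h.1, fun _ => h.2⟩⟩
  have hfrP : ∀ x, x ∈ frontier P ↔ (∀ i, inner ℝ (u i) x ≤ t) ∧ ∃ i, inner ℝ (u i) x = t :=
    fun x => mem_frontier_circumPolytope ht
  have hintP : interior P = {x | ∀ i, inner ℝ (u i) x < t} := interior_circumPolytope ht
  -- Upper bound for the boundary of the union.
  have hunion : frontier (P ∪ D) ⊆ (frontier P ∩ B) ∪ (S ∩ B') := by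
    intro x hx
    rw [frontier, (hPc.union hDc).closure_eq] at hx
    obtain ⟨hx1, hx2⟩ := hx
    have hxP : x ∉ interior P := fun h => hx2 (interior_mono subset_union_left h)
    have hxD : x ∉ Metric.ball (0 : Euc n) 1 := fun h =>
      hx2 (interior_mono subset_union_right (interior_unitBall ▸ h))
    have hx1n : 1 ≤ ‖x‖ := by simpa using hxD
    have hx0 : x ≠ 0 := fun h => by simp [h] at hx1n; linarith
    rw [hintP] at hxP
    simp only [mem_ofPred_eq, not_forall, not_lt] at hxP
    obtain ⟨i, hi⟩ := hxP
    by_cases hxDm : x ∈ D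
    · have hx1' : ‖x‖ = 1 := le_antisymm ((hmemD x).1 hxDm) hx1n
      exact Or.inr ⟨(hmemS x).2 hx1', (hB'mem x).2 ⟨hx0, i, by rw [hx1']; linarith⟩⟩
    · have hxPm : x ∈ P := hx1.resolve_right hxDm
      rw [hmemD, not_le] at hxDm
      refine Or.inl ⟨(hfrP x).2 ⟨hxPm, i, le_antisymm (hxPm i) hi⟩, hx0, fun j => ?_⟩
      have := hxPm j
      nlinarith
  -- Lower bound for the boundary of the intersection.
  have hinter : (frontier P ∩ B') ∪ (S ∩ B) ⊆ frontier (P ∩ D) := by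
    rintro x (⟨h1, h2⟩ | ⟨h1, h2⟩)
    · have hx := (hfrP x).1 h1
      obtain ⟨hx0, i, hi⟩ := (hB'mem x).1 h2
      rw [frontier, (hPc.inter hDc).closure_eq]
      refine ⟨⟨hx.1, (hmemD x).2 ?_⟩, fun h => ?_⟩
      · have := hx.1 i
        nlinarith
      · exact h1.2 (interior_mono inter_subset_left h)
    · have hx1 := (hmemS x).1 h1
      rw [frontier, (hPc.inter hDc).closure_eq]
      refine ⟨⟨fun i => ?_, (hmemD x).2 hx1.le⟩, fun h => ?_⟩
      · have := h2.2 i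
        rw [hx1] at this; linarith
      · have := interior_mono inter_subset_right h
        rw [hD, interior_unitBall] at this
        simp [hx1] at this
  have hdisj : Disjoint (frontier P ∩ B') (S ∩ B) :=
    disjoint_left.2 fun x h1 h2 => h1.2.2 h2.2
  have hfin : μ (frontier (P ∩ D)) < ∞ := by
    have hsub : frontier (P ∩ D) ⊆ (frontier P ∩ {0}ᶜ) ∪ (S ∩ {0}ᶜ) := by
      intro x hx
      have h0 : x ≠ 0 := by
        rintro rfl
        refine hx.2 ?_
        rw [interior_inter, hintP, hD, interior_unitBall]
        exact ⟨fun i => by simpa using ht, by simp⟩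
      rcases frontier_inter_subset P D hx with h | h
      · exact Or.inl ⟨h.1, h0⟩
      · exact Or.inr ⟨by rw [hS, ← frontier_unitBall]; exact h.2, h0⟩
    refine (measure_mono hsub).trans_lt ((measure_union_le _ _).trans_lt ?_)
    exact ENNReal.add_lt_top.2 ⟨(areaP _ .compl_zero).2, (areaS _ .compl_zero).2⟩
  have hU : surfaceArea (P ∪ D) ≤
      n / t * (volume (P ∩ B)).toReal + n * (volume (D ∩ B')).toReal := by
    rw [← (areaP B hB).1, ← (areaS B' hB').1,
      ← ENNReal.toReal_add (areaP B hB).2.ne (areaS B' hB').2.ne]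
    exact ENNReal.toReal_mono (ENNReal.add_lt_top.2 ⟨(areaP B hB).2, (areaS B' hB').2⟩).ne
      ((measure_mono hunion).trans (measure_union_le _ _))
  have hI : n / t * (volume (P ∩ B')).toReal + n * (volume (D ∩ B)).toReal ≤
      surfaceArea (P ∩ D) := by
    rw [← (areaP B' hB').1, ← (areaS B hB).1,
      ← ENNReal.toReal_add (areaP B' hB').2.ne (areaS B hB).2.ne,
      ← measure_union hdisj (by
        exact Metric.isClosed_sphere.measurableSet.inter hB.measurableSet)]
    exact ENNReal.toReal_mono hfin.ne (measure_mono hinter)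
  -- The volumes of the parts of `P \ D` and `D \ P`.
  have hDB : D ∩ B ⊆ P ∩ B := by
    rintro x ⟨hx, hxB⟩
    refine ⟨fun i => ?_, hxB⟩
    have := hxB.2 i
    have := (hmemD x).1 hx
    nlinarith
  have hPB : P ∩ B' ⊆ D ∩ B' := by
    rintro x ⟨hx, hxB⟩
    obtain ⟨hx0, i, hi⟩ := (hB'mem x).1 hxB
    refine ⟨(hmemD x).2 ?_, hxB⟩
    have := hx i
    nlinarith
  have hfi : ∀ {A A' : Set (Euc n)}, volume A < ∞ → volume (A ∩ A') ≠ ∞ := fun h =>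
    ((measure_mono inter_subset_left).trans_lt h).ne
  have hmP : MeasurableSet P := hPc.measurableSet
  have hmD : MeasurableSet D := hDc.measurableSet
  have hsum : ((volume (P ∩ B)).toReal - (volume (D ∩ B)).toReal) +
      ((volume (D ∩ B')).toReal - (volume (P ∩ B')).toReal) ≤ volDiff P D := by
    have e1 : (volume ((P ∩ B) \ (D ∩ B))).toReal =
        (volume (P ∩ B)).toReal - (volume (D ∩ B)).toReal :=
      measureReal_sdiff hDB (hmD.inter hB.measurableSet) (hfi hvP)
    have e2 : (volume ((D ∩ B') \ (P ∩ B'))).toReal =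
        (volume (D ∩ B')).toReal - (volume (P ∩ B')).toReal :=
      measureReal_sdiff hPB (hmP.inter hB'.measurableSet) (hfi hvD)
    rw [← e1, ← e2, volDiff, vol, ← ENNReal.toReal_add, ← measure_union]
    · refine ENNReal.toReal_mono ?_ (measure_mono ?_)
      · exact ((measure_mono (symmDiff_subset_union)).trans_lt
          ((measure_union_le _ _).trans_lt (ENNReal.add_lt_top.2 ⟨hvP, hvD⟩))).ne
      · rintro x (⟨⟨h1, h2⟩, h3⟩ | ⟨⟨h1, h2⟩, h3⟩)
        · exact Or.inl ⟨h1, fun h => h3 ⟨h, h2⟩⟩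
        · exact Or.inr ⟨h1, fun h => h3 ⟨h, h2⟩⟩
    · exact disjoint_left.2 fun x h1 h2 => h2.1.2.2 h1.1.2
    · exact (hmD.inter hB'.measurableSet).diff (hmP.inter hB'.measurableSet)
    · exact ((measure_mono sdiff_subset).trans_lt (hfi hvP).lt_top).ne
    · exact ((measure_mono sdiff_subset).trans_lt (hfi hvD).lt_top).ne
  have hPle : (volume (P ∩ B)).toReal ≤ vol D + volDiff P D := by
    have h1 : P ∩ B ⊆ D ∪ (P ∆ D) := by
      rintro x ⟨hx, -⟩
      by_cases h : x ∈ D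
      · exact Or.inl h
      · exact Or.inr (Or.inl ⟨hx, h⟩)
    have hsd : volume (P ∆ D) < ∞ := (measure_mono (symmDiff_subset_union)).trans_lt
          ((measure_union_le _ _).trans_lt (ENNReal.add_lt_top.2 ⟨hvP, hvD⟩))
    rw [vol, volDiff, vol, ← ENNReal.toReal_add hvD.ne hsd.ne]
    exact ENNReal.toReal_mono (ENNReal.add_lt_top.2 ⟨hvD, hsd⟩).ne
      ((measure_mono h1).trans (measure_union_le _ _))
  set p₁ := (volume (P ∩ B)).toReal
  set p₂ := (volume (P ∩ B')).toReal with hp₂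
  set d₁ := (volume (D ∩ B)).toReal
  set d₂ := (volume (D ∩ B')).toReal
  have hp2 : 0 ≤ p₂ := ENNReal.toReal_nonneg
  have ht' : 0 ≤ 1 / t - 1 := by
    rw [sub_nonneg, le_div_iff₀ ht]; linarith
  have hn0 : (0 : ℝ) ≤ n := Nat.cast_nonneg n
  have e : surfDev P D ≤ n * ((p₁ - d₁) + (d₂ - p₂)) + (1 / t - 1) * n * (p₁ - p₂) := by
    have : n * ((p₁ - d₁) + (d₂ - p₂)) + (1 / t - 1) * n * (p₁ - p₂) =
        (n / t * p₁ + n * d₂) - (n / t * p₂ + n * d₁) := by ring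
    rw [this, surfDev]
    linarith
  refine e.trans (add_le_add (mul_le_mul_of_nonneg_left hsum hn0)
    (mul_le_mul_of_nonneg_left ?_ (mul_nonneg ht' hn0)))
  linarith

/-! ### Counting facets -/

section facets

variable {n : ℕ} {ι : Type*} {u : ι → Euc n} {t : ℝ}

/-- Every facet of `circumPolytope u t` lies in one of the bounding hyperplanes. The barycenter of
affinely independent points spanning the facet is a boundary point, and a constraint active at it
is active at all of these points. -/
lemma facet_subset_hyperplane [Fintype ι] (ht : 0 < t) {F : Set (Euc n)}
    (hF : F ∈ facets (circumPolytope u t)) : ∃ i, ∀ x ∈ F, inner ℝ (u i) x = t := by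
  obtain ⟨hne, hexp, hdim⟩ := hF
  have hPconv : Convex ℝ (circumPolytope u t) := by
    intro x hx y hy a b ha hb hab i
    rw [inner_add_right, inner_smul_right, inner_smul_right]
    nlinarith [mul_le_mul_of_nonneg_left (hx i) ha, mul_le_mul_of_nonneg_left (hy i) hb]
  obtain ⟨l, hl⟩ := hexp hne
  have h0int : (0 : Euc n) ∈ interior (circumPolytope u t) := by
    rw [interior_circumPolytope ht]
    exact fun i => by simpa using ht
  have hl0 : l ≠ 0 := by
    rintro rfl
    have hFP : F = circumPolytope u t := by rw [hl]; ext x; simp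
    have htop : vectorSpan ℝ F = ⊤ := by
      rw [← direction_affineSpan, hFP,
        (affineSpan_eq_top_of_nonempty_interior
          ⟨0, interior_mono (subset_convexHull ℝ _) h0int⟩), AffineSubspace.direction_top]
    rw [htop, finrank_top, finrank_euclideanSpace_fin] at hdim
    omega
  obtain ⟨T, hTF, hTspan, hTind⟩ := exists_affineIndependent ℝ (Euc n) F
  have hTfin : T.Finite := finite_set_of_fin_dim_affineIndependent ℝ hTind
  have hTne : T.Nonempty := by
    rw [← affineSpan_nonempty ℝ, hTspan]
    exact hne.affineSpan ℝ
  have hFconv : Convex ℝ F := hexp.convex hPconv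
  set S := hTfin.toFinset with hS
  have hSne : S.Nonempty := by simpa [hS] using hTne
  have hk : (0 : ℝ) < S.card := by exact_mod_cast hSne.card_pos
  set z : Euc n := ∑ p ∈ S, (S.card : ℝ)⁻¹ • p with hz
  have hzF : z ∈ F := hFconv.sum_mem (fun _ _ => by positivity)
    (by rw [Finset.sum_const, nsmul_eq_mul, mul_inv_cancel₀ hk.ne'])
    (fun p hp => hTF (by simpa [hS] using hp))
  have hzmax : z ∈ circumPolytope u t ∧ ∀ y ∈ circumPolytope u t, l y ≤ l z := by
    rw [hl] at hzF; exact hzF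
  have hzint : z ∉ interior (circumPolytope u t) := by
    intro hzi
    apply hl0
    have hloc : IsLocalMax l z := by
      filter_upwards [mem_interior_iff_mem_nhds.1 hzi] with y hy using hzmax.2 y hy
    have := hloc.hasFDerivAt_eq_zero l.hasFDerivAt
    exact this
  rw [interior_circumPolytope ht] at hzint
  simp only [mem_ofPred_eq, not_forall, not_lt] at hzint
  obtain ⟨i, hi⟩ := hzint
  refine ⟨i, ?_⟩
  have hle : ∀ p ∈ S, inner ℝ (u i) p ≤ t := fun p hp => by
    have : p ∈ F := hTF (by simpa [hS] using hp)
    rw [hl] at this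
    exact this.1 i
  have hsum : ∑ p ∈ S, inner ℝ (u i) p = ∑ p ∈ S, t := by
    apply le_antisymm (Finset.sum_le_sum hle)
    have : inner ℝ (u i) z = (S.card : ℝ)⁻¹ * ∑ p ∈ S, inner ℝ (u i) p := by
      rw [hz, inner_sum, Finset.mul_sum]
      simp only [inner_smul_right]
    rw [this, inv_mul_eq_div, le_div_iff₀ hk] at hi
    rw [Finset.sum_const, nsmul_eq_mul]
    linarith
  have hall := (Finset.sum_eq_sum_iff_of_le hle).1 hsum
  let A : AffineSubspace ℝ (Euc n) :=
    AffineSubspace.mk' z (LinearMap.ker (innerSL ℝ (u i)).toLinearMap)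
  have hzt : inner ℝ (u i) z = t := le_antisymm (hzmax.1 i) hi
  have hA : ∀ x, x ∈ A ↔ inner ℝ (u i) x = t := by
    intro x
    simp [A, AffineSubspace.mem_mk', inner_sub_right, hzt, sub_eq_zero]
  intro x hx
  rw [← hA]
  have : affineSpan ℝ T ≤ A := affineSpan_le.2 fun p hp =>
    (hA p).2 (hall p (by simpa [hS] using hp))
  exact this (hTspan ▸ subset_affineSpan ℝ F hx)

/-- A facet is determined by the bounding hyperplane containing it, so there are at most as many
facets as half-spaces. -/
lemma facet_eq_inter_hyperplane [Fintype ι] (hu : ∀ i, ‖u i‖ = 1) (ht : 0 < t) {F : Set (Euc n)}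
    (hF : F ∈ facets (circumPolytope u t)) :
    ∃ i, F = circumPolytope u t ∩ {x | inner ℝ (u i) x = t} := by
  obtain ⟨i, hi⟩ := facet_subset_hyperplane ht hF
  obtain ⟨hne, hexp, hdim⟩ := hF
  obtain ⟨l, hl⟩ := hexp hne
  refine ⟨i, Subset.antisymm (fun x hx => ⟨hexp.subset hx, hi x hx⟩) ?_⟩
  rintro y ⟨hyP, hy⟩
  have hy : inner ℝ (u i) y = t := hy
  obtain ⟨x, hx⟩ := hne
  have hui : u i ≠ 0 := fun h => by simpa [h] using hu i
  -- The direction of the facet is the whole orthogonal complement of `u i`.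
  have hle : vectorSpan ℝ F ≤ (ℝ ∙ u i)ᗮ := by
    rw [vectorSpan_def, Submodule.span_le]
    rintro _ ⟨a, ha, b, hb, rfl⟩
    simp [Submodule.mem_orthogonal_singleton_iff_inner_right, inner_sub_right, hi a ha, hi b hb]
  have hfr : Module.finrank ℝ ((ℝ ∙ u i)ᗮ : Submodule ℝ (Euc n)) + 1 = n := by
    have := (ℝ ∙ u i).finrank_add_finrank_orthogonal
    rw [finrank_span_singleton hui, finrank_euclideanSpace_fin] at this
    omega
  have heq : vectorSpan ℝ F = (ℝ ∙ u i)ᗮ := Submodule.eq_of_le_of_finrank_eq hle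
    (Nat.add_right_cancel (hdim.trans hfr.symm))
  have hlF : vectorSpan ℝ F ≤ LinearMap.ker l.toLinearMap := by
    rw [vectorSpan_def, Submodule.span_le]
    rintro _ ⟨a, ha, b, hb, rfl⟩
    rw [hl] at ha hb
    have h1 := ha.2 b hb.1
    have h2 := hb.2 a ha.1
    simp only [vsub_eq_sub, SetLike.mem_coe, LinearMap.mem_ker, ContinuousLinearMap.coe_coe,
      map_sub]
    linarith
  have hyx : y - x ∈ vectorSpan ℝ F := by
    rw [heq, Submodule.mem_orthogonal_singleton_iff_inner_right, inner_sub_right, hy, hi x hx,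
      sub_self]
  have hlyx : l y = l x := by
    have := hlF hyx
    simp only [LinearMap.mem_ker, ContinuousLinearMap.coe_coe, map_sub] at this
    linarith
  rw [hl] at hx ⊢
  exact ⟨hyP, fun w hw => hlyx ▸ hx.2 w hw⟩

lemma encard_facets_le [Fintype ι] (hu : ∀ i, ‖u i‖ = 1) (ht : 0 < t) :
    (facets (circumPolytope u t)).encard ≤ Fintype.card ι := by
  have hsub : facets (circumPolytope u t) ⊆
      (fun i => circumPolytope u t ∩ {x | inner ℝ (u i) x = t}) '' univ := by
    intro F hF
    obtain ⟨i, hi⟩ := facet_eq_inter_hyperplane hu ht hF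
    exact ⟨i, mem_univ _, hi.symm⟩
  refine (encard_le_encard hsub).trans ((encard_image_le _ _).trans ?_)
  rw [encard_univ, ENat.card_eq_coe_fintype_card]

lemma circumPolytope_mem_polytopesWithAtMost [Fintype ι] (hu : ∀ i, ‖u i‖ = 1) (ht : 0 < t)
    (hb : Bornology.IsBounded (circumPolytope u t)) {N : ℕ} (hN : Fintype.card ι ≤ N) :
    circumPolytope u t ∈ polytopesWithAtMost n N := by
  classical
  refine ⟨⟨⟨Finset.univ.image fun i => (u i, t), ?_, ?_⟩, hb, 0, ?_⟩,
    (encard_facets_le hu ht).trans (by exact_mod_cast hN)⟩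
  · intro p hp
    obtain ⟨i, -, rfl⟩ := Finset.mem_image.1 hp
    intro h
    have h : u i = 0 := h
    simpa [h] using hu i
  · ext x
    simp [circumPolytope]
  · rw [interior_circumPolytope ht]
    exact fun i => by simpa using ht

end facets

/-! ### Spherical sectors -/

/-- The hyperplanes orthogonal to a unit vector are isometric copies of `ℝⁿ⁻¹`. -/
lemma exists_isometry_hyperplane {n : ℕ} {e : Euc n} (he : ‖e‖ = 1) (y : ℝ) :
    ∃ f : Euc (n - 1) → Euc n, Isometry f ∧ range f = {x | inner ℝ e x = y} ∧
      ∀ z, ‖f z‖ ^ 2 = y ^ 2 + ‖z‖ ^ 2 := by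
  have he0 : e ≠ 0 := fun h => by simp [h] at he
  have hfr : Module.finrank ℝ ((ℝ ∙ e)ᗮ : Submodule ℝ (Euc n)) = n - 1 := by
    have := (ℝ ∙ e).finrank_add_finrank_orthogonal
    rw [finrank_span_singleton he0, finrank_euclideanSpace_fin] at this
    omega
  let g : Euc (n - 1) ≃ₗᵢ[ℝ] ((ℝ ∙ e)ᗮ : Submodule ℝ (Euc n)) :=
    ((stdOrthonormalBasis ℝ ((ℝ ∙ e)ᗮ : Submodule ℝ (Euc n))).reindex (finCongr hfr)).repr.symm
  have hg : ∀ z, inner ℝ e (g z : Euc n) = 0 := fun z =>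
    Submodule.mem_orthogonal_singleton_iff_inner_right.1 (g z).2
  refine ⟨fun z => (g z : Euc n) + y • e, ?_, ?_, ?_⟩
  · refine Isometry.of_dist_eq fun a b => ?_
    rw [dist_add_right, ← Subtype.dist_eq, g.dist_map]
  · ext x
    constructor
    · rintro ⟨z, rfl⟩
      simp [inner_add_right, hg, inner_smul_right, he]
    · intro hx
      have hx : inner ℝ e x = y := hx
      have hmem : x - y • e ∈ (ℝ ∙ e)ᗮ := by
        rw [Submodule.mem_orthogonal_singleton_iff_inner_right]
        simp [inner_sub_right, inner_smul_right, hx, he]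
      exact ⟨g.symm ⟨_, hmem⟩, by simp⟩
  · intro z
    have hgn : ‖(g z : Euc n)‖ = ‖z‖ := g.norm_map z
    rw [norm_add_sq_real, inner_smul_right, real_inner_comm, hg, norm_smul, he, hgn,
      Real.norm_eq_abs, mul_one, sq_abs]
    ring

/-- The area of the closed disc of radius `ρ` in a hyperplane. -/
lemma area_closedDisc {n : ℕ} {e : Euc n} (he : ‖e‖ = 1) (y : ℝ) {ρ : ℝ} (hρ : 0 ≤ ρ) :
    Measure.euclideanHausdorffMeasure (n - 1)
      {x : Euc n | inner ℝ e x = y ∧ ‖x‖ ^ 2 ≤ y ^ 2 + ρ ^ 2} =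
      ENNReal.ofReal ρ ^ (n - 1) * volume (unitBall (n - 1)) := by
  obtain ⟨f, hf, hrange, hnorm⟩ := exists_isometry_hyperplane he y
  have : {x : Euc n | inner ℝ e x = y ∧ ‖x‖ ^ 2 ≤ y ^ 2 + ρ ^ 2} =
      f '' Metric.closedBall 0 ρ := by
    ext x
    constructor
    · rintro ⟨h1, h2⟩
      have : x ∈ range f := hrange ▸ h1
      obtain ⟨z, rfl⟩ := this
      refine ⟨z, ?_, rfl⟩
      rw [hnorm] at h2
      simpa using le_of_sq_le_sq (by linarith) hρ
    · rintro ⟨z, hz, rfl⟩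
      have hz : ‖z‖ ≤ ρ := by simpa using hz
      refine ⟨?_, ?_⟩
      · have : f z ∈ range f := mem_range_self z
        rw [hrange] at this
        exact this
      · rw [hnorm]
        have := pow_le_pow_left₀ (norm_nonneg z) hz 2
        linarith
  rw [this, hf.euclideanHausdorffMeasure_image, EuclideanSpace.euclideanHausdorffMeasure_eq_volume,
    Measure.addHaar_closedBall' _ _ hρ, finrank_euclideanSpace_fin, ENNReal.ofReal_pow hρ, unitBall]

lemma area_openDisc {n : ℕ} (hn : 2 ≤ n) {e : Euc n} (he : ‖e‖ = 1) (y : ℝ) {ρ : ℝ} (hρ : 0 ≤ ρ) :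
    Measure.euclideanHausdorffMeasure (n - 1)
      {x : Euc n | inner ℝ e x = y ∧ ‖x‖ ^ 2 < y ^ 2 + ρ ^ 2} =
      ENNReal.ofReal ρ ^ (n - 1) * volume (unitBall (n - 1)) := by
  obtain ⟨f, hf, hrange, hnorm⟩ := exists_isometry_hyperplane he y
  have himg : {x : Euc n | inner ℝ e x = y ∧ ‖x‖ ^ 2 < y ^ 2 + ρ ^ 2} =
      f '' Metric.ball 0 ρ := by
    ext x
    constructor
    · rintro ⟨h1, h2⟩
      have : x ∈ range f := hrange ▸ h1
      obtain ⟨z, rfl⟩ := this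
      refine ⟨z, ?_, rfl⟩
      rw [hnorm] at h2
      simpa using lt_of_pow_lt_pow_left₀ 2 hρ (by linarith)
    · rintro ⟨z, hz, rfl⟩
      have hz : ‖z‖ < ρ := by simpa using hz
      refine ⟨?_, ?_⟩
      · have : f z ∈ range f := mem_range_self z
        rw [hrange] at this
        exact this
      · rw [hnorm]
        have := pow_lt_pow_left₀ hz (norm_nonneg z) two_ne_zero
        linarith
  have : Nonempty (Fin (n - 1)) := ⟨⟨0, by omega⟩⟩
  rw [himg, hf.euclideanHausdorffMeasure_image,
    EuclideanSpace.euclideanHausdorffMeasure_eq_volume, ← Measure.addHaar_closedBall_eq_addHaar_ball,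
    Measure.addHaar_closedBall' _ _ hρ, finrank_euclideanSpace_fin, ENNReal.ofReal_pow hρ, unitBall]

/-- The ball lies in a cylinder of height `2` over its equatorial disc. -/
lemma volume_unitBall_le {n : ℕ} (hn : 1 ≤ n) :
    volume (unitBall n) ≤ 2 * volume (unitBall (n - 1)) := by
  set e : Euc n := EuclideanSpace.single ⟨0, hn⟩ 1 with he
  have he1 : ‖e‖ = 1 := by simp [he]
  rw [volume_eq_lintegral_slices e he1 (T := unitBall n) Metric.isClosed_closedBall.measurableSet]
  calc _ ≤ ∫⁻ y : ℝ, (Icc (-1) 1).indicator (fun _ => volume (unitBall (n - 1))) y := by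
        refine lintegral_mono fun y => ?_
        by_cases hy : y ∈ Icc (-1 : ℝ) 1
        · rw [indicator_of_mem hy]
          refine (measure_mono ?_).trans
            (area_closedDisc he1 y zero_le_one).le |>.trans (by simp)
          rintro x ⟨hx, hxy⟩
          rw [unitBall_eq] at hx
          have hx : ‖x‖ ≤ 1 := hx
          exact ⟨hxy, by nlinarith [norm_nonneg x, sq_nonneg y]⟩
        · rw [indicator_of_notMem hy, nonpos_iff_eq_zero]
          convert measure_empty (μ := Measure.euclideanHausdorffMeasure (X := Euc n) (n - 1))
          rw [eq_empty_iff_forall_notMem]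
          rintro x ⟨hx, hxy⟩
          rw [unitBall_eq] at hx
          have hx : ‖x‖ ≤ 1 := hx
          have hxy : inner ℝ e x = y := hxy
          have := abs_real_inner_le_norm e x
          rw [he1, one_mul, hxy] at this
          exact hy (abs_le.1 (this.trans hx))
    _ = _ := by
        rw [lintegral_indicator measurableSet_Icc, setLIntegral_const, Real.volume_Icc, mul_comm]
        norm_num

/-- `√(1 - y²)ⁿ⁻¹`: the area of the section of the unit ball at height `y`, relative to
the volume of the `(n-1)`-dimensional unit ball. -/
noncomputable def sectionProfile (n : ℕ) (y : ℝ) : ℝ := Real.sqrt (1 - y ^ 2) ^ (n - 1)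

/-- The volume of the spherical sector `{y ∈ D_n | s ‖y‖ < ⟪e, y⟫}` relative to that of the
`(n-1)`-dimensional unit ball: a cone over a disc at height `s` plus the cap above it. -/
noncomputable def sectorProfile (n : ℕ) (s : ℝ) : ℝ :=
  s * sectionProfile n s / n + ∫ y in s..1, sectionProfile n y

lemma continuous_sectionProfile (n : ℕ) : Continuous (sectionProfile n) := by
  unfold sectionProfile; fun_prop

lemma sectionProfile_nonneg (n : ℕ) (y : ℝ) : 0 ≤ sectionProfile n y := by
  unfold sectionProfile; positivity

lemma sectionProfile_pos (n : ℕ) {y : ℝ} (h0 : 0 ≤ y) (h1 : y < 1) : 0 < sectionProfile n y := by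
  have : 0 < 1 - y ^ 2 := by nlinarith
  unfold sectionProfile; positivity

lemma sectionProfile_one {n : ℕ} (hn : 2 ≤ n) : sectionProfile n 1 = 0 := by
  simp [sectionProfile]; omega

lemma sectorProfile_one {n : ℕ} (hn : 2 ≤ n) : sectorProfile n 1 = 0 := by
  simp [sectorProfile, sectionProfile_one hn]

lemma hasDerivAt_sectionProfile (n : ℕ) {y : ℝ} (h0 : 0 < y) (h1 : y < 1) :
    HasDerivAt (sectionProfile n)
      (-((n - 1 : ℕ) * y * sectionProfile n y / (1 - y ^ 2))) y := by
  have hpos : 0 < 1 - y ^ 2 := by nlinarith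
  have hq : 0 < Real.sqrt (1 - y ^ 2) := Real.sqrt_pos.2 hpos
  have h2 : HasDerivAt (fun y : ℝ => 1 - y ^ 2) (-(2 * y)) y := by
    simpa using ((hasDerivAt_id y).pow 2).const_sub 1
  have h3 := (h2.sqrt hpos.ne').pow (n - 1)
  refine h3.congr_deriv ?_
  unfold sectionProfile
  rcases Nat.eq_zero_or_pos (n - 1) with h | h
  · simp [h]
  · obtain ⟨k, hk⟩ := Nat.exists_eq_add_of_le' h
    rw [hk]
    have hsq := Real.sq_sqrt hpos.le
    set q := Real.sqrt (1 - y ^ 2)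
    rw [← hsq]
    simp only [Nat.succ_eq_add_one, Nat.zero_add, Nat.add_sub_cancel]
    field_simp
    ring

lemma hasDerivAt_sectorProfile {n : ℕ} (hn : 1 ≤ n) {s : ℝ} (h0 : 0 < s) (h1 : s < 1) :
    HasDerivAt (sectorProfile n)
      (-((n - 1 : ℕ) / n * sectionProfile n s / (1 - s ^ 2))) s := by
  have hpos : 0 < 1 - s ^ 2 := by nlinarith
  have hc := continuous_sectionProfile n
  have h2 := (((hasDerivAt_id s).mul (hasDerivAt_sectionProfile n h0 h1)).div_const (n : ℝ)).add
    (intervalIntegral.integral_hasDerivAt_left (hc.intervalIntegrable s 1)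
      hc.stronglyMeasurable.stronglyMeasurableAtFilter hc.continuousAt)
  refine h2.congr_deriv ?_
  have hn0 : (n : ℝ) ≠ 0 := by positivity
  have hcast : ((n - 1 : ℕ) : ℝ) = n - 1 := by rw [Nat.cast_sub hn]; simp
  rw [hcast, id_eq]
  field_simp
  ring

lemma continuous_sectorProfile (n : ℕ) : Continuous (sectorProfile n) := by
  have hc := continuous_sectionProfile n
  unfold sectorProfile
  refine ((continuous_id.mul hc).div_const _).add ?_
  have hsymm : (fun s : ℝ => ∫ y in s..1, sectionProfile n y) =
      fun s => -∫ y in (1 : ℝ)..s, sectionProfile n y :=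
    funext fun s => intervalIntegral.integral_symm 1 s
  rw [hsymm]
  exact (intervalIntegral.continuous_primitive (fun a b => hc.intervalIntegrable a b) 1).neg

lemma sectionProfile_div_le_sectorProfile {n : ℕ} (hn : 2 ≤ n) {s : ℝ} (hs : s ∈ Icc (0 : ℝ) 1) :
    sectionProfile n s / n ≤ sectorProfile n s := by
  have hanti : AntitoneOn (fun s => sectorProfile n s - sectionProfile n s / n) (Icc 0 1) := by
    refine antitoneOn_of_hasDerivWithinAt_nonpos (convex_Icc 0 1)
      (f' := fun s => -((n - 1 : ℕ) / n * sectionProfile n s / (1 - s ^ 2)) -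
        -((n - 1 : ℕ) * s * sectionProfile n s / (1 - s ^ 2)) / n)
      ((continuous_sectorProfile n).sub ((continuous_sectionProfile n).div_const _)).continuousOn
      ?_ ?_
    · intro x hx
      rw [interior_Icc] at hx
      exact ((hasDerivAt_sectorProfile (by omega) hx.1 hx.2).sub
        ((hasDerivAt_sectionProfile n hx.1 hx.2).div_const _)).hasDerivWithinAt
    · intro x hx
      rw [interior_Icc] at hx
      have hpos : 0 < 1 - x ^ 2 := by nlinarith [hx.1, hx.2]
      have : -((n - 1 : ℕ) / n * sectionProfile n x / (1 - x ^ 2)) -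
        -((n - 1 : ℕ) * x * sectionProfile n x / (1 - x ^ 2)) / n =
        -((n - 1 : ℕ) / n * sectionProfile n x / (1 - x ^ 2) * (1 - x)) := by ring
      rw [this, neg_nonpos]
      have h1 := sectionProfile_nonneg n x
      have h2 : 0 ≤ 1 - x := by linarith [hx.2]
      positivity
  have := hanti hs (right_mem_Icc.2 zero_le_one) hs.2
  simp only [sectorProfile_one hn, sectionProfile_one hn, zero_div, sub_zero] at this
  linarith

lemma mul_sectorProfile_le {n : ℕ} (hn : 2 ≤ n) {s : ℝ} (h0 : 0 < s) (h1 : s ≤ 1) :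
    s * sectorProfile n s ≤ sectionProfile n s / n := by
  have hanti : AntitoneOn (fun s => sectionProfile n s / n / s - sectorProfile n s) (Icc s 1) := by
    refine antitoneOn_of_hasDerivWithinAt_nonpos (convex_Icc s 1)
      (f' := fun s => ((-((n - 1 : ℕ) * s * sectionProfile n s / (1 - s ^ 2))) / n * s -
        sectionProfile n s / n * 1) / s ^ 2 -
        -((n - 1 : ℕ) / n * sectionProfile n s / (1 - s ^ 2))) ?_ ?_ ?_
    · refine ContinuousOn.sub (ContinuousOn.div ?_ continuousOn_id ?_)
        (continuous_sectorProfile n).continuousOn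
      · exact ((continuous_sectionProfile n).div_const _).continuousOn
      · intro x hx
        exact (h0.trans_le hx.1).ne'
    · intro x hx
      rw [interior_Icc] at hx
      have hx0 := h0.trans hx.1
      exact ((((hasDerivAt_sectionProfile n hx0 hx.2).div_const _).div (hasDerivAt_id x)
        hx0.ne').sub (hasDerivAt_sectorProfile (by omega) hx0 hx.2)).hasDerivWithinAt
    · intro x hx
      rw [interior_Icc] at hx
      have hx0 := h0.trans hx.1
      have hpos : 0 < 1 - x ^ 2 := by nlinarith [hx.1, hx.2]
      have : ((-((n - 1 : ℕ) * x * sectionProfile n x / (1 - x ^ 2))) / n * x -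
        sectionProfile n x / n * 1) / x ^ 2 -
        -((n - 1 : ℕ) / n * sectionProfile n x / (1 - x ^ 2)) =
        -(sectionProfile n x / n / x ^ 2) := by field_simp; ring
      rw [this, neg_nonpos]
      have h1 := sectionProfile_nonneg n x
      positivity
  have := hanti (left_mem_Icc.2 h1) (right_mem_Icc.2 h1) h1
  simp only [sectorProfile_one hn, sectionProfile_one hn, zero_div, sub_zero] at this
  rw [sub_nonneg, le_div_iff₀ h0] at this
  linarith

/-- The ratio `sectorProfile / sectionProfile` is antitone; this makes the comparison of the
measures of two caps with the ratio of their base areas sharp in both directions. -/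
lemma sectorProfile_mul_sectionProfile_le {n : ℕ} (hn : 2 ≤ n) {t s : ℝ} (h0 : 0 < t) (hts : t ≤ s)
    (h1 : s ≤ 1) :
    sectorProfile n s * sectionProfile n t ≤ sectorProfile n t * sectionProfile n s := by
  rcases h1.eq_or_lt with rfl | h1
  · simp [sectorProfile_one hn, sectionProfile_one hn]
  have hanti : AntitoneOn (fun s => sectorProfile n s / sectionProfile n s) (Icc t s) := by
    refine antitoneOn_of_hasDerivWithinAt_nonpos (convex_Icc t s)
      (f' := fun s => (-((n - 1 : ℕ) / n * sectionProfile n s / (1 - s ^ 2)) * sectionProfile n s -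
        sectorProfile n s * -((n - 1 : ℕ) * s * sectionProfile n s / (1 - s ^ 2))) /
          sectionProfile n s ^ 2) ?_ ?_ ?_
    · refine ContinuousOn.div (continuous_sectorProfile n).continuousOn
        (continuous_sectionProfile n).continuousOn ?_
      intro x hx
      exact (sectionProfile_pos n (h0.le.trans hx.1) (hx.2.trans_lt h1)).ne'
    · intro x hx
      rw [interior_Icc] at hx
      have hx0 := h0.trans hx.1
      have hx1 := hx.2.trans h1
      exact ((hasDerivAt_sectorProfile (by omega) hx0 hx1).div
        (hasDerivAt_sectionProfile n hx0 hx1)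
        (sectionProfile_pos n hx0.le hx1).ne').hasDerivWithinAt
    · intro x hx
      rw [interior_Icc] at hx
      have hx0 := h0.trans hx.1
      have hx1 := hx.2.trans h1
      have hpos : 0 < 1 - x ^ 2 := by nlinarith
      have hS := sectionProfile_pos n hx0.le hx1
      have hle := mul_sectorProfile_le hn hx0 hx1.le
      have : (-((n - 1 : ℕ) / n * sectionProfile n x / (1 - x ^ 2)) * sectionProfile n x -
        sectorProfile n x * -((n - 1 : ℕ) * x * sectionProfile n x / (1 - x ^ 2))) =
        -((n - 1 : ℕ) * sectionProfile n x / (1 - x ^ 2) *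
          (sectionProfile n x / n - x * sectorProfile n x)) := by ring
      rw [this]
      refine div_nonpos_of_nonpos_of_nonneg (neg_nonpos.2 ?_) (by positivity)
      have := sub_nonneg.2 hle
      positivity
  have := hanti (left_mem_Icc.2 hts) (right_mem_Icc.2 hts) hts
  simp only at this
  rwa [div_le_div_iff₀ (sectionProfile_pos n (h0.le.trans hts) h1)
    (sectionProfile_pos n h0.le (hts.trans_lt h1))] at this

lemma sectorProfile_nonneg {n : ℕ} (hn : 2 ≤ n) {s : ℝ} (hs : s ∈ Icc (0 : ℝ) 1) :
    0 ≤ sectorProfile n s :=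
  (div_nonneg (sectionProfile_nonneg n s) (Nat.cast_nonneg n)).trans
    (sectionProfile_div_le_sectorProfile hn hs)

/-- The volume of a spherical sector. -/
lemma volume_sector {n : ℕ} (hn : 2 ≤ n) {e : Euc n} (he : ‖e‖ = 1) {s : ℝ} (h0 : 0 < s)
    (h1 : s ≤ 1) :
    volume (unitBall n ∩ {y | s * ‖y‖ < inner ℝ e y}) =
      volume (unitBall (n - 1)) * ENNReal.ofReal (sectorProfile n s) := by
  set C := {y : Euc n | s * ‖y‖ < inner ℝ e y} with hC
  have hCc : IsConical C := isConical_cap e s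
  set κ := volume (unitBall (n - 1)) with hκ
  have hi : Measurable fun x : Euc n => inner ℝ e x :=
    (by fun_prop : Continuous fun x : Euc n => inner ℝ e x).measurable
  have hcs : ∀ x, inner ℝ e x ≤ ‖x‖ := fun x => by
    simpa [he] using real_inner_le_norm e x
  have hs2 : 0 ≤ 1 - s ^ 2 := by nlinarith
  have hsplit : unitBall n ∩ C = ({x | 0 < inner ℝ e x ∧ inner ℝ e x ≤ s} ∩ C) ∪
      (unitBall n ∩ {x | s < inner ℝ e x}) := by
    ext x
    simp only [unitBall_eq, hC, mem_inter_iff, mem_union, mem_ofPred_eq]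
    constructor
    · rintro ⟨hx, hx2⟩
      by_cases h : inner ℝ e x ≤ s
      · exact Or.inl ⟨⟨(by positivity : 0 ≤ s * ‖x‖).trans_lt hx2, h⟩, hx2⟩
      · exact Or.inr ⟨hx, not_le.1 h⟩
    · rintro (⟨⟨_, h⟩, hx2⟩ | ⟨hx, h⟩)
      · refine ⟨?_, hx2⟩
        by_contra hcon
        push Not at hcon
        nlinarith
      · exact ⟨hx, by nlinarith⟩
  have hdisj : Disjoint ({x | 0 < inner ℝ e x ∧ inner ℝ e x ≤ s} ∩ C)
      (unitBall n ∩ {x | s < inner ℝ e x}) :=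
    disjoint_left.2 fun x h1 h2 => not_lt.2 h1.1.2 h2.2
  have hm2 : MeasurableSet (unitBall n ∩ {x | s < inner ℝ e x}) :=
    Metric.isClosed_closedBall.measurableSet.inter (measurableSet_lt measurable_const hi)
  rw [hsplit, measure_union hdisj hm2]
  -- The cone over a disc.
  have hcone : volume ({x | 0 < inner ℝ e x ∧ inner ℝ e x ≤ s} ∩ C) =
      κ * ENNReal.ofReal (s * sectionProfile n s / n) := by
    have h := volume_cone_hyperplane (by omega) he h0 hCc
    have hdisc : ({x | inner ℝ e x = s} ∩ C) =
        {x : Euc n | inner ℝ e x = s ∧ ‖x‖ ^ 2 < s ^ 2 + Real.sqrt (1 - s ^ 2) ^ 2} := by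
      ext x
      rw [Real.sq_sqrt hs2]
      simp only [hC, mem_inter_iff, mem_ofPred_eq]
      constructor
      · rintro ⟨hx, hx2⟩
        have : ‖x‖ < 1 := by rw [hx] at hx2; nlinarith
        exact ⟨hx, by nlinarith [norm_nonneg x]⟩
      · rintro ⟨hx, hx2⟩
        have : ‖x‖ < 1 := by nlinarith [norm_nonneg x]
        exact ⟨hx, by rw [hx]; nlinarith⟩
    rw [hdisc, area_openDisc hn he s (Real.sqrt_nonneg _), ← ENNReal.ofReal_pow (Real.sqrt_nonneg _),
      ← ENNReal.ofReal_natCast] at h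
    have hn0 : (0 : ℝ) < n := by positivity
    have hn0' : ENNReal.ofReal n ≠ 0 := (ENNReal.ofReal_pos.2 hn0).ne'
    have hr : ENNReal.ofReal n * ENNReal.ofReal (s * sectionProfile n s / n) =
        ENNReal.ofReal s * ENNReal.ofReal (sectionProfile n s) := by
      rw [← ENNReal.ofReal_mul hn0.le, ← ENNReal.ofReal_mul h0.le]
      congr 1
      field_simp
    rw [← ENNReal.mul_right_inj hn0' ENNReal.ofReal_ne_top, h,
      mul_left_comm (ENNReal.ofReal (n : ℝ)), hr, sectionProfile]
    ring
  -- The cap.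
  have hcap : volume (unitBall n ∩ {x | s < inner ℝ e x}) =
      κ * ENNReal.ofReal (∫ y in s..1, sectionProfile n y) := by
    rw [volume_eq_lintegral_slices e he hm2, intervalIntegral.integral_of_le h1,
      ofReal_integral_eq_lintegral_ofReal, ← lintegral_const_mul _ (by
        exact (continuous_sectionProfile n).measurable.ennreal_ofReal),
      ← lintegral_indicator measurableSet_Ioc]
    · congr 1
      ext y
      by_cases hy : y ∈ Ioc s 1
      · rw [indicator_of_mem hy]
        have hy2 : 0 ≤ 1 - y ^ 2 := by nlinarith [hy.1, hy.2]
        have hset : (unitBall n ∩ {x | s < inner ℝ e x}) ∩ {x | inner ℝ e x = y} =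
            {x : Euc n | inner ℝ e x = y ∧ ‖x‖ ^ 2 ≤ y ^ 2 + Real.sqrt (1 - y ^ 2) ^ 2} := by
          ext x
          rw [Real.sq_sqrt hy2, unitBall_eq]
          simp only [mem_inter_iff, mem_ofPred_eq]
          constructor
          · rintro ⟨⟨hx, _⟩, hx2⟩
            exact ⟨hx2, by nlinarith [norm_nonneg x]⟩
          · rintro ⟨hx, hx2⟩
            exact ⟨⟨by nlinarith [norm_nonneg x], hx ▸ hy.1⟩, hx⟩
        rw [hset, area_closedDisc he y (Real.sqrt_nonneg _), sectionProfile,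
          ENNReal.ofReal_pow (Real.sqrt_nonneg _), mul_comm]
      · rw [indicator_of_notMem hy]
        convert measure_empty (μ := Measure.euclideanHausdorffMeasure (X := Euc n) (n - 1))
        rw [eq_empty_iff_forall_notMem]
        rintro x ⟨⟨hx, hx2⟩, hxy⟩
        rw [unitBall_eq] at hx
        have hx : ‖x‖ ≤ 1 := hx
        have hxy : inner ℝ e x = y := hxy
        exact hy ⟨hxy ▸ hx2, hxy ▸ (hcs x).trans hx⟩
    · exact (continuous_sectionProfile n).integrableOn_Icc.mono_set Ioc_subset_Icc_self
    · exact .of_forall fun y => sectionProfile_nonneg n y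
  rw [hcone, hcap, ← mul_add, ← ENNReal.ofReal_add, sectorProfile]
  · have := sectionProfile_nonneg n s
    positivity
  · exact intervalIntegral.integral_nonneg h1 fun y _ => sectionProfile_nonneg n y

/-! ### The first moment method -/

/-- First moment method: for `M` independent random half-spaces `{⟪ω i, x⟫ ≤ t ‖ω i‖}`, some
realization does not exceed the expected volume of the part of `A` cut off by them and of the part
of `A'` left over by them. -/
lemma exists_halfspaces_le {n : ℕ} (ν : Measure (Euc n)) [IsProbabilityMeasure ν] (hν : ν {0} = 0)
    (M : ℕ) (t : ℝ) {A A' : Set (Euc n)} (hA : MeasurableSet A) (hA' : MeasurableSet A')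
    (hAfin : volume A < ∞) (hA'fin : volume A' < ∞) {Φ Φ' : Euc n → ℝ≥0∞}
    (hΦ : ∀ x ∈ A, 1 - ν {y | inner ℝ y x ≤ t * ‖y‖} ^ M ≤ Φ x)
    (hΦ' : ∀ x ∈ A', ν {y | inner ℝ y x ≤ t * ‖y‖} ^ M ≤ Φ' x) :
    ∃ ω : Fin M → Euc n, (∀ i, ω i ≠ 0) ∧
      volume (A \ {x | ∀ i, inner ℝ (ω i) x ≤ t * ‖ω i‖}) +
        volume (A' ∩ {x | ∀ i, inner ℝ (ω i) x ≤ t * ‖ω i‖}) ≤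
      (∫⁻ x in A, Φ x) + ∫⁻ x in A', Φ' x := by
  set π : Measure (Fin M → Euc n) := Measure.pi fun _ => ν with hπ
  set S : Set ((Fin M → Euc n) × Euc n) := {p | ∀ i, inner ℝ (p.1 i) p.2 ≤ t * ‖p.1 i‖} with hS
  have hSm : MeasurableSet S := by
    have : S = ⋂ i, {p : (Fin M → Euc n) × Euc n | inner ℝ (p.1 i) p.2 ≤ t * ‖p.1 i‖} := by
      ext p; simp [hS]
    rw [this]
    exact MeasurableSet.iInter fun i => (isClosed_le (by fun_prop) (by fun_prop)).measurableSet
  have : IsFiniteMeasure (volume.restrict A) := ⟨by simpa using hAfin⟩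
  have : IsFiniteMeasure (volume.restrict A') := ⟨by simpa using hA'fin⟩
  have hprob : ∀ x, π {ω | (ω, x) ∈ S} = ν {y | inner ℝ y x ≤ t * ‖y‖} ^ M := by
    intro x
    have : {ω : Fin M → Euc n | (ω, x) ∈ S} =
        Set.pi univ fun _ => {y | inner ℝ y x ≤ t * ‖y‖} := by
      ext ω; simp [hS]
    rw [this, hπ, Measure.pi_pi]
    simp
  set N₀ : Set (Fin M → Euc n) := ⋃ i, {ω | ω i = 0} with hN₀
  have hN : π N₀ = 0 := by
    refine measure_iUnion_null fun i => ?_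
    have := (measurePreserving_eval (fun _ : Fin M => ν) i).measure_preimage
      (measurableSet_singleton (0 : Euc n)).nullMeasurableSet
    rw [hν] at this
    exact this
  have hf1 : Measurable fun ω => (volume.restrict A) (Prod.mk ω ⁻¹' Sᶜ) :=
    measurable_measure_prodMk_left hSm.compl
  have hf2 : Measurable fun ω => (volume.restrict A') (Prod.mk ω ⁻¹' S) :=
    measurable_measure_prodMk_left hSm
  obtain ⟨ω, hω, hle⟩ := exists_notMem_null_le_lintegral (μ := π)
    (hf1.add hf2).aemeasurable hN
  refine ⟨ω, fun i hi => hω (mem_iUnion.2 ⟨i, hi⟩), ?_⟩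
  have hslice : Prod.mk ω ⁻¹' S = {x | ∀ i, inner ℝ (ω i) x ≤ t * ‖ω i‖} := rfl
  have hms : MeasurableSet {x : Euc n | ∀ i, inner ℝ (ω i) x ≤ t * ‖ω i‖} := by
    rw [← hslice]; exact measurable_prodMk_left hSm
  have e1 : (volume.restrict A) (Prod.mk ω ⁻¹' Sᶜ) =
      volume (A \ {x | ∀ i, inner ℝ (ω i) x ≤ t * ‖ω i‖}) := by
    rw [preimage_compl, hslice, Measure.restrict_apply hms.compl, inter_comm, ← sdiff_eq]
  have e2 : (volume.restrict A') (Prod.mk ω ⁻¹' S) =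
      volume (A' ∩ {x | ∀ i, inner ℝ (ω i) x ≤ t * ‖ω i‖}) := by
    rw [hslice, Measure.restrict_apply hms, inter_comm]
  rw [← e1, ← e2]
  refine hle.trans ?_
  simp only [Pi.add_apply]
  rw [lintegral_add_left hf1, ← Measure.prod_apply hSm.compl, ← Measure.prod_apply hSm,
    Measure.prod_apply_symm hSm.compl, Measure.prod_apply_symm hSm]
  refine add_le_add (setLIntegral_mono' hA fun x hx => ?_) (setLIntegral_mono' hA' fun x hx => ?_)
  · refine le_trans (le_of_eq ?_) (hΦ x hx)
    rw [← hprob x, ← prob_compl_eq_one_sub]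
    · rfl
    · exact measurable_prodMk_right hSm
  · exact (hprob x).le.trans (hΦ' x hx)

/-- Integration of radial functions in polar coordinates. -/
lemma lintegral_radial {n : ℕ} (hn : 1 ≤ n) {f : ℝ → ℝ≥0∞} (hf : Measurable f) :
    ∫⁻ x : Euc n, f ‖x‖ =
      n * volume (unitBall n) * ∫⁻ r in Ioi (0 : ℝ), ENNReal.ofReal (r ^ (n - 1)) * f r := by
  have : Nonempty (Fin n) := ⟨⟨0, hn⟩⟩
  have hball : volume (unitBall n) = volume (Metric.ball (0 : Euc n) 1) :=
    Measure.addHaar_closedBall_eq_addHaar_ball _ _ _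
  calc ∫⁻ x : Euc n, f ‖x‖
      = ∫⁻ x : ({(0)}ᶜ : Set (Euc n)), f ‖x.1‖ ∂(volume.comap Subtype.val) := by
        rw [lintegral_subtype_comap (measurableSet_singleton (0 : Euc n)).compl fun x => f ‖x‖,
          restrict_compl_singleton]
    _ = ∫⁻ x : Metric.sphere (0 : Euc n) 1 × Ioi (0 : ℝ), f x.2
          ∂(volume : Measure (Euc n)).toSphere.prod (.volumeIoiPow (n - 1)) := by
        have h := (volume : Measure (Euc n)).measurePreserving_homeomorphUnitSphereProd.lintegral_comp
          (f := fun p => f p.2) (hf.comp (measurable_subtype_coe.comp measurable_snd))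
        rw [finrank_euclideanSpace_fin] at h
        rw [← h]
        simp
    _ = _ := by
        have hmeas : Measurable fun p : Metric.sphere (0 : Euc n) 1 × Ioi (0 : ℝ) => f p.2 :=
          hf.comp (measurable_subtype_coe.comp measurable_snd)
        rw [lintegral_prod _ hmeas.aemeasurable]
        simp only
        rw [lintegral_const, Measure.toSphere_apply_univ, finrank_euclideanSpace_fin, hball,
          mul_comm]
        congr 1
        have hf' : Measurable fun r : Ioi (0 : ℝ) => f r := hf.comp measurable_subtype_coe
        rw [Measure.volumeIoiPow, lintegral_withDensity_eq_lintegral_mul _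
          (by fun_prop) hf',
          ← lintegral_subtype_comap measurableSet_Ioi fun r => ENNReal.ofReal (r ^ (n - 1)) * f r]
        rfl

/-- The normalized Lebesgue measure on the unit ball. -/
noncomputable def ballMeasure (n : ℕ) : Measure (Euc n) :=
  (volume (unitBall n))⁻¹ • volume.restrict (unitBall n)

lemma volume_unitBall_pos {n : ℕ} : 0 < volume (unitBall n) :=
  Metric.measure_closedBall_pos volume _ one_pos

instance {n : ℕ} : IsProbabilityMeasure (ballMeasure n) := by
  refine ⟨?_⟩
  rw [ballMeasure, Measure.smul_apply, Measure.restrict_apply_univ, smul_eq_mul,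
    ENNReal.inv_mul_cancel volume_unitBall_pos.ne' volume_unitBall_lt_top.ne]

/-- The fraction of the unit ball occupied by the sector `{y | s ‖y‖ < ⟪e, y⟫}`. -/
noncomputable def sectorFraction (n : ℕ) (s : ℝ) : ℝ :=
  vol (unitBall (n - 1)) * sectorProfile n s / vol (unitBall n)

lemma sectorFraction_nonneg {n : ℕ} (hn : 2 ≤ n) {s : ℝ} (hs : s ∈ Icc (0 : ℝ) 1) :
    0 ≤ sectorFraction n s := by
  have := sectorProfile_nonneg hn hs
  have := vol_unitBall_pos n
  have := vol_unitBall_pos (n - 1)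
  unfold sectorFraction; positivity

lemma ballMeasure_sector {n : ℕ} (hn : 2 ≤ n) {e : Euc n} (he : ‖e‖ = 1) {s : ℝ} (h0 : 0 < s)
    (h1 : s ≤ 1) :
    ballMeasure n {y | s * ‖y‖ < inner ℝ e y} = ENNReal.ofReal (sectorFraction n s) := by
  rw [ballMeasure, Measure.smul_apply, Measure.restrict_apply (isConical_cap e s).measurableSet,
    inter_comm, volume_sector hn he h0 h1, smul_eq_mul, sectorFraction,
    ENNReal.ofReal_div_of_pos (vol_unitBall_pos n), ENNReal.ofReal_mul (vol_unitBall_pos _).le, vol,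
    vol, ENNReal.ofReal_toReal volume_unitBall_lt_top.ne,
    ENNReal.ofReal_toReal volume_unitBall_lt_top.ne, div_eq_mul_inv, mul_comm]

lemma sectorFraction_le_one {n : ℕ} (hn : 2 ≤ n) {s : ℝ} (h0 : 0 < s) (h1 : s ≤ 1) :
    sectorFraction n s ≤ 1 := by
  have he : ‖(EuclideanSpace.single ⟨0, by omega⟩ 1 : Euc n)‖ = 1 := by simp
  have h := ballMeasure_sector hn he h0 h1
  have h2 : ENNReal.ofReal (sectorFraction n s) ≤ 1 := h ▸ prob_le_one
  simpa using h2

/-- The probability that a random half-space at distance `t` from the origin contains `x`. -/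
lemma ballMeasure_halfspace {n : ℕ} (hn : 2 ≤ n) {t : ℝ} (ht : 0 < t) {x : Euc n}
    (hx : t ≤ ‖x‖) :
    ballMeasure n {y | inner ℝ y x ≤ t * ‖y‖} =
      ENNReal.ofReal (1 - sectorFraction n (t / ‖x‖)) := by
  have hx0 : 0 < ‖x‖ := ht.trans_le hx
  have he : ‖‖x‖⁻¹ • x‖ = 1 := by simp [norm_smul, hx0.ne']
  have hs0 : 0 < t / ‖x‖ := by positivity
  have hs1 : t / ‖x‖ ≤ 1 := (div_le_one hx0).2 hx
  have hset : {y : Euc n | inner ℝ y x ≤ t * ‖y‖} =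
      {y | t / ‖x‖ * ‖y‖ < inner ℝ (‖x‖⁻¹ • x) y}ᶜ := by
    ext y
    simp only [mem_ofPred_eq, mem_compl_iff, not_lt, real_inner_smul_left]
    rw [inv_mul_eq_div, div_mul_eq_mul_div, div_le_div_iff_of_pos_right hx0, real_inner_comm]
  rw [hset, prob_compl_eq_one_sub (isConical_cap _ _).measurableSet,
    ballMeasure_sector hn he hs0 hs1, ENNReal.ofReal_sub _
      (sectorFraction_nonneg hn ⟨hs0.le, hs1⟩), ENNReal.ofReal_one]

lemma ballMeasure_halfspace_of_le {n : ℕ} {t : ℝ} {x : Euc n} (hx : ‖x‖ ≤ t) :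
    ballMeasure n {y | inner ℝ y x ≤ t * ‖y‖} = 1 := by
  have : {y : Euc n | inner ℝ y x ≤ t * ‖y‖} = univ := by
    ext y
    simp only [mem_ofPred_eq, mem_univ, iff_true]
    refine (real_inner_le_norm y x).trans ?_
    rw [mul_comm]
    gcongr
  rw [this, measure_univ]

/-- The part of the unit ball beyond the hyperplane `{⟪e, x⟫ = t}` is contained in the sector over
it with its copy scaled by `t` removed. -/
lemma volume_cap_le {n : ℕ} (hn : 2 ≤ n) {e : Euc n} (he : ‖e‖ = 1) {t : ℝ} (h0 : 0 < t)
    (h1 : t ≤ 1) :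
    volume (unitBall n ∩ {x | t < inner ℝ e x}) ≤
      ENNReal.ofReal ((1 - t ^ n) * sectorFraction n t) * volume (unitBall n) := by
  set C := unitBall n ∩ {y : Euc n | t * ‖y‖ < inner ℝ e y} with hC
  have hCc := isConical_cap e t
  have hCm : MeasurableSet C := Metric.isClosed_closedBall.measurableSet.inter hCc.measurableSet
  have hCfin : volume C < ∞ := (measure_mono inter_subset_left).trans_lt volume_unitBall_lt_top
  have hvolC : volume C = ENNReal.ofReal (sectorFraction n t) * volume (unitBall n) := by
    rw [← ballMeasure_sector hn he h0 h1, ballMeasure, Measure.smul_apply,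
      Measure.restrict_apply hCc.measurableSet, inter_comm, smul_eq_mul, mul_comm, ← mul_assoc,
      ENNReal.mul_inv_cancel volume_unitBall_pos.ne' volume_unitBall_lt_top.ne, one_mul]
  have hcs : ∀ x, inner ℝ e x ≤ ‖x‖ := fun x => by
    simpa [he] using real_inner_le_norm e x
  have hsub : unitBall n ∩ {x | t < inner ℝ e x} ⊆ C \ (t • C) := by
    rintro x ⟨hx, hxt⟩
    have hx1 : ‖x‖ ≤ 1 := by rw [unitBall_eq] at hx; exact hx
    have hxt : t < inner ℝ e x := hxt
    refine ⟨⟨hx, ?_⟩, ?_⟩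
    · show t * ‖x‖ < inner ℝ e x
      nlinarith
    · rintro ⟨y, ⟨hy, -⟩, rfl⟩
      rw [unitBall_eq] at hy
      have hy : ‖y‖ ≤ 1 := hy
      simp only [inner_smul_right] at hxt
      have := hcs y
      nlinarith
  have htC : t • C ⊆ C := by
    rintro _ ⟨y, ⟨hy, hy2⟩, rfl⟩
    refine ⟨?_, hCc.smul_mem t h0 y hy2⟩
    rw [unitBall_eq] at hy ⊢
    have hy : ‖y‖ ≤ 1 := hy
    simp only [mem_ofPred_eq, norm_smul, Real.norm_of_nonneg h0.le]
    nlinarith [norm_nonneg y]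
  have htvol : volume (t • C) = ENNReal.ofReal (t ^ n) * volume C := by
    rw [Measure.addHaar_smul, finrank_euclideanSpace_fin, abs_of_nonneg (by positivity)]
  have htn : t ^ n ≤ 1 := pow_le_one₀ h0.le h1
  refine (measure_mono hsub).trans ?_
  rw [measure_sdiff htC (hCm.const_smul_of_ne_zero h0.ne').nullMeasurableSet
    ((measure_mono htC).trans_lt hCfin).ne, htvol,
    ENNReal.ofReal_mul (by linarith), mul_assoc, ← hvolC, ENNReal.ofReal_sub _ (by positivity),
    ENNReal.ofReal_one, ENNReal.sub_mul (fun _ _ => hCfin.ne), one_mul]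

/-- The normals `±eⱼ` of a cube. -/
noncomputable def cubeNormal (n : ℕ) (p : Fin n × Bool) : Euc n :=
  EuclideanSpace.single p.1 (if p.2 then 1 else -1)

lemma norm_cubeNormal {n : ℕ} (p : Fin n × Bool) : ‖cubeNormal n p‖ = 1 := by
  unfold cubeNormal
  split_ifs <;> simp

lemma inner_cubeNormal {n : ℕ} (p : Fin n × Bool) (x : Euc n) :
    inner ℝ (cubeNormal n p) x = (if p.2 then 1 else -1) * x p.1 := by
  unfold cubeNormal
  rw [EuclideanSpace.inner_single_left]
  split_ifs <;> simp

lemma norm_le_of_mem_cube {n : ℕ} {t : ℝ} (ht : t ≤ 1) {x : Euc n}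
    (hx : ∀ p, inner ℝ (cubeNormal n p) x ≤ t) : ‖x‖ ≤ Real.sqrt n := by
  rw [EuclideanSpace.norm_eq]
  apply Real.sqrt_le_sqrt
  have hle : ∀ i, ‖x i‖ ^ 2 ≤ 1 := by
    intro i
    have h1 := hx (i, true)
    have h2 := hx (i, false)
    rw [inner_cubeNormal] at h1 h2
    simp only [if_true, one_mul, Bool.false_eq_true, if_false] at h1 h2
    rw [Real.norm_eq_abs, sq_abs]
    nlinarith
  calc ∑ i, ‖x i‖ ^ 2 ≤ ∑ _i : Fin n, (1 : ℝ) := Finset.sum_le_sum fun i _ => hle i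
    _ = n := by simp

/-- A polytope with `M` random facets and the `2n` facets of a cube, all at distance `t` from the
origin, whose volume deviation from the ball is at most its expected value. -/
lemma exists_circumPolytope_volume_le {n : ℕ} (hn : 2 ≤ n) (M : ℕ) {t : ℝ} (h0 : 0 < t)
    (h1 : t ≤ 1) {Φ Φ' : ℝ → ℝ≥0∞}
    (hΦ : ∀ r, t < r → r ≤ 1 → ENNReal.ofReal (1 - (1 - sectorFraction n (t / r)) ^ M) ≤ Φ r)
    (hΦ' : ∀ r, 1 < r → r ≤ Real.sqrt n →
      ENNReal.ofReal ((1 - sectorFraction n (t / r)) ^ M) ≤ Φ' r) :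
    ∃ u : Fin M ⊕ (Fin n × Bool) → Euc n, (∀ i, ‖u i‖ = 1) ∧
      Bornology.IsBounded (circumPolytope u t) ∧
      volume (circumPolytope u t ∆ unitBall n) ≤
        (∫⁻ x : Euc n, (Ioc t 1).indicator Φ ‖x‖) +
        (∫⁻ x : Euc n, (Ioc 1 (Real.sqrt n)).indicator Φ' ‖x‖) +
        ENNReal.ofReal (2 * n * ((1 - t ^ n) * sectorFraction n t)) * volume (unitBall n) := by
  set A' : Set (Euc n) := {x | ‖x‖ ∈ Ioc 1 (Real.sqrt n)} with hA'
  have hA'm : MeasurableSet A' := measurable_norm measurableSet_Ioc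
  have hA'fin : volume A' < ∞ := by
    refine (measure_mono ?_).trans_lt (measure_closedBall_lt_top (x := (0 : Euc n))
      (r := Real.sqrt n))
    intro x hx
    simpa using hx.2
  have hDm : MeasurableSet (unitBall n) := Metric.isClosed_closedBall.measurableSet
  have hν0 : ballMeasure n {0} = 0 := by
    have : Nonempty (Fin n) := ⟨⟨0, by omega⟩⟩
    rw [ballMeasure, Measure.smul_apply, smul_eq_mul,
      Measure.restrict_apply (measurableSet_singleton _)]
    rw [measure_mono_null inter_subset_left (measure_singleton (0 : Euc n)), mul_zero]
  have hfr1 : ∀ r, t ≤ r → sectorFraction n (t / r) ≤ 1 := fun r hr => by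
    have hr0 : 0 < r := h0.trans_le hr
    exact sectorFraction_le_one hn (by positivity) ((div_le_one hr0).2 hr)
  obtain ⟨ω, hω, hle⟩ := exists_halfspaces_le (ballMeasure n) hν0 M t hDm hA'm
    volume_unitBall_lt_top hA'fin (Φ := fun x => (Ioc t 1).indicator Φ ‖x‖)
    (Φ' := fun x => (Ioc 1 (Real.sqrt n)).indicator Φ' ‖x‖) (by
      intro x hx
      rw [unitBall_eq] at hx
      have hx : ‖x‖ ≤ 1 := hx
      rcases le_or_gt ‖x‖ t with hxt | hxt
      · rw [ballMeasure_halfspace_of_le hxt]; simp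
      · rw [indicator_of_mem (show ‖x‖ ∈ Ioc t 1 from ⟨hxt, hx⟩), ballMeasure_halfspace hn h0 hxt.le]
        have h2 := sub_nonneg.2 (hfr1 _ hxt.le)
        rw [← ENNReal.ofReal_pow h2, ← ENNReal.ofReal_one, ← ENNReal.ofReal_sub _ (by positivity)]
        exact hΦ _ hxt hx) (by
      intro x hx
      have hxt : t ≤ ‖x‖ := h1.trans hx.1.le
      rw [indicator_of_mem (show ‖x‖ ∈ Ioc 1 (Real.sqrt n) from hx), ballMeasure_halfspace hn h0 hxt,
        ← ENNReal.ofReal_pow (sub_nonneg.2 (hfr1 _ hxt))]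
      exact hΦ' _ hx.1 hx.2)
  set R := {x : Euc n | ∀ i, inner ℝ (ω i) x ≤ t * ‖ω i‖} with hR
  set u : Fin M ⊕ (Fin n × Bool) → Euc n :=
    Sum.elim (fun i => ‖ω i‖⁻¹ • ω i) (cubeNormal n) with hu
  have hPmem : ∀ x, x ∈ circumPolytope u t ↔ x ∈ R ∧ ∀ p, inner ℝ (cubeNormal n p) x ≤ t := by
    intro x
    have : ∀ i, inner ℝ (‖ω i‖⁻¹ • ω i) x ≤ t ↔ inner ℝ (ω i) x ≤ t * ‖ω i‖ := fun i => by
      have hpos : 0 < ‖ω i‖ := norm_pos_iff.2 (hω i)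
      rw [real_inner_smul_left, inv_mul_eq_div, div_le_iff₀ hpos]
    simp only [circumPolytope, mem_ofPred_eq, Sum.forall, hu, Sum.elim_inl, Sum.elim_inr, this, hR]
  have hbd : Bornology.IsBounded (circumPolytope u t) := by
    refine (Metric.isBounded_closedBall (x := (0 : Euc n)) (r := Real.sqrt n)).subset ?_
    intro x hx
    simpa using norm_le_of_mem_cube h1 ((hPmem x).1 hx).2
  refine ⟨u, ?_, hbd, ?_⟩
  · rintro (i | p)
    · have hpos : 0 < ‖ω i‖ := norm_pos_iff.2 (hω i)
      simp [hu, norm_smul, hpos.ne']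
    · exact norm_cubeNormal p
  · have hsub : circumPolytope u t ∆ unitBall n ⊆ ((unitBall n \ R) ∪ (A' ∩ R)) ∪
        ⋃ p, (unitBall n ∩ {x | t < inner ℝ (cubeNormal n p) x}) := by
      rintro x (⟨hx, hxD⟩ | ⟨hxD, hx⟩)
      · have hx' := (hPmem x).1 hx
        refine Or.inl (Or.inr ⟨⟨?_, norm_le_of_mem_cube h1 hx'.2⟩, hx'.1⟩)
        rw [unitBall_eq] at hxD
        exact not_le.1 hxD
      · rw [hPmem, not_and_or] at hx
        rcases hx with hx | hx
        · exact Or.inl (Or.inl ⟨hxD, hx⟩)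
        · push Not at hx
          obtain ⟨p, hp⟩ := hx
          exact Or.inr (mem_iUnion.2 ⟨p, hxD, hp⟩)
    refine (measure_mono hsub).trans ((measure_union_le _ _).trans (add_le_add ?_ ?_))
    · refine (measure_union_le _ _).trans (hle.trans ?_)
      exact add_le_add (setLIntegral_le_lintegral _ _) (setLIntegral_le_lintegral _ _)
    · refine (measure_iUnion_fintype_le _ _).trans ?_
      refine (Finset.sum_le_sum fun p _ => volume_cap_le hn (norm_cubeNormal p) h0 h1).trans ?_
      rw [Finset.sum_const, nsmul_eq_mul, Finset.card_univ, Fintype.card_prod, Fintype.card_fin,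
        Fintype.card_bool, ← mul_assoc, ← ENNReal.ofReal_natCast, ← ENNReal.ofReal_mul (by positivity)]
      push_cast
      rw [mul_comm (n : ℝ) 2]

/-! ### The expected volume cut off from the ball -/

/-- The logarithm of the ratio `((1 - (t/r)²) / (1 - t²))^((n-1)/2)` of the base areas of the caps
cut off at heights `t / r` and `t`. -/
noncomputable def logCapRatio (n : ℕ) (t r : ℝ) : ℝ :=
  (n - 1 : ℕ) / 2 * Real.log ((1 - (t / r) ^ 2) / (1 - t ^ 2))

section logCapRatio

variable {n : ℕ} {t r : ℝ}

lemma capRatio_pos (ht : 0 < t) (ht1 : t < 1) (hr : t < r) :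
    0 < (1 - (t / r) ^ 2) / (1 - t ^ 2) := by
  have hr0 := ht.trans hr
  have h1 : t / r < 1 := (div_lt_one hr0).2 hr
  have h2 : 0 < t / r := by positivity
  exact div_pos (by nlinarith) (by nlinarith)

lemma sectionProfile_div_eq (ht : 0 < t) (ht1 : t < 1) (hr : t < r) :
    sectionProfile n (t / r) = sectionProfile n t * Real.exp (logCapRatio n t r) := by
  have hw := capRatio_pos ht ht1 hr
  have h1 : 0 < 1 - t ^ 2 := by nlinarith
  have h2 : 1 - (t / r) ^ 2 = (1 - t ^ 2) * ((1 - (t / r) ^ 2) / (1 - t ^ 2)) := by field_simp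
  unfold sectionProfile logCapRatio
  set w := (1 - (t / r) ^ 2) / (1 - t ^ 2)
  rw [h2, Real.sqrt_mul h1.le, mul_pow]
  congr 1
  rw [← Real.exp_log hw, Real.log_exp, Real.sqrt_eq_rpow, ← Real.exp_mul, ← Real.exp_nat_mul]
  congr 1
  ring

lemma hasDerivAt_logCapRatio (ht : 0 < t) (ht1 : t < 1) (hr : t < r) :
    HasDerivAt (logCapRatio n t)
      ((n - 1 : ℕ) * t ^ 2 /
        ((1 - t ^ 2) * r ^ 3 * ((1 - (t / r) ^ 2) / (1 - t ^ 2)))) r := by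
  have hr0 := ht.trans hr
  have hw := capRatio_pos ht ht1 hr
  have h1 : 0 < 1 - t ^ 2 := by nlinarith
  have h2 : HasDerivAt (fun r : ℝ => t / r) (-t / r ^ 2) r := by
    exact ((hasDerivAt_const r t).div (hasDerivAt_id r) hr0.ne').congr_deriv (by simp)
  have h3 := ((((h2.pow 2).const_sub 1).div_const (1 - t ^ 2)).log hw.ne').const_mul
    (((n - 1 : ℕ) : ℝ) / 2)
  refine h3.congr_deriv ?_
  have hw' : 1 - (t / r) ^ 2 ≠ 0 := fun h => by rw [h, zero_div] at hw; exact lt_irrefl _ hw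
  have hw'' : r ^ 2 - t ^ 2 ≠ 0 := by nlinarith
  simp only [Pi.pow_apply]
  norm_num
  field_simp

lemma injOn_logCapRatio (hn : 2 ≤ n) (ht : 0 < t) (ht1 : t < 1) :
    InjOn (logCapRatio n t) (Ioi t) := by
  intro a ha b hb hab
  have ha0 := ht.trans ha
  have hb0 := ht.trans hb
  have h1 : 0 < 1 - t ^ 2 := by nlinarith
  have hm : ((n - 1 : ℕ) : ℝ) / 2 ≠ 0 := by
    have : 0 < n - 1 := by omega
    positivity
  have h2 := Real.log_injOn_pos (capRatio_pos ht ht1 ha) (capRatio_pos ht ht1 hb)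
    (mul_left_cancel₀ hm hab)
  rw [div_left_inj' h1.ne', sub_right_inj] at h2
  have h3 := (pow_left_inj₀ (by positivity) (by positivity) two_ne_zero).1 h2
  field_simp at h3
  exact h3.symm

lemma logCapRatio_neg (hn : 2 ≤ n) (ht : 0 < t) (hr : t < r) (hr1 : r < 1) :
    logCapRatio n t r < 0 := by
  have hr0 := ht.trans hr
  have h1 : 0 < 1 - t ^ 2 := by nlinarith
  have hm : 0 < ((n - 1 : ℕ) : ℝ) / 2 := by
    have : 0 < n - 1 := by omega
    positivity
  refine mul_neg_of_pos_of_neg hm (Real.log_neg (capRatio_pos ht (hr.trans hr1) hr) ?_)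
  rw [div_lt_one h1]
  have : t < t / r := by rw [lt_div_iff₀ hr0]; nlinarith
  nlinarith

lemma logCapRatio_pos (hn : 2 ≤ n) (ht : 0 < t) (ht1 : t < 1) (hr : 1 < r) :
    0 < logCapRatio n t r := by
  have hr0 := one_pos.trans hr
  have h1 : 0 < 1 - t ^ 2 := by nlinarith
  have hm : 0 < ((n - 1 : ℕ) : ℝ) / 2 := by
    have : 0 < n - 1 := by omega
    positivity
  refine mul_pos hm (Real.log_pos ?_)
  rw [one_lt_div h1]
  have : t / r < t := by rw [div_lt_iff₀ hr0]; nlinarith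
  have : 0 < t / r := by positivity
  nlinarith

/-- For points of the ball, the ratio of cap areas overestimates the ratio of sector fractions. -/
lemma sectorFraction_div_le (hn : 2 ≤ n) (ht : 0 < t) (ht1 : t < 1) (hr : t < r) (hr1 : r ≤ 1) :
    sectorFraction n (t / r) ≤ sectorFraction n t * Real.exp (logCapRatio n t r) := by
  have hr0 := ht.trans hr
  have h := sectorProfile_mul_sectionProfile_le hn ht
    (show t ≤ t / r by rw [le_div_iff₀ hr0]; nlinarith) ((div_le_one hr0).2 hr.le)
  rw [sectionProfile_div_eq ht ht1 hr, mul_left_comm, mul_comm (sectorProfile n (t / r))] at h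
  have h2 := le_of_mul_le_mul_left h (sectionProfile_pos n ht.le ht1)
  have := vol_unitBall_pos n
  have := vol_unitBall_pos (n - 1)
  unfold sectorFraction
  rw [div_mul_eq_mul_div, mul_assoc]
  gcongr

/-- For points outside the ball, the ratio of cap areas underestimates the ratio of sector
fractions. -/
lemma le_sectorFraction_div (hn : 2 ≤ n) (ht : 0 < t) (ht1 : t < 1) (hr : 1 ≤ r) :
    sectorFraction n t * Real.exp (logCapRatio n t r) ≤ sectorFraction n (t / r) := by
  have hr0 : 0 < r := by linarith
  have h := sectorProfile_mul_sectionProfile_le hn (t := t / r) (s := t) (by positivity)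
    (by rw [div_le_iff₀ hr0]; nlinarith) ht1.le
  rw [sectionProfile_div_eq ht ht1 (ht1.trans_le hr), mul_left_comm,
    mul_comm (sectorProfile n (t / r))] at h
  have h2 := le_of_mul_le_mul_left h (sectionProfile_pos n ht.le ht1)
  have := vol_unitBall_pos n
  have := vol_unitBall_pos (n - 1)
  unfold sectorFraction
  rw [div_mul_eq_mul_div, mul_assoc]
  gcongr

end logCapRatio

/-- From `exp (-p) * (1 - p²) ≤ 1 - p` and Bernoulli's inequality. -/
lemma exp_sub_le_one_sub_pow {p : ℝ} (h0 : 0 ≤ p) (h1 : p ≤ 1) (M : ℕ) :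
    Real.exp (-(M * p)) - M * p ^ 2 ≤ (1 - p) ^ M := by
  have h2 : Real.exp (-p) * (1 - p ^ 2) ≤ 1 - p := by
    have : Real.exp (-p) * (1 + p) ≤ 1 := by
      have := Real.add_one_le_exp p
      calc Real.exp (-p) * (1 + p) ≤ Real.exp (-p) * Real.exp p := by gcongr; linarith
        _ = 1 := by rw [← Real.exp_add]; simp
    nlinarith
  have h3 : 0 ≤ 1 - p ^ 2 := by nlinarith
  have h4 : 1 - M * p ^ 2 ≤ (1 - p ^ 2) ^ M := by
    have := one_add_mul_le_pow (a := -p ^ 2) (by linarith) M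
    simpa [sub_eq_add_neg] using this
  have h5 : Real.exp (-(M * p)) ≤ 1 := Real.exp_le_one_iff.2 (by
    have : 0 ≤ M * p := by positivity
    linarith)
  calc Real.exp (-(M * p)) - M * p ^ 2 ≤ Real.exp (-(M * p)) * (1 - M * p ^ 2) := by
        have : 0 ≤ M * p ^ 2 := by positivity
        nlinarith
    _ ≤ Real.exp (-(M * p)) * (1 - p ^ 2) ^ M := by gcongr
    _ = (Real.exp (-p) * (1 - p ^ 2)) ^ M := by
        rw [mul_pow, ← Real.exp_nat_mul]; congr 2; ring
    _ ≤ (1 - p) ^ M := by gcongr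

lemma integrableOn_constI_integrand :
    IntegrableOn (fun v : ℝ => v⁻¹ * (1 - Real.exp (-(Real.log 2) * v))) (Ioo 0 1) := by
  refine Measure.integrableOn_of_bounded (M := Real.log 2) (by simp) ?_ ?_
  · exact Measurable.aestronglyMeasurable (by fun_prop)
  · refine (ae_restrict_iff' measurableSet_Ioo).2 (.of_forall fun v hv => ?_)
    have hl := Real.log_pos one_lt_two
    have h1 := Real.add_one_le_exp (-(Real.log 2) * v)
    have h2 : Real.exp (-(Real.log 2) * v) ≤ 1 := Real.exp_le_one_iff.2 (by nlinarith [hv.1])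
    rw [Real.norm_of_nonneg (mul_nonneg (inv_nonneg.2 hv.1.le) (by linarith)),
      inv_mul_le_iff₀ hv.1]
    linarith

lemma constI_nonneg : 0 ≤ constI := by
  refine intervalIntegral.integral_nonneg zero_le_one fun v hv => ?_
  have hl := Real.log_pos one_lt_two
  have h2 : Real.exp (-(Real.log 2) * v) ≤ 1 := Real.exp_le_one_iff.2 (by nlinarith [hv.1])
  exact mul_nonneg (inv_nonneg.2 hv.1) (by linarith)

lemma constII_nonneg : 0 ≤ constII := integral_nonneg fun _ => (Real.exp_pos _).le

lemma lintegral_inner_profile {a : ℝ} (ha : 0 ≤ a) :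
    ∫⁻ v in Ioo (0 : ℝ) 1,
      ENNReal.ofReal (v⁻¹ * (1 - Real.exp (-(Real.log 2) * v)) + a * v) =
    ENNReal.ofReal (constI + a / 2) := by
  have hi2 : IntegrableOn (fun v : ℝ => a * v) (Ioo 0 1) :=
    (Continuous.integrableOn_Icc (by fun_prop)).mono_set Ioo_subset_Icc_self
  have hi : IntegrableOn (fun v : ℝ => v⁻¹ * (1 - Real.exp (-(Real.log 2) * v)) + a * v)
      (Ioo 0 1) := integrableOn_constI_integrand.add hi2
  rw [← ofReal_integral_eq_lintegral_ofReal hi]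
  · congr 1
    rw [integral_add integrableOn_constI_integrand hi2, ← integral_Ioc_eq_integral_Ioo,
      ← integral_Ioc_eq_integral_Ioo, ← intervalIntegral.integral_of_le zero_le_one,
      ← intervalIntegral.integral_of_le zero_le_one, constI, intervalIntegral.integral_const_mul,
      integral_id]
    ring
  · refine (ae_restrict_iff' measurableSet_Ioo).2 (.of_forall fun v hv => ?_)
    have hl := Real.log_pos one_lt_two
    have h2 : Real.exp (-(Real.log 2) * v) ≤ 1 := Real.exp_le_one_iff.2 (by nlinarith [hv.1])
    have h3 := hv.1
    have := sub_nonneg.2 h2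
    show 0 ≤ v⁻¹ * (1 - Real.exp (-(Real.log 2) * v)) + a * v
    positivity

/-- Expected volume of the part of the ball cut off by the random half-spaces, after the change of
variables `v = exp (logCapRatio n t r)`. -/
lemma lintegral_inner_le {n : ℕ} (hn : 2 ≤ n) {t : ℝ} (ht : 0 < t) (ht1 : t < 1) {a : ℝ}
    (ha : 0 ≤ a) :
    ∫⁻ r in Ioo t 1, ENNReal.ofReal (r ^ (n - 1)) *
      ENNReal.ofReal (1 - Real.exp (-(Real.log 2) * Real.exp (logCapRatio n t r)) +
        a * Real.exp (logCapRatio n t r) ^ 2) ≤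
    ENNReal.ofReal ((1 - t ^ 2) / t ^ 2 / (n - 1 : ℕ) * (constI + a / 2)) := by
  have hm : 0 < ((n - 1 : ℕ) : ℝ) := by
    have : 0 < n - 1 := by omega
    positivity
  have hε : 0 < 1 - t ^ 2 := by nlinarith
  set c := (1 - t ^ 2) / t ^ 2 / (n - 1 : ℕ) with hc
  have hc0 : 0 < c := by positivity
  set g : ℝ → ℝ := fun v => v⁻¹ * (1 - Real.exp (-(Real.log 2) * v)) + a * v with hg
  set V : ℝ → ℝ := fun r => Real.exp (logCapRatio n t r) with hV
  set V' : ℝ → ℝ := fun r => Real.exp (logCapRatio n t r) * ((n - 1 : ℕ) * t ^ 2 /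
        ((1 - t ^ 2) * r ^ 3 * ((1 - (t / r) ^ 2) / (1 - t ^ 2)))) with hV'
  have hcov := lintegral_image_eq_lintegral_abs_deriv_mul (s := Ioo t 1) (f := V) (f' := V')
    measurableSet_Ioo (fun r hr => (hasDerivAt_logCapRatio ht ht1 hr.1).exp.hasDerivWithinAt)
    (fun x hx y hy hxy => injOn_logCapRatio hn ht ht1 hx.1 hy.1 (Real.exp_injective hxy))
    (fun v => ENNReal.ofReal (g v))
  have himg : V '' Ioo t 1 ⊆ Ioo 0 1 := by
    rintro _ ⟨r, hr, rfl⟩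
    exact ⟨Real.exp_pos _, Real.exp_lt_one_iff.2 (logCapRatio_neg hn ht hr.1 hr.2)⟩
  calc _ ≤ ∫⁻ r in Ioo t 1, ENNReal.ofReal c * (ENNReal.ofReal |V' r| * ENNReal.ofReal (g (V r))) := by
        refine setLIntegral_mono' measurableSet_Ioo fun r hr => ?_
        have hr0 := ht.trans hr.1
        have hw := capRatio_pos ht ht1 hr.1
        have hlog := logCapRatio_neg hn ht hr.1 hr.2
        have hw1 : (1 - (t / r) ^ 2) / (1 - t ^ 2) ≤ 1 := by
          rw [div_le_one hε]
          have : t ≤ t / r := by rw [le_div_iff₀ hr0]; nlinarith [hr.2]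
          nlinarith
        rw [← ENNReal.ofReal_mul (by positivity), ← ENNReal.ofReal_mul (abs_nonneg _),
          ← ENNReal.ofReal_mul hc0.le]
        apply ENNReal.ofReal_le_ofReal
        have hV0 : 0 < V r := Real.exp_pos _
        have hl := Real.log_pos one_lt_two
        have h2 : Real.exp (-(Real.log 2) * V r) ≤ 1 := Real.exp_le_one_iff.2 (by nlinarith)
        have hφ : 0 ≤ 1 - Real.exp (-(Real.log 2) * V r) + a * V r ^ 2 :=
          add_nonneg (by linarith) (by positivity)
        set w := (1 - (t / r) ^ 2) / (1 - t ^ 2) with hwdef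
        have hV'0 : 0 < V' r := by
          simp only [hV']
          positivity
        rw [abs_of_pos hV'0]
        have e : c * (V' r * g (V r)) =
            (1 - Real.exp (-(Real.log 2) * V r) + a * V r ^ 2) * (r ^ 3 * w)⁻¹ := by
          have : V' r = V r * ((n - 1 : ℕ) * t ^ 2 / ((1 - t ^ 2) * r ^ 3 * w)) := rfl
          rw [this]
          simp only [hg, hc]
          field_simp
        rw [e, mul_comm]
        refine mul_le_mul_of_nonneg_left ?_ hφ
        rw [le_inv_comm₀ (by positivity) (by positivity)]
        -- Inside the ball the Jacobian factor `rⁿ⁺² w` is at most `1`.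
        have h3 : r ^ 3 * w ≤ 1 :=
          mul_le_one₀ (pow_le_one₀ hr0.le hr.2.le) hw.le hw1
        exact h3.trans ((one_le_inv₀ (by positivity)).2 (pow_le_one₀ hr0.le hr.2.le))
    _ = ENNReal.ofReal c * ∫⁻ v in V '' Ioo t 1, ENNReal.ofReal (g v) := by
        rw [hcov, lintegral_const_mul' _ _ ENNReal.ofReal_ne_top]
    _ ≤ ENNReal.ofReal c * ∫⁻ v in Ioo 0 1, ENNReal.ofReal (g v) := by
        gcongr
    _ = _ := by
        rw [lintegral_inner_profile ha, ← ENNReal.ofReal_mul hc0.le]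

/-! ### The expected volume left outside the ball -/

lemma sq_le_four_pow {k : ℕ} (hk : 2 ≤ k) : (k + 2) ^ 2 ≤ 4 ^ k := by
  induction k, hk using Nat.le_induction with
  | base => norm_num
  | succ k hk ih => rw [pow_succ 4]; nlinarith

lemma exp_le_one_add_mul_exp (x : ℝ) : Real.exp x ≤ 1 + x * Real.exp x := by
  have h := Real.add_one_le_exp (-x)
  have h2 : Real.exp x * Real.exp (-x) = 1 := by rw [← Real.exp_add]; simp
  nlinarith [mul_le_mul_of_nonneg_left h (Real.exp_pos x).le]

/-- The Jacobian factor `rⁿ⁺² w` of the substitution `s = logCapRatio n t r` outside the ball is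
`1` up to a small multiple of an integrable weight. For small `n` the bound `r ≤ √n` suffices.
For large `n`, as long as `r² ≤ 2` the factor is `exp O(s / n + (1 - t²) exp s)`, while for
`r² > 2` the weight `exp (exp s / 4)`, with `exp s ≥ 4ⁿ⁻¹`, dominates `n ^ n`. -/
lemma jacobian_le {n : ℕ} (hn : 2 ≤ n) {t : ℝ} (ht : 0 < t) (hε0 : 0 < 1 - t ^ 2)
    (hε : 1 - t ^ 2 ≤ 1 / 40) {r : ℝ} (hr : 1 < r) (hrn : r ≤ Real.sqrt n) :
    r ^ (n + 2) * ((1 - (t / r) ^ 2) / (1 - t ^ 2)) ≤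
      1 + 531441 * (1 - t ^ 2 + 1 / n) *
        Real.exp (2 * logCapRatio n t r + Real.exp (logCapRatio n t r) / 4) := by
  have ht1 : t < 1 := by nlinarith
  have hr0 : 0 < r := by linarith
  have hs := logCapRatio_pos hn ht ht1 hr
  have hw := capRatio_pos ht ht1 (ht1.trans hr)
  have hwlog : logCapRatio n t r = (n - 1 : ℕ) / 2 * Real.log ((1 - (t / r) ^ 2) / (1 - t ^ 2)) :=
    rfl
  have hcast : ((n - 1 : ℕ) : ℝ) = n - 1 := by rw [Nat.cast_sub (by omega)]; simp
  have hn2 : (2 : ℝ) ≤ n := by exact_mod_cast hn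
  have hm : (0 : ℝ) < n - 1 := by linarith
  have hr2 : r ^ 2 ≤ n := by
    have := pow_le_pow_left₀ hr0.le hrn 2
    rwa [Real.sq_sqrt (by positivity)] at this
  rw [hcast] at hwlog
  set ε := 1 - t ^ 2 with hεdef
  set w := (1 - (t / r) ^ 2) / ε with hwdef
  set s := logCapRatio n t r
  set δ : ℝ := 2 / (n - 1) with hδ
  have hδ0 : 0 < δ := by positivity
  have hws : w = Real.exp (δ * s) := by
    rw [hwlog, hδ, ← Real.exp_log hw, Real.log_exp]
    congr 1
    field_simp
  have hδ2 : δ ≤ 2 := by rw [hδ, div_le_iff₀ hm]; linarith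
  have hw2 : w ≤ Real.exp (2 * s) := by
    rw [hws]; apply Real.exp_le_exp.2; nlinarith
  have hes : 1 ≤ Real.exp s := Real.one_le_exp hs.le
  have hses : s ≤ Real.exp s := by linarith [Real.add_one_le_exp s]
  have hK : Real.exp (2 * s) ≤ Real.exp (2 * s + Real.exp s / 4) := by
    apply Real.exp_le_exp.2; linarith
  have hKpos := Real.exp_pos (2 * s + Real.exp s / 4)
  set K := Real.exp (2 * s + Real.exp s / 4) with hKdef
  rcases lt_or_ge n 9 with hn9 | hn9
  · have hn9' : (n : ℝ) ≤ 9 := by exact_mod_cast hn9.le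
    have hr3 : r ≤ 3 := by
      apply le_of_sq_le_sq _ (by norm_num)
      linarith
    -- The constant `531441` is `9 * 3 ^ 10`.
    have h1 : r ^ (n + 2) ≤ 59049 := by
      calc r ^ (n + 2) ≤ 3 ^ (n + 2) := by gcongr
        _ ≤ 3 ^ 10 := pow_le_pow_right₀ (by norm_num) (by omega)
        _ = 59049 := by norm_num
    have h2 : (1 : ℝ) / 9 ≤ 1 / n := by gcongr
    calc r ^ (n + 2) * w ≤ 59049 * K := mul_le_mul h1 (hw2.trans hK) hw.le (by norm_num)
      _ ≤ 531441 * (ε + 1 / n) * K := by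
          apply mul_le_mul_of_nonneg_right _ hKpos.le
          linarith
      _ ≤ _ := by linarith
  have hn9' : (9 : ℝ) ≤ n := by exact_mod_cast hn9
  have hδ4 : δ ≤ 1 / 4 := by rw [hδ, div_le_iff₀ hm]; linarith
  have ht2 : t ^ 2 = 1 - ε := by rw [hεdef]; ring
  rcases le_or_gt (r ^ 2) 2 with hr22 | hr22
  · -- Near the ball.
    have hrw : r ^ 2 - 1 = r ^ 2 * (ε * (w - 1)) / t ^ 2 := by
      rw [hwdef, mul_sub, mul_div_cancel₀ _ hε0.ne', hεdef]
      field_simp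
      ring
    have hw1 : w - 1 ≤ δ * Real.exp s := by
      have hc := convexOn_exp.2 (mem_univ s) (mem_univ 0) hδ0.le
        (sub_nonneg.2 (show δ ≤ 1 by linarith)) (by ring)
      simp only [smul_eq_mul, mul_zero, add_zero, Real.exp_zero, mul_one] at hc
      rw [hws]; linarith
    have hw1' : 0 ≤ w - 1 := by
      rw [hws, sub_nonneg]; exact Real.one_le_exp (by positivity)
    have hb : r ^ 2 - 1 ≤ 80 / 39 * ε * δ * Real.exp s := by
      rw [hrw, div_le_iff₀ (by positivity)]
      have h39 : 39 / 40 ≤ t ^ 2 := by linarith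
      have : r ^ 2 * (ε * (w - 1)) ≤ 2 * (ε * (δ * Real.exp s)) := by
        gcongr
      have h2 : 80 / 39 * ε * δ * Real.exp s * (39 / 40) ≤ 80 / 39 * ε * δ * Real.exp s * t ^ 2 := by
        gcongr
      linarith
    have hnδ : ((n : ℝ) + 2) * δ ≤ 11 / 4 := by
      rw [hδ, mul_div_assoc', div_le_iff₀ hm]; linarith
    have hrpow : r ^ (n + 2) ≤ Real.exp (3 * ε * Real.exp s) := by
      have h1 : r ^ 2 ≤ Real.exp (r ^ 2 - 1) := by linarith [Real.add_one_le_exp (r ^ 2 - 1)]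
      have h2 : r ≤ Real.exp ((r ^ 2 - 1) / 2) := by
        apply le_of_sq_le_sq _ (Real.exp_pos _).le
        rw [← Real.exp_nat_mul]
        refine h1.trans_eq ?_
        congr 1
        push_cast
        ring
      calc r ^ (n + 2) ≤ Real.exp ((r ^ 2 - 1) / 2) ^ (n + 2) := by gcongr
        _ = Real.exp (((n : ℝ) + 2) * ((r ^ 2 - 1) / 2)) := by
            rw [← Real.exp_nat_mul]; push_cast; rfl
        _ ≤ Real.exp (3 * ε * Real.exp s) := by
            apply Real.exp_le_exp.2
            calc ((n : ℝ) + 2) * ((r ^ 2 - 1) / 2)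
                ≤ ((n : ℝ) + 2) * ((80 / 39 * ε * δ * Real.exp s) / 2) := by gcongr
              _ = 40 / 39 * (ε * Real.exp s) * (((n : ℝ) + 2) * δ) := by ring
              _ ≤ 40 / 39 * (ε * Real.exp s) * (11 / 4) := by gcongr
              _ ≤ 3 * ε * Real.exp s := by nlinarith [mul_pos hε0 (Real.exp_pos s)]
    have hx : δ * s + 3 * ε * Real.exp s ≤ (δ + 3 * ε) * Real.exp s := by
      have := mul_le_mul_of_nonneg_left hses hδ0.le
      linarith
    have hδn : δ ≤ 3 / n := by
      rw [hδ, div_le_div_iff₀ hm (by positivity)]; linarith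
    calc r ^ (n + 2) * w ≤ Real.exp (3 * ε * Real.exp s) * Real.exp (δ * s) := by
          rw [← hws]; gcongr
      _ = Real.exp (δ * s + 3 * ε * Real.exp s) := by rw [← Real.exp_add]; congr 1; ring
      _ ≤ 1 + (δ * s + 3 * ε * Real.exp s) * Real.exp (δ * s + 3 * ε * Real.exp s) :=
          exp_le_one_add_mul_exp _
      _ ≤ 1 + ((δ + 3 * ε) * Real.exp s) * Real.exp (s + Real.exp s / 4) := by
          have h1 : δ * s + 3 * ε * Real.exp s ≤ s + Real.exp s / 4 := by
            have h11 : δ * s ≤ s := mul_le_of_le_one_left hs.le (by linarith)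
            have h12 : 3 * ε * Real.exp s ≤ 1 / 4 * Real.exp s :=
              mul_le_mul_of_nonneg_right (by linarith) (Real.exp_pos s).le
            linarith
          have h2 : 0 ≤ (δ + 3 * ε) * Real.exp s := by positivity
          exact add_le_add_right (mul_le_mul hx (Real.exp_le_exp.2 h1) (Real.exp_pos _).le h2) 1
      _ = 1 + (δ + 3 * ε) * K := by
          rw [mul_assoc, ← Real.exp_add, hKdef]; congr 3; ring
      _ ≤ 1 + 531441 * (ε + 1 / n) * K := by
          gcongr
          have : (3 : ℝ) / n = 3 * (1 / n) := by ring
          have h0 : (0 : ℝ) ≤ 1 / n := by positivity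
          linarith
  · -- Far from the ball.
    have hw16 : 16 ≤ w := by
      rw [hwdef, le_div_iff₀ hε0, div_pow]
      have : t ^ 2 / r ^ 2 ≤ 1 / 2 := by
        rw [div_le_div_iff₀ (by positivity) (by norm_num)]; nlinarith
      linarith
    have hs4 : (4 : ℝ) ^ (n - 1) ≤ Real.exp s := by
      have h1 : Real.log 16 ≤ Real.log w := Real.log_le_log (by norm_num) hw16
      have h2 : Real.log 16 = 2 * Real.log 4 := by
        rw [show (16 : ℝ) = 4 ^ 2 by norm_num, Real.log_pow]; norm_num
      calc (4 : ℝ) ^ (n - 1) = Real.exp (((n : ℝ) - 1) * Real.log 4) := by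
            rw [← hcast, Real.exp_nat_mul, Real.exp_log (by norm_num)]
        _ ≤ Real.exp s := by
            apply Real.exp_le_exp.2
            rw [hwlog]
            nlinarith
    have hnn : (n : ℝ) ^ 2 ≤ Real.exp s / 4 := by
      have h1 := sq_le_four_pow (k := n - 2) (by omega)
      rw [Nat.sub_add_cancel hn] at h1
      have h2 : (n : ℝ) ^ 2 ≤ 4 ^ (n - 2) := by exact_mod_cast h1
      have h3 : (4 : ℝ) ^ (n - 1) = 4 * 4 ^ (n - 2) := by
        rw [← pow_succ']; congr 1; omega
      linarith
    have hrn' : n * r ^ (n + 2) ≤ Real.exp (Real.exp s / 4) := by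
      have hsn : 1 ≤ Real.sqrt n := Real.one_le_sqrt.2 (by linarith)
      calc n * r ^ (n + 2) ≤ Real.sqrt n ^ 2 * Real.sqrt n ^ (n + 2) := by
            rw [Real.sq_sqrt (by positivity)]; gcongr
        _ = Real.sqrt n ^ (n + 4) := by ring
        _ ≤ Real.sqrt n ^ (2 * n) := pow_le_pow_right₀ hsn (by omega)
        _ = (n : ℝ) ^ n := by rw [pow_mul, Real.sq_sqrt (by positivity)]
        _ ≤ Real.exp n ^ n := by
            gcongr
            linarith [Real.add_one_le_exp (n : ℝ)]
        _ = Real.exp ((n : ℝ) ^ 2) := by rw [← Real.exp_nat_mul, sq]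
        _ ≤ _ := Real.exp_le_exp.2 hnn
    have h0 : (0 : ℝ) < 1 / n := by positivity
    calc r ^ (n + 2) * w = 1 / n * (n * r ^ (n + 2)) * w := by field_simp
      _ ≤ 1 / n * Real.exp (Real.exp s / 4) * Real.exp (2 * s) := by gcongr
      _ = 1 / n * K := by rw [mul_assoc, ← Real.exp_add, hKdef]; congr 2; ring
      _ ≤ 531441 * (ε + 1 / n) * K := by gcongr; linarith
      _ ≤ _ := by linarith

/-- As `log 2 > 1 / 4`, the weight in `jacobian_le` is integrable against `exp (-log 2 * exp s)`. -/
lemma exp_weight_le {s : ℝ} :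
    Real.exp (-(Real.log 2) * Real.exp s) * Real.exp (2 * s + Real.exp s / 4) ≤
      100 * Real.exp (-s) := by
  have hl : (0.6931471803 : ℝ) < Real.log 2 := Real.log_two_gt_d9
  have hE := Real.exp_pos s
  have h1 : (2 / 5 * Real.exp s) ^ 3 / 6 ≤ Real.exp (2 / 5 * Real.exp s) := by
    have := Real.pow_div_factorial_le_exp (2 / 5 * Real.exp s) (by positivity) 3
    simpa [Nat.factorial] using this
  have h2 : Real.exp (2 * s) = Real.exp s ^ 2 := by rw [← Real.exp_nat_mul]; norm_num
  have h3 : Real.exp (-s) * Real.exp s = 1 := by rw [← Real.exp_add]; simp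
  have h4 : Real.exp (-(2 / 5 * Real.exp s)) * Real.exp (2 / 5 * Real.exp s) = 1 := by
    rw [← Real.exp_add]; simp
  calc Real.exp (-(Real.log 2) * Real.exp s) * Real.exp (2 * s + Real.exp s / 4)
      = Real.exp (-(Real.log 2) * Real.exp s + Real.exp s / 4) * Real.exp (2 * s) := by
        rw [← Real.exp_add, ← Real.exp_add]; congr 1; ring
    _ ≤ Real.exp (-(2 / 5 * Real.exp s)) * Real.exp s ^ 2 := by
        rw [h2]
        gcongr
        nlinarith
    _ ≤ 100 * Real.exp (-s) := by
        set E := Real.exp s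
        set F := Real.exp (-(2 / 5 * E)) with hF
        have hFpos : 0 < F := Real.exp_pos _
        have h5 : F * ((2 / 5 * E) ^ 3 / 6) ≤ 1 := by
          calc F * ((2 / 5 * E) ^ 3 / 6) ≤ F * Real.exp (2 / 5 * E) := by gcongr
            _ = 1 := h4
        have h6 : Real.exp (-s) = E⁻¹ := Real.exp_neg s
        rw [h6, ← div_eq_mul_inv, le_div_iff₀ hE]
        have : F * ((2 / 5 * E) ^ 3 / 6) = (F * E ^ 2 * E) * (8 / 750) := by ring
        rw [this] at h5
        linarith

lemma integrableOn_constII_integrand :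
    IntegrableOn (fun s : ℝ => Real.exp (-(Real.log 2) * Real.exp s)) (Ioi 0) := by
  refine Integrable.mono' ((integrableOn_exp_neg_Ioi 0).const_mul 100)
    (Continuous.aestronglyMeasurable (by fun_prop)) ?_
  refine (ae_restrict_iff' measurableSet_Ioi).2 (.of_forall fun s hs => ?_)
  have hs : 0 < s := hs
  rw [Real.norm_of_nonneg (Real.exp_pos _).le]
  refine le_trans ?_ (exp_weight_le (s := s))
  refine le_mul_of_one_le_right (Real.exp_pos _).le (Real.one_le_exp ?_)
  have := Real.exp_pos s
  linarith

lemma lintegral_outer_profile {c : ℝ} (hc : 0 ≤ c) :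
    ∫⁻ s in Ioi (0 : ℝ), ENNReal.ofReal (Real.exp (-(Real.log 2) * Real.exp s) *
      (1 + c * Real.exp (2 * s + Real.exp s / 4))) ≤
    ENNReal.ofReal (constII + 100 * c) := by
  have hi2 : IntegrableOn (fun s : ℝ => 100 * c * Real.exp (-s)) (Ioi 0) :=
    (integrableOn_exp_neg_Ioi 0).const_mul _
  have hi : IntegrableOn (fun s : ℝ => Real.exp (-(Real.log 2) * Real.exp s) +
      100 * c * Real.exp (-s)) (Ioi 0) := integrableOn_constII_integrand.add hi2
  calc _ ≤ ∫⁻ s in Ioi (0 : ℝ), ENNReal.ofReal (Real.exp (-(Real.log 2) * Real.exp s) +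
          100 * c * Real.exp (-s)) := by
        refine lintegral_mono fun s => ENNReal.ofReal_le_ofReal ?_
        have := mul_le_mul_of_nonneg_left (exp_weight_le (s := s)) hc
        nlinarith
    _ = _ := by
        rw [← ofReal_integral_eq_lintegral_ofReal hi (.of_forall fun s => by positivity),
          integral_add integrableOn_constII_integrand hi2, integral_const_mul, integral_exp_neg_Ioi,
          constII]
        simp

/-- Expected volume of the part of the polytope outside the ball, after the change of variables
`s = logCapRatio n t r`. -/
lemma lintegral_outer_le {n : ℕ} (hn : 2 ≤ n) {t : ℝ} (ht : 0 < t) (hε0 : 0 < 1 - t ^ 2)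
    (hε : 1 - t ^ 2 ≤ 1 / 40) :
    ∫⁻ r in Ioc 1 (Real.sqrt n), ENNReal.ofReal (r ^ (n - 1)) *
      ENNReal.ofReal (Real.exp (-(Real.log 2) * Real.exp (logCapRatio n t r))) ≤
    ENNReal.ofReal ((1 - t ^ 2) / t ^ 2 / (n - 1 : ℕ) *
      (constII + 53144100 * (1 - t ^ 2 + 1 / n))) := by
  have ht1 : t < 1 := by nlinarith
  have hm : 0 < ((n - 1 : ℕ) : ℝ) := by
    have : 0 < n - 1 := by omega
    positivity
  have hn0 : (0 : ℝ) < n := by positivity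
  set c := (1 - t ^ 2) / t ^ 2 / (n - 1 : ℕ) with hc
  have hc0 : 0 < c := by positivity
  set b := 531441 * (1 - t ^ 2 + 1 / n) with hb
  have hb0 : 0 ≤ b := by positivity
  set g : ℝ → ℝ := fun s => Real.exp (-(Real.log 2) * Real.exp s) *
      (1 + b * Real.exp (2 * s + Real.exp s / 4)) with hg
  set s' : ℝ → ℝ := fun r => (n - 1 : ℕ) * t ^ 2 /
        ((1 - t ^ 2) * r ^ 3 * ((1 - (t / r) ^ 2) / (1 - t ^ 2))) with hs'
  have hcov := lintegral_image_eq_lintegral_abs_deriv_mul (s := Ioc 1 (Real.sqrt n))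
    (f := logCapRatio n t) (f' := s')
    measurableSet_Ioc
    (fun r hr => (hasDerivAt_logCapRatio ht ht1 (ht1.trans hr.1)).hasDerivWithinAt)
    ((injOn_logCapRatio hn ht ht1).mono fun x hx => ht1.trans hx.1)
    (fun v => ENNReal.ofReal (g v))
  have himg : logCapRatio n t '' Ioc 1 (Real.sqrt n) ⊆ Ioi 0 := by
    rintro _ ⟨r, hr, rfl⟩
    exact logCapRatio_pos hn ht ht1 hr.1
  calc _ ≤ ∫⁻ r in Ioc 1 (Real.sqrt n), ENNReal.ofReal c *
          (ENNReal.ofReal |s' r| * ENNReal.ofReal (g (logCapRatio n t r))) := by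
        refine setLIntegral_mono' measurableSet_Ioc fun r hr => ?_
        have hr0 : 0 < r := one_pos.trans hr.1
        have hw := capRatio_pos ht ht1 (ht1.trans hr.1)
        have hJ := jacobian_le hn ht hε0 hε hr.1 hr.2
        rw [← ENNReal.ofReal_mul (by positivity), ← ENNReal.ofReal_mul (abs_nonneg _),
          ← ENNReal.ofReal_mul hc0.le]
        apply ENNReal.ofReal_le_ofReal
        have hdef : s' r = (n - 1 : ℕ) * t ^ 2 /
          ((1 - t ^ 2) * r ^ 3 * ((1 - (t / r) ^ 2) / (1 - t ^ 2))) := rfl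
        set w := (1 - (t / r) ^ 2) / (1 - t ^ 2) with hwdef
        set L := logCapRatio n t r
        have hs'0 : 0 < s' r := by rw [hdef]; positivity
        rw [abs_of_pos hs'0]
        have e : c * (s' r * g L) = Real.exp (-(Real.log 2) * Real.exp L) *
            ((1 + b * Real.exp (2 * L + Real.exp L / 4)) / (r ^ 3 * w)) := by
          rw [hdef]
          simp only [hg, hc]
          field_simp
        rw [e, mul_comm]
        refine mul_le_mul_of_nonneg_left ?_ (Real.exp_pos _).le
        rw [le_div_iff₀ (by positivity)]
        refine le_of_eq_of_le ?_ hJ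
        rw [← mul_assoc, ← pow_add]
        congr 2
        omega
    _ = ENNReal.ofReal c * ∫⁻ v in logCapRatio n t '' Ioc 1 (Real.sqrt n),
          ENNReal.ofReal (g v) := by
        rw [hcov, lintegral_const_mul' _ _ ENNReal.ofReal_ne_top]
    _ ≤ ENNReal.ofReal c * ∫⁻ v in Ioi 0, ENNReal.ofReal (g v) := by
        gcongr
    _ ≤ ENNReal.ofReal c * ENNReal.ofReal (constII + 100 * b) := by
        gcongr
        exact lintegral_outer_profile hb0
    _ = _ := by
        rw [← ENNReal.ofReal_mul hc0.le, hb]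
        congr 2
        ring

/-! ### Polytopes with small volume deviation -/

lemma measurable_logCapRatio (n : ℕ) (t : ℝ) : Measurable (logCapRatio n t) := by
  unfold logCapRatio; fun_prop

/-- The expected volume deviation, evaluated. -/
lemma exists_circumPolytope_volDiff_le {n : ℕ} (hn : 2 ≤ n) {M : ℕ} (hM : 1 ≤ M) {t : ℝ}
    (ht : 0 < t) (hε0 : 0 < 1 - t ^ 2) (hε : 1 - t ^ 2 ≤ 1 / 40)
    (hfrac : sectorFraction n t = Real.log 2 / M) :
    ∃ u : Fin M ⊕ (Fin n × Bool) → Euc n, (∀ i, ‖u i‖ = 1) ∧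
      Bornology.IsBounded (circumPolytope u t) ∧
      volDiff (circumPolytope u t) (unitBall n) ≤
        (n * ((1 - t ^ 2) / t ^ 2 / (n - 1 : ℕ) * (constI + Real.log 2 ^ 2 / M / 2)) +
          n * ((1 - t ^ 2) / t ^ 2 / (n - 1 : ℕ) *
            (constII + 53144100 * (1 - t ^ 2 + 1 / n))) +
          2 * n * ((1 - t ^ n) * (Real.log 2 / M))) * vol (unitBall n) := by
  have ht1 : t < 1 := by nlinarith
  have hl0 := Real.log_pos one_lt_two
  have hl1 : Real.log 2 < 1 := by linarith [Real.log_two_lt_d9]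
  have hM0 : (0 : ℝ) < M := by exact_mod_cast hM
  have hM1 : (1 : ℝ) ≤ M := by exact_mod_cast hM
  set a : ℝ := Real.log 2 ^ 2 / M with ha
  have ha0 : 0 ≤ a := by positivity
  set φ : ℝ → ℝ := fun r => 1 - Real.exp (-(Real.log 2) * Real.exp (logCapRatio n t r)) +
        a * Real.exp (logCapRatio n t r) ^ 2 with hφ
  set φ' : ℝ → ℝ := fun r => Real.exp (-(Real.log 2) * Real.exp (logCapRatio n t r)) with hφ'
  have hL := measurable_logCapRatio n t
  have hfr1 : ∀ r, t ≤ r → sectorFraction n (t / r) ≤ 1 := fun r hr => by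
    have hr0 : 0 < r := ht.trans_le hr
    exact sectorFraction_le_one hn (by positivity) ((div_le_one hr0).2 hr)
  obtain ⟨u, hu, hb, hvol⟩ := exists_circumPolytope_volume_le hn M ht ht1.le
    (Φ := fun r => ENNReal.ofReal (φ r)) (Φ' := fun r => ENNReal.ofReal (φ' r)) (by
      intro r hr hr1
      apply ENNReal.ofReal_le_ofReal
      have hq := sectorFraction_div_le hn ht ht1 hr hr1
      rw [hfrac] at hq
      have hL0 : logCapRatio n t r ≤ 0 := by
        rcases hr1.eq_or_lt with rfl | hr1
        · simp [logCapRatio, div_self hε0.ne']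
        · exact (logCapRatio_neg hn ht hr hr1).le
      set v := Real.exp (logCapRatio n t r) with hv
      have hv0 : 0 < v := Real.exp_pos _
      have hv1 : v ≤ 1 := Real.exp_le_one_iff.2 hL0
      set p := Real.log 2 / M * v with hp
      have hp0 : 0 ≤ p := by positivity
      have hp1 : p ≤ 1 := mul_le_one₀ ((div_le_one hM0).2 (by linarith)) hv0.le hv1
      have h1 := exp_sub_le_one_sub_pow hp0 hp1 M
      have h2 : (1 - p) ^ M ≤ (1 - sectorFraction n (t / r)) ^ M :=
        pow_le_pow_left₀ (by linarith) (by linarith) M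
      have e1 : -(M * p) = -(Real.log 2) * v := by rw [hp]; field_simp
      have e2 : M * p ^ 2 = a * v ^ 2 := by rw [hp, ha]; field_simp
      rw [e1, e2] at h1
      simp only [hφ]
      linarith) (by
      intro r hr hrn
      apply ENNReal.ofReal_le_ofReal
      have hq := le_sectorFraction_div hn ht ht1 hr.le
      rw [hfrac] at hq
      have h1 := hfr1 r (ht1.le.trans hr.le)
      set q := sectorFraction n (t / r)
      calc (1 - q) ^ M ≤ Real.exp (-q) ^ M :=
            pow_le_pow_left₀ (by linarith) (by linarith [Real.add_one_le_exp (-q)]) M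
        _ = Real.exp (-(M * q)) := by rw [← Real.exp_nat_mul]; congr 1; ring
        _ ≤ _ := by
            apply Real.exp_le_exp.2
            have : Real.log 2 * Real.exp (logCapRatio n t r) ≤ M * q := by
              calc _ = M * (Real.log 2 / M * Real.exp (logCapRatio n t r)) := by field_simp
                _ ≤ _ := by gcongr
            linarith)
  refine ⟨u, hu, hb, ?_⟩
  have hmφ : Measurable fun r => ENNReal.ofReal (φ r) := by
    simp only [hφ]; fun_prop
  have hmφ' : Measurable fun r => ENNReal.ofReal (φ' r) := by
    simp only [hφ']; fun_prop
  have hpolar : ∀ (f : ℝ → ℝ≥0∞) (α β : ℝ), 0 ≤ α → Measurable f →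
      ∫⁻ x : Euc n, (Ioc α β).indicator f ‖x‖ = n * volume (unitBall n) *
        ∫⁻ r in Ioc α β, ENNReal.ofReal (r ^ (n - 1)) * f r := by
    intro f α β hα hf
    rw [lintegral_radial (by omega) (hf.indicator measurableSet_Ioc)]
    congr 1
    have : ∀ r, ENNReal.ofReal (r ^ (n - 1)) * (Ioc α β).indicator f r =
        (Ioc α β).indicator (fun r => ENNReal.ofReal (r ^ (n - 1)) * f r) r := fun r => by
      by_cases hr : r ∈ Ioc α β <;> simp [hr]
    simp_rw [this]
    rw [setLIntegral_indicator measurableSet_Ioc]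
    congr 2
    ext r
    simp only [mem_inter_iff, mem_Ioc, mem_Ioi]
    exact ⟨fun h => h.1, fun h => ⟨h, hα.trans_lt h.1⟩⟩
  rw [hpolar _ _ _ ht.le hmφ, hpolar _ _ _ zero_le_one hmφ', hfrac,
    setLIntegral_congr (Ioo_ae_eq_Ioc (μ := volume) (a := t) (b := (1 : ℝ))).symm] at hvol
  have h1 := lintegral_inner_le hn ht ht1 ha0
  have h2 := lintegral_outer_le hn ht hε0 hε
  set A := (1 - t ^ 2) / t ^ 2 / (n - 1 : ℕ) * (constI + a / 2) with hA
  set B := (1 - t ^ 2) / t ^ 2 / (n - 1 : ℕ) *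
      (constII + 53144100 * (1 - t ^ 2 + 1 / n)) with hB
  have hA0 : 0 ≤ A := by
    have := constI_nonneg
    positivity
  have hB0 : 0 ≤ B := by
    have := constII_nonneg
    positivity
  have hbox0 : 0 ≤ 2 * n * ((1 - t ^ n) * (Real.log 2 / M)) := by
    have : 0 ≤ 1 - t ^ n := sub_nonneg.2 (pow_le_one₀ ht.le ht1.le)
    positivity
  have hvD : volume (unitBall n) = ENNReal.ofReal (vol (unitBall n)) := by
    rw [vol, ENNReal.ofReal_toReal volume_unitBall_lt_top.ne]
  have hv0 := vol_unitBall_pos n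
  have hfinal : volume (circumPolytope u t ∆ unitBall n) ≤
      ENNReal.ofReal ((n * A + n * B + 2 * n * ((1 - t ^ n) * (Real.log 2 / M))) *
        vol (unitBall n)) := by
    refine hvol.trans ?_
    calc _ ≤ n * volume (unitBall n) * ENNReal.ofReal A + n * volume (unitBall n) * ENNReal.ofReal B
          + ENNReal.ofReal (2 * n * ((1 - t ^ n) * (Real.log 2 / M))) * volume (unitBall n) := by
          gcongr
      _ = _ := by
          rw [hvD, ← ENNReal.ofReal_natCast, ← ENNReal.ofReal_mul (by positivity),
            ← ENNReal.ofReal_mul (by positivity), ← ENNReal.ofReal_mul (by positivity),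
            ← ENNReal.ofReal_mul hbox0, ← ENNReal.ofReal_add (by positivity) (by positivity),
            ← ENNReal.ofReal_add (by positivity) (by positivity)]
          congr 1
          ring
  rw [volDiff, vol]
  exact ENNReal.toReal_le_of_le_ofReal (by positivity) hfinal

lemma pow_add_le_ten_pow {n : ℕ} (hn : 2 ≤ n) : n ^ 3 + 2 * n ≤ 10 ^ n := by
  induction n, hn using Nat.le_induction with
  | base => norm_num
  | succ n hn ih =>
    rw [pow_succ 10]
    nlinarith [Nat.zero_le (n ^ 3), Nat.zero_le (n ^ 2), mul_le_mul hn hn (Nat.zero_le _) (Nat.zero_le _),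
      mul_le_mul hn (mul_le_mul hn hn (Nat.zero_le _) (Nat.zero_le _)) (Nat.zero_le _) (Nat.zero_le _)]

lemma mul_seven_pow_le {n : ℕ} (hn : 2 ≤ n) : n * 7 ^ n + 10 * n ≤ 5 * 10 ^ n := by
  rcases hn.eq_or_lt with rfl | hn3
  · norm_num
  induction n, (show 3 ≤ n from hn3) using Nat.le_induction with
  | base => norm_num
  | succ n hn ih =>
    have ih := ih (by omega) (by omega)
    rw [pow_succ 10, pow_succ 7]
    have h7 : 0 < 7 ^ n := by positivity
    nlinarith

lemma continuous_sectorFraction (n : ℕ) : Continuous (sectorFraction n) := by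
  unfold sectorFraction
  exact ((continuous_sectorProfile n).const_mul _).div_const _

lemma sectionProfile_le_sectorFraction {n : ℕ} (hn : 2 ≤ n) {s : ℝ} (hs : s ∈ Icc (0 : ℝ) 1) :
    sectionProfile n s ≤ 2 * n * sectorFraction n s := by
  have hv := vol_unitBall_pos n
  have h1 : vol (unitBall n) ≤ 2 * vol (unitBall (n - 1)) := by
    have h := ENNReal.toReal_mono (ENNReal.mul_lt_top (by simp) volume_unitBall_lt_top).ne
      (volume_unitBall_le (n := n) (by omega))
    rwa [ENNReal.toReal_mul] at h
  have h2 := sectionProfile_div_le_sectorProfile hn hs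
  have hn0 : (0 : ℝ) < n := by positivity
  rw [div_le_iff₀ hn0] at h2
  have h3 := sectorProfile_nonneg hn hs
  unfold sectorFraction
  rw [← mul_div_assoc, le_div_iff₀ hv]
  calc sectionProfile n s * vol (unitBall n)
      ≤ (sectorProfile n s * n) * (2 * vol (unitBall (n - 1))) := by gcongr
    _ = _ := by ring

/-- The distance `t` at which the caps of the ball have measure `log 2 / M`. -/
lemma exists_sectorFraction_eq {n : ℕ} (hn : 2 ≤ n) {N : ℕ} (hN : 10 ^ n ≤ N) :
    ∃ t : ℝ, 0 < t ∧ 0 < 1 - t ^ 2 ∧ 1 - t ^ 2 ≤ 1 / 40 ∧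
      1 - t ^ 2 ≤ (4 * n / N : ℝ) ^ ((2 : ℝ) / (n - 1)) ∧
      sectorFraction n t = Real.log 2 / (N - 2 * n : ℕ) := by
  have h1 := pow_add_le_ten_pow hn
  have h2 := mul_seven_pow_le hn
  have hn8 : 8 * n ≤ N * 2 := by
    have : n * 2 ^ 2 ≤ n * n ^ 2 := by gcongr
    have : n * n ^ 2 = n ^ 3 := by ring
    omega
  have hnN : 2 * n ≤ N := by
    have : 0 ≤ n ^ 3 := Nat.zero_le _
    omega
  have hcast : ((N - 2 * n : ℕ) : ℝ) = N - 2 * n := by push_cast [Nat.cast_sub hnN]; ring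
  have hNr : (10 : ℝ) ^ n ≤ N := by exact_mod_cast hN
  have h1r : (n : ℝ) ^ 3 + 2 * n ≤ 10 ^ n := by exact_mod_cast h1
  have h2r : (n : ℝ) * 7 ^ n + 10 * n ≤ 5 * 10 ^ n := by exact_mod_cast h2
  have h8r : 8 * (n : ℝ) ≤ N * 2 := by exact_mod_cast hn8
  have hn2 : (2 : ℝ) ≤ n := by exact_mod_cast hn
  have hl0 := Real.log_pos one_lt_two
  have hl1 : Real.log 2 < 7 / 10 := by linarith [Real.log_two_lt_d9]
  have hn3 : 4 * (n : ℝ) ≤ n ^ 3 := by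
    calc 4 * (n : ℝ) = 2 ^ 2 * n := by norm_num
      _ ≤ n ^ 2 * n := by gcongr
      _ = n ^ 3 := by ring
  have hM0 : (0 : ℝ) < N - 2 * n := by linarith
  rw [hcast]
  set y := Real.log 2 / ((N : ℝ) - 2 * n) with hy
  have hy0 : 0 < y := by positivity
  have hprof0 : sectionProfile n 0 = 1 := by simp [sectionProfile]
  have hy1 : y ≤ sectorFraction n 0 := by
    have h := sectionProfile_le_sectorFraction hn (left_mem_Icc.2 zero_le_one)
    rw [hprof0] at h
    have h3 : 2 * n * y ≤ 1 := by
      rw [hy, mul_div_assoc', div_le_one hM0]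
      nlinarith
    by_contra hlt
    push Not at hlt
    nlinarith
  have hone : sectorFraction n 1 = 0 := by simp [sectorFraction, sectorProfile_one hn]
  obtain ⟨t, htI, ht⟩ := intermediate_value_Icc' zero_le_one
    (continuous_sectorFraction n).continuousOn (show y ∈ Icc (sectorFraction n 1) _ from
      ⟨hone ▸ hy0.le, hy1⟩)
  have ht1 : t < 1 := lt_of_le_of_ne htI.2 fun h => by
    rw [h, hone] at ht; exact hy0.ne ht
  have hε0 : 0 < 1 - t ^ 2 := by nlinarith [htI.1]
  have hprof := sectionProfile_le_sectorFraction hn htI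
  rw [ht] at hprof
  have hq0 := Real.sqrt_nonneg (1 - t ^ 2)
  have hqsq := Real.sq_sqrt hε0.le
  have hε : 1 - t ^ 2 ≤ 1 / 40 := by
    by_contra hcon
    push Not at hcon
    -- `sectionProfile n t` would be at least `7 ^ (1 - n)`, too much for `N ≥ 10 ^ n`.
    have hq : 1 / 7 ≤ Real.sqrt (1 - t ^ 2) := by
      apply Real.le_sqrt_of_sq_le; norm_num; linarith
    have h3 : (1 / 7 : ℝ) ^ (n - 1) ≤ 2 * n * y := (pow_le_pow_left₀ (by norm_num) hq _).trans hprof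
    have h7 : (7 : ℝ) ^ n = 7 * 7 ^ (n - 1) := by rw [← pow_succ']; congr 1; omega
    rw [hy, mul_div_assoc', le_div_iff₀ hM0, one_div, inv_pow, inv_mul_le_iff₀ (by positivity)] at h3
    have h4 : (7 : ℝ) ^ (n - 1) * (2 * n * Real.log 2) < 7 ^ (n - 1) * (2 * n * (7 / 10)) := by
      gcongr
    nlinarith
  refine ⟨t, by nlinarith [htI.1], hε0, hε, ?_, ht⟩
  have hm : (0 : ℝ) < n - 1 := by linarith
  have hN0 : (0 : ℝ) < N := by linarith
  have h3 : sectionProfile n t ≤ 4 * n / N := by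
    refine hprof.trans ?_
    rw [hy, mul_div_assoc', div_le_div_iff₀ hM0 hN0]
    have : 2 * (n : ℝ) * Real.log 2 * N ≤ 2 * n * (7 / 10) * N := by gcongr
    have h5 : (n : ℝ) * (8 * n) ≤ n * (N * 2) := by gcongr
    nlinarith
  calc 1 - t ^ 2 = sectionProfile n t ^ ((2 : ℝ) / (n - 1)) := by
        have hcm : ((n - 1 : ℕ) : ℝ) = n - 1 := by rw [Nat.cast_sub (by omega)]; simp
        rw [sectionProfile, Real.sqrt_eq_rpow, ← Real.rpow_natCast _ (n - 1),
          ← Real.rpow_mul hε0.le, ← Real.rpow_mul hε0.le, hcm]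
        rw [show (1 / 2 * ((n : ℝ) - 1) * (2 / (n - 1))) = 1 by field_simp, Real.rpow_one]
    _ ≤ _ := Real.rpow_le_rpow (sectionProfile_nonneg n t) h3 (by positivity)

/-- Polytopes with at most `N ≥ 10ⁿ` facets, all at distance `√(1 - ε)` from the origin, for which
both deviations from the unit ball are of order `ε ≤ (4n / N)^(2 / (n-1))`. -/
lemma exists_polytope_approx {n : ℕ} (hn : 2 ≤ n) {N : ℕ} (hN : 10 ^ n ≤ N) :
    ∃ P ∈ polytopesWithAtMost n N, ∃ ε : ℝ, 0 < ε ∧ ε ≤ 1 / 40 ∧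
      ε ≤ (4 * n / N : ℝ) ^ ((2 : ℝ) / (n - 1)) ∧
      volDiff P (unitBall n) ≤
        (n / (n - 1) * (ε / (1 - ε)) * (constI + constII + 53144103 * (ε + 1 / n))) *
          vol (unitBall n) ∧
      surfDev P (unitBall n) ≤ n * volDiff P (unitBall n) +
        (ε / 2 + ε ^ 2) * n * (vol (unitBall n) + volDiff P (unitBall n)) := by
  obtain ⟨t, ht0, hε0, hε, hεN, hfrac⟩ := exists_sectorFraction_eq hn hN
  have h1 := pow_add_le_ten_pow hn
  have hcube : n ^ 3 ≤ N - 2 * n := by omega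
  have hM : 1 ≤ N - 2 * n := le_trans (Nat.one_le_pow _ _ (by omega)) hcube
  obtain ⟨u, hu, hb, hvol⟩ := exists_circumPolytope_volDiff_le hn hM ht0 hε0 hε hfrac
  have ht1 : t ≤ 1 := by nlinarith
  refine ⟨circumPolytope u t, circumPolytope_mem_polytopesWithAtMost hu ht0 hb ?_, 1 - t ^ 2, hε0,
    hε, hεN, ?_, ?_⟩
  · simp only [Fintype.card_sum, Fintype.card_fin, Fintype.card_prod, Fintype.card_bool]
    omega
  · refine hvol.trans (mul_le_mul_of_nonneg_right ?_ (vol_unitBall_pos n).le)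
    have hcubeR : (n : ℝ) ^ 3 ≤ (N - 2 * n : ℕ) := by exact_mod_cast hcube
    set M : ℝ := ((N - 2 * n : ℕ) : ℝ)
    have hn2 : (2 : ℝ) ≤ n := by exact_mod_cast hn
    have hl0 := Real.log_pos one_lt_two
    have hl1 : Real.log 2 < 1 := by linarith [Real.log_two_lt_d9]
    have hcm : ((n - 1 : ℕ) : ℝ) = n - 1 := by rw [Nat.cast_sub (by omega)]; simp
    have hm : (0 : ℝ) < n - 1 := by linarith
    rw [hcm]
    have ht2 : t ^ 2 = 1 - (1 - t ^ 2) := by ring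
    have hpow : 1 - t ^ n ≤ n * (1 - t ^ 2) := by
      have := one_add_mul_le_pow (a := t - 1) (by linarith) n
      rw [add_sub_cancel] at this
      have h5 : (n : ℝ) * (1 - t) ≤ n * (1 - t ^ 2) := by
        gcongr
        nlinarith
      linarith
    set ε := 1 - t ^ 2
    rw [ht2]
    have hn3 : (0 : ℝ) < (n : ℝ) ^ 3 := by positivity
    have hM0 : 0 < M := hn3.trans_le hcubeR
    have hnn : (n : ℝ) ≤ n ^ 3 := le_self_pow₀ (by linarith) (by norm_num)
    have hsq : Real.log 2 ^ 2 / M / 2 ≤ 1 / n := by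
      have h6 : Real.log 2 ^ 2 ≤ 1 := by nlinarith
      rw [div_div, div_le_div_iff₀ (by positivity) (by positivity)]
      nlinarith
    have hbox : 2 * n * ((1 - t ^ n) * (Real.log 2 / M)) ≤ ε * (2 / n) := by
      have h7 : Real.log 2 / M ≤ 1 / n ^ 3 := by gcongr
      calc 2 * n * ((1 - t ^ n) * (Real.log 2 / M)) ≤ 2 * n * ((n * ε) * (1 / n ^ 3)) := by
            gcongr
        _ = ε * (2 / n) := by field_simp
    have hfac : ε ≤ n / (n - 1) * (ε / (1 - ε)) := by
      have h8 : 1 ≤ (n : ℝ) / (n - 1) := by rw [one_le_div hm]; linarith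
      have h9 : ε ≤ ε / (1 - ε) := by
        rw [le_div_iff₀ (by linarith)]; nlinarith
      nlinarith
    have h10 : ε * (2 / n) ≤ n / (n - 1) * (ε / (1 - ε)) * (2 / n) := by gcongr
    have hpos : 0 < (n : ℝ) / (n - 1) * (ε / (1 - ε)) := hε0.trans_le hfac
    calc _ ≤ n * (ε / (1 - ε) / (n - 1) * (constI + 1 / n)) +
          n * (ε / (1 - ε) / (n - 1) * (constII + 53144100 * (ε + 1 / n))) +
          n / (n - 1) * (ε / (1 - ε)) * (2 / n) := by
          have : 0 < 1 - ε := by linarith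
          have hcI := constI_nonneg
          refine add_le_add (add_le_add ?_ le_rfl) (hbox.trans h10)
          gcongr
      _ = n / (n - 1) * (ε / (1 - ε)) *
          (constI + constII + 53144100 * (ε + 1 / n) + 3 / n) := by ring
      _ ≤ _ := by
          refine mul_le_mul_of_nonneg_left ?_ hpos.le
          have : (3 : ℝ) / n = 3 * (1 / n) := by ring
          linarith
  · refine (surfDev_circumPolytope_le (by omega) hu ht0 ht1 hb).trans ?_
    have hvd : 0 ≤ volDiff (circumPolytope u t) (unitBall n) := ENNReal.toReal_nonneg
    have hv := vol_unitBall_pos n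
    gcongr
    rw [sub_le_iff_le_add, div_le_iff₀ ht0]
    have ht2 : t ^ 2 = 1 - (1 - t ^ 2) := by ring
    set ε := 1 - t ^ 2
    apply le_of_sq_le_sq _ (by positivity)
    rw [mul_pow, ht2]
    nlinarith [sq_nonneg ε, mul_pos hε0 hε0, pow_pos hε0 3, pow_pos hε0 4, pow_pos hε0 5,
      mul_nonneg (sq_nonneg ε) (sub_nonneg.2 hε)]

/-! ### Choice of the constants -/

lemma rpow_neg_half_mem {n : ℕ} (hn : 1 ≤ n) :
    0 < (n : ℝ) ^ (-(1 / 2 : ℝ)) ∧ (n : ℝ) ^ (-(1 / 2 : ℝ)) ≤ 1 ∧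
      1 / (n : ℝ) ≤ (n : ℝ) ^ (-(1 / 2 : ℝ)) := by
  have hn0 : (1 : ℝ) ≤ n := by exact_mod_cast hn
  refine ⟨by positivity, Real.rpow_le_one_of_one_le_of_nonpos hn0 (by norm_num), ?_⟩
  rw [one_div, ← Real.rpow_neg_one]
  exact Real.rpow_le_rpow_of_exponent_le hn0 (by norm_num)

/-- The left side is `exp O(log n / n)`, and `log n = O(√n)`. -/
lemma four_mul_rpow_le {n : ℕ} (hn : 2 ≤ n) :
    (4 * n : ℝ) ^ ((2 : ℝ) / (n - 1)) ≤ 1 + Real.exp 16 * (n : ℝ) ^ (-(1 / 2 : ℝ)) := by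
  obtain ⟨hx0, hx1, -⟩ := rpow_neg_half_mem (n := n) (by omega)
  have hn2 : (2 : ℝ) ≤ n := by exact_mod_cast hn
  have hn0 : (0 : ℝ) < n := by linarith
  have hm : (0 : ℝ) < n - 1 := by linarith
  set x := (n : ℝ) ^ (-(1 / 2 : ℝ)) with hx
  have hxs : x = (Real.sqrt n)⁻¹ := by rw [hx, Real.rpow_neg hn0.le, Real.sqrt_eq_rpow]
  set q := Real.sqrt n with hq
  have hq0 : 0 < q := Real.sqrt_pos.2 hn0
  have hqn : (n : ℝ) = q ^ 2 := (Real.sq_sqrt hn0.le).symm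
  have hlog : Real.log (4 * n) ≤ 4 * q := by
    have h1 : (4 * n : ℝ) = (2 * q) ^ 2 := by rw [hqn]; ring
    rw [h1, Real.log_pow]
    have := Real.log_le_sub_one_of_pos (show 0 < 2 * q by positivity)
    push_cast
    linarith
  have hexp : Real.log (4 * n) * (2 / (n - 1)) ≤ 16 * x := by
    rw [mul_div_assoc', div_le_iff₀ hm, hxs]
    have h2 : 16 * q⁻¹ * ((n : ℝ) - 1) ≥ 16 * q⁻¹ * (n / 2) := by
      have : 0 ≤ 16 * q⁻¹ := by positivity
      exact mul_le_mul_of_nonneg_left (by linarith) this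
    have h3 : 16 * q⁻¹ * ((n : ℝ) / 2) = 8 * q := by rw [hqn]; field_simp; norm_num
    linarith
  rw [Real.rpow_def_of_pos (by positivity)]
  refine (Real.exp_le_exp.2 hexp).trans ?_
  have hc := convexOn_exp.2 (mem_univ 16) (mem_univ 0) hx0.le (sub_nonneg.2 hx1) (by ring)
  simp only [smul_eq_mul, mul_zero, add_zero, Real.exp_zero, mul_one] at hc
  rw [mul_comm 16 x]
  linarith

lemma rate_pos {n N : ℕ} (hN : 1 ≤ N) : 0 < rate n N := by
  have : (0 : ℝ) < N := by exact_mod_cast hN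
  unfold rate; positivity

lemma rate_le_one {n N : ℕ} (hn : 2 ≤ n) (hN : 1 ≤ N) : rate n N ≤ 1 := by
  have hN0 : (1 : ℝ) ≤ N := by exact_mod_cast hN
  have hn2 : (2 : ℝ) ≤ n := by exact_mod_cast hn
  exact Real.rpow_le_one_of_one_le_of_nonpos hN0
    (div_nonpos_of_nonpos_of_nonneg (by norm_num) (by linarith))

lemma rate_le_one_div {n N : ℕ} (hn : 2 ≤ n) (hN : n ^ n ≤ N) : rate n N ≤ 1 / n := by
  have hn2 : (2 : ℝ) ≤ n := by exact_mod_cast hn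
  have hm : (0 : ℝ) < n - 1 := by linarith
  have hNr : (n : ℝ) ^ n ≤ N := by exact_mod_cast hN
  calc rate n N ≤ ((n : ℝ) ^ n) ^ (-(2 : ℝ) / (n - 1)) :=
        Real.rpow_le_rpow_of_nonpos (by positivity) hNr
          (div_nonpos_of_nonpos_of_nonneg (by norm_num) hm.le)
    _ = (n : ℝ) ^ (n * (-(2 : ℝ) / (n - 1))) := by
        rw [← Real.rpow_natCast, ← Real.rpow_mul (by positivity)]
    _ ≤ (n : ℝ) ^ (-1 : ℝ) := by
        apply Real.rpow_le_rpow_of_exponent_le (by linarith)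
        rw [mul_div_assoc', div_le_iff₀ hm]
        linarith
    _ = 1 / n := by rw [Real.rpow_neg_one, one_div]

lemma four_mul_div_rpow {n N : ℕ} :
    (4 * n / N : ℝ) ^ ((2 : ℝ) / (n - 1)) = (4 * n : ℝ) ^ ((2 : ℝ) / (n - 1)) * rate n N := by
  rw [Real.div_rpow (by positivity) (by positivity), div_eq_mul_inv,
    ← Real.rpow_neg (by positivity), rate, neg_div]

/-- The approximation result for all `N ≥ 10ⁿ`, up to an absolute constant. -/
lemma exists_polytope_const :
    ∃ C : ℝ, 0 ≤ C ∧ ∀ n N : ℕ, 2 ≤ n → 10 ^ n ≤ N → ∃ P ∈ polytopesWithAtMost n N,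
      volDiff P (unitBall n) ≤ C * rate n N * vol (unitBall n) ∧
      surfDev P (unitBall n) ≤ C * rate n N * surfaceArea (unitBall n) := by
  have hI := constI_nonneg
  have hII := constII_nonneg
  set K := Real.exp 16 with hK
  have hK0 : 0 < K := Real.exp_pos _
  set A := 4 * (constI + constII + 53144103) * (1 + K) with hA
  have hA0 : 0 < A := by positivity
  refine ⟨A + (1 + K) * (1 + A), by positivity, fun n N hn hN => ?_⟩
  obtain ⟨P, hP, ε, hε0, hε, hεN, hV, hS⟩ := exists_polytope_approx hn hN
  have hN1 : 1 ≤ N := (Nat.one_le_pow _ _ (by norm_num)).trans hN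
  have hR0 := rate_pos (n := n) hN1
  have hR1 := rate_le_one hn hN1
  obtain ⟨hx0, hx1, hnx⟩ := rpow_neg_half_mem (n := n) (by omega)
  have h4 := four_mul_rpow_le hn
  rw [four_mul_div_rpow] at hεN
  set R := rate n N
  set v := vol (unitBall n) with hv
  have hv0 : 0 < v := vol_unitBall_pos n
  have hn2 : (2 : ℝ) ≤ n := by exact_mod_cast hn
  have hm : (0 : ℝ) < n - 1 := by linarith
  have hεR : ε ≤ (1 + K) * R := by
    refine hεN.trans (mul_le_mul_of_nonneg_right (h4.trans ?_) hR0.le)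
    have := mul_le_mul_of_nonneg_left hx1 hK0.le
    linarith
  have hfac : n / (n - 1) * (ε / (1 - ε)) ≤ 4 * ε := by
    have h1 : (n : ℝ) / (n - 1) ≤ 2 := by rw [div_le_iff₀ hm]; linarith
    have h2 : ε / (1 - ε) ≤ 2 * ε := by
      rw [div_le_iff₀ (by linarith)]; nlinarith
    calc n / (n - 1) * (ε / (1 - ε)) ≤ 2 * (2 * ε) :=
          mul_le_mul h1 h2 (div_nonneg hε0.le (by linarith)) (by norm_num)
      _ = 4 * ε := by ring
  have hVA : volDiff P (unitBall n) ≤ A * R * v := by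
    refine hV.trans (mul_le_mul_of_nonneg_right ?_ hv0.le)
    have h1 : 1 / (n : ℝ) ≤ 1 / 2 := by gcongr
    calc n / (n - 1) * (ε / (1 - ε)) * (constI + constII + 53144103 * (ε + 1 / n))
        ≤ 4 * ((1 + K) * R) * (constI + constII + 53144103 * 1) := by
          have h2 : constI + constII + 53144103 * (ε + 1 / n) ≤ constI + constII + 53144103 * 1 := by
            linarith
          exact mul_le_mul (hfac.trans (by linarith)) h2 (by positivity) (by positivity)
      _ = A * R := by rw [hA]; ring
  set V := volDiff P (unitBall n)
  refine ⟨P, hP, hVA.trans ?_, hS.trans ?_⟩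
  · gcongr
    have : 0 ≤ (1 + K) * (1 + A) := by positivity
    linarith
  · rw [surfaceArea_unitBall (by omega), ← hv]
    have hV2 : V ≤ A * v := by
      refine hVA.trans (mul_le_mul_of_nonneg_right ?_ hv0.le)
      exact mul_le_of_le_one_right hA0.le hR1
    have he : ε / 2 + ε ^ 2 ≤ (1 + K) * R := by nlinarith
    have hn0 : (0 : ℝ) < n := by linarith
    have hV0 : 0 ≤ V := ENNReal.toReal_nonneg
    calc n * V + (ε / 2 + ε ^ 2) * n * (v + V)
        ≤ n * (A * R * v) + (1 + K) * R * n * (v + A * v) := by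
          gcongr
      _ = _ := by ring

lemma one_add_mul_mul_le {a b x : ℝ} (ha : 0 ≤ a) (hb : 0 ≤ b) (hx0 : 0 ≤ x) (hx1 : x ≤ 1) :
    (1 + a * x) * (1 + b * x) ≤ 1 + (a + b + a * b) * x := by
  nlinarith [mul_nonneg (mul_nonneg ha hb) (mul_nonneg hx0 (sub_nonneg.2 hx1))]

set_option maxHeartbeats 1000000 in
/-- The approximation result with sharp constants in high dimension. -/
lemma exists_polytope_sharp :
    ∃ C : ℝ, 0 ≤ C ∧ ∀ n N : ℕ, 10 ≤ n → n ^ n ≤ N → ∃ P ∈ polytopesWithAtMost n N,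
      volDiff P (unitBall n) ≤ (constI + constII + C * (n : ℝ) ^ (-(1 / 2 : ℝ))) *
        rate n N * vol (unitBall n) ∧
      surfDev P (unitBall n) ≤ (2 * constI + constII + 1 / 2 + C * (n : ℝ) ^ (-(1 / 2 : ℝ))) *
        rate n N * surfaceArea (unitBall n) := by
  have hI := constI_nonneg
  have hII := constII_nonneg
  -- Each factor is of the form `1 + O(x)` with `x = n ^ (-1/2) ≤ 1`: here `K` bounds
  -- `(4n) ^ (2 / (n - 1))`, `L` bounds `1 / (1 - ε)` and `1 + 2 ε`, and `A`, `B`, `C₁`, `E`, `F`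
  -- collect the products.
  obtain ⟨J, hJ⟩ : ∃ J : ℝ, J = constI + constII := ⟨_, rfl⟩
  have hJ0 : 0 ≤ J := by rw [hJ]; positivity
  obtain ⟨K, hK⟩ : ∃ K : ℝ, K = Real.exp 16 := ⟨_, rfl⟩
  have hK0 : 0 < K := hK ▸ Real.exp_pos _
  obtain ⟨L, hL⟩ : ∃ L : ℝ, L = 2 * (1 + K) := ⟨_, rfl⟩
  obtain ⟨A, hA⟩ : ∃ A : ℝ, A = K + 2 + K * 2 := ⟨_, rfl⟩
  obtain ⟨B, hB⟩ : ∃ B : ℝ, B = A + L + A * L := ⟨_, rfl⟩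
  obtain ⟨D, hD⟩ : ∃ D : ℝ, D = 53144103 * (2 + K) := ⟨_, rfl⟩
  obtain ⟨C₁, hC₁⟩ : ∃ C₁ : ℝ, C₁ = D + B * J + B * D := ⟨_, rfl⟩
  obtain ⟨E, hE⟩ : ∃ E : ℝ, E = K + L + K * L := ⟨_, rfl⟩
  obtain ⟨F, hF⟩ : ∃ F : ℝ, F = E + (J + C₁) + E * (J + C₁) := ⟨_, rfl⟩
  have hL0 : 0 < L := by rw [hL]; positivity
  have hA0 : 0 < A := by rw [hA]; positivity
  have hB0 : 0 < B := by rw [hB]; positivity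
  have hD0 : 0 < D := by rw [hD]; positivity
  have hC₁0 : 0 < C₁ := by rw [hC₁]; positivity
  have hE0 : 0 < E := by rw [hE]; positivity
  have hF0 : 0 < F := by rw [hF]; positivity
  refine ⟨C₁ + F, by positivity, fun n N hn hN => ?_⟩
  have hn2' : 2 ≤ n := by omega
  obtain ⟨P, hP, ε, hε0, hε, hεN, hV, hS⟩ :=
    exists_polytope_approx hn2' ((Nat.pow_le_pow_left hn n).trans hN)
  have hN1 : 1 ≤ N := (Nat.one_le_pow _ _ (by omega)).trans hN
  have hR0 := rate_pos (n := n) hN1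
  have hRn := rate_le_one_div hn2' hN
  obtain ⟨hx0, hx1, hnx⟩ := rpow_neg_half_mem (n := n) (by omega)
  have h4 := four_mul_rpow_le hn2'
  rw [four_mul_div_rpow] at hεN
  rw [← hK] at h4
  rw [← hJ] at hV ⊢
  set R := rate n N
  set x := (n : ℝ) ^ (-(1 / 2 : ℝ))
  set v := vol (unitBall n) with hv
  have hv0 : 0 < v := vol_unitBall_pos n
  have hn10 : (10 : ℝ) ≤ n := by exact_mod_cast hn
  have hn0 : (0 : ℝ) < n := by linarith
  have hm : (0 : ℝ) < n - 1 := by linarith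
  have hRx : R ≤ x := hRn.trans hnx
  have hεR : ε ≤ (1 + K * x) * R := hεN.trans (mul_le_mul_of_nonneg_right h4 hR0.le)
  have hεx : ε ≤ (1 + K) * x := by
    refine hεR.trans (mul_le_mul ?_ hRx hR0.le (by positivity))
    have := mul_le_mul_of_nonneg_left hx1 hK0.le
    linarith
  have hfac : n / (n - 1) * (ε / (1 - ε)) ≤ (1 + B * x) * R := by
    have h1 : (n : ℝ) / (n - 1) ≤ 1 + 2 * x := by
      have : (n : ℝ) / (n - 1) ≤ 1 + 2 * (1 / n) := by
        rw [div_le_iff₀ hm]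
        have : (1 + 2 * (1 / (n : ℝ))) * (n - 1) = n + 1 - 2 * (1 / n) := by field_simp; ring
        have h12 : 1 / (n : ℝ) ≤ 1 / 10 := by gcongr
        linarith
      linarith
    have h2 : ε / (1 - ε) ≤ (1 + L * x) * ε := by
      have h21 : ε / (1 - ε) ≤ (1 + 2 * ε) * ε := by
        rw [div_le_iff₀ (by linarith)]
        nlinarith [mul_pos hε0 hε0]
      refine h21.trans (mul_le_mul_of_nonneg_right ?_ hε0.le)
      rw [hL]; linarith
    calc n / (n - 1) * (ε / (1 - ε)) ≤ (1 + 2 * x) * ((1 + L * x) * ε) :=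
          mul_le_mul h1 h2 (div_nonneg hε0.le (by linarith)) (by positivity)
      _ ≤ (1 + 2 * x) * ((1 + L * x) * ((1 + K * x) * R)) := by gcongr
      _ = ((1 + K * x) * (1 + 2 * x)) * (1 + L * x) * R := by ring
      _ ≤ (1 + A * x) * (1 + L * x) * R := by
          gcongr
          rw [hA]
          exact one_add_mul_mul_le hK0.le (by norm_num) hx0.le hx1
      _ ≤ _ := by
          gcongr
          rw [hB]
          exact one_add_mul_mul_le hA0.le hL0.le hx0.le hx1
  have hVA : volDiff P (unitBall n) ≤ (J + C₁ * x) * R * v := by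
    refine hV.trans (mul_le_mul_of_nonneg_right ?_ hv0.le)
    have h1 : 53144103 * (ε + 1 / n) ≤ D * x := by rw [hD]; linarith
    calc n / (n - 1) * (ε / (1 - ε)) * (J + 53144103 * (ε + 1 / n))
        ≤ (1 + B * x) * R * (J + D * x) :=
          mul_le_mul hfac (by linarith) (by positivity) (by positivity)
      _ = ((1 + B * x) * (J + D * x)) * R := by ring
      _ ≤ (J + C₁ * x) * R := by
          gcongr
          rw [hC₁]
          nlinarith [mul_nonneg (mul_nonneg hB0.le hD0.le) (mul_nonneg hx0.le (sub_nonneg.2 hx1))]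
  set V := volDiff P (unitBall n)
  refine ⟨P, hP, hVA.trans ?_, hS.trans ?_⟩
  · gcongr
    linarith
  · rw [surfaceArea_unitBall (by omega), ← hv]
    have hV2 : V ≤ (J + C₁) * x * v := by
      refine hVA.trans (mul_le_mul_of_nonneg_right ?_ hv0.le)
      have := mul_le_mul_of_nonneg_left hx1 hC₁0.le
      exact mul_le_mul (by linarith) hRx hR0.le (by positivity)
    have he : ε / 2 + ε ^ 2 ≤ 1 / 2 * ((1 + E * x) * R) := by
      have h1 : ε / 2 + ε ^ 2 = 1 / 2 * (ε * (1 + 2 * ε)) := by ring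
      have h2 : 1 + 2 * ε ≤ 1 + L * x := by rw [hL]; linarith
      rw [h1]
      calc 1 / 2 * (ε * (1 + 2 * ε)) ≤ 1 / 2 * (((1 + K * x) * R) * (1 + L * x)) := by gcongr
        _ = 1 / 2 * (((1 + K * x) * (1 + L * x)) * R) := by ring
        _ ≤ _ := by
            gcongr
            rw [hE]
            exact one_add_mul_mul_le hK0.le hL0.le hx0.le hx1
    have hEF : (1 + E * x) * (1 + (J + C₁) * x) ≤ 1 + F * x :=
      hF ▸ one_add_mul_mul_le hE0.le (by positivity) hx0.le hx1
    have hV0 : 0 ≤ V := ENNReal.toReal_nonneg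
    calc n * V + (ε / 2 + ε ^ 2) * n * (v + V)
        ≤ n * ((J + C₁ * x) * R * v) + (1 / 2 * ((1 + E * x) * R)) * n * (v + (J + C₁) * x * v) := by
          gcongr
      _ = (J + C₁ * x + 1 / 2 * ((1 + E * x) * (1 + (J + C₁) * x))) * R * (n * v) := by ring
      _ ≤ (2 * constI + constII + 1 / 2 + (C₁ + F) * x) * R * (n * v) := by
          have h1 : J + C₁ * x + 1 / 2 * ((1 + E * x) * (1 + (J + C₁) * x)) ≤
              2 * constI + constII + 1 / 2 + (C₁ + F) * x := by
            have : 0 ≤ F * x := by positivity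
            linarith
          exact mul_le_mul_of_nonneg_right (mul_le_mul_of_nonneg_right h1 hR0.le) (by positivity)

lemma cube_mem_polytopesWithAtMost {n N : ℕ} (hN : 2 * n ≤ N) :
    circumPolytope (cubeNormal n) 1 ∈ polytopesWithAtMost n N := by
  refine circumPolytope_mem_polytopesWithAtMost norm_cubeNormal one_pos ?_ ?_
  · refine (Metric.isBounded_closedBall (x := (0 : Euc n)) (r := Real.sqrt n)).subset ?_
    intro x hx
    simpa using norm_le_of_mem_cube le_rfl hx
  · simp only [Fintype.card_prod, Fintype.card_fin, Fintype.card_bool]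
    omega

/-- In bounded dimensions, finitely many values of `N` are not covered by the bound for
`N ≥ 10ⁿ`; for these a cube will do. -/
lemma exists_polytope_low_dim :
    ∃ C : ℝ, 0 ≤ C ∧ ∀ n N : ℕ, 2 ≤ n → n < 10 → n ^ n ≤ N → ∃ P ∈ polytopesWithAtMost n N,
      volDiff P (unitBall n) ≤ C * rate n N * vol (unitBall n) ∧
      surfDev P (unitBall n) ≤ C * rate n N * surfaceArea (unitBall n) := by
  obtain ⟨C, hC0, hC⟩ := exists_polytope_const
  set c : ℕ → ℕ → ℝ := fun n N =>
    |volDiff (circumPolytope (cubeNormal n) 1) (unitBall n) / (rate n N * vol (unitBall n))| +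
    |surfDev (circumPolytope (cubeNormal n) 1) (unitBall n) /
      (rate n N * surfaceArea (unitBall n))| with hc
  have hc0 : ∀ n N, 0 ≤ c n N := fun n N => by positivity
  set S := ∑ n ∈ Finset.range 10, ∑ N ∈ Finset.range (10 ^ n), c n N with hS
  have hS0 : 0 ≤ S := Finset.sum_nonneg fun n _ => Finset.sum_nonneg fun N _ => hc0 n N
  refine ⟨C + S, by positivity, fun n N hn hn10 hN => ?_⟩
  have hN1 : 1 ≤ N := (Nat.one_le_pow _ _ (by omega)).trans hN
  have hR0 := rate_pos (n := n) hN1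
  have hv0 := vol_unitBall_pos n
  have hs0 : 0 < surfaceArea (unitBall n) := by
    rw [surfaceArea_unitBall (by omega)]; positivity
  rcases le_or_gt (10 ^ n) N with h10 | h10
  · obtain ⟨P, hP, hV, hSP⟩ := hC n N hn h10
    refine ⟨P, hP, hV.trans ?_, hSP.trans ?_⟩ <;>
    · gcongr
      linarith
  · have hcS : c n N ≤ C + S := by
      have h1 : c n N ≤ ∑ N ∈ Finset.range (10 ^ n), c n N :=
        Finset.single_le_sum (f := fun N => c n N) (fun N _ => hc0 n N) (Finset.mem_range.2 h10)
      have h2 : ∑ N ∈ Finset.range (10 ^ n), c n N ≤ S :=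
        Finset.single_le_sum (f := fun n => ∑ N ∈ Finset.range (10 ^ n), c n N)
          (fun n _ => Finset.sum_nonneg fun N _ => hc0 n N) (Finset.mem_range.2 hn10)
      linarith
    have h2n : 2 * n ≤ N := by
      have h1 : n ^ 2 ≤ n ^ n := Nat.pow_le_pow_right (by omega) hn
      nlinarith
    refine ⟨_, cube_mem_polytopesWithAtMost h2n, ?_, ?_⟩
    · rw [mul_assoc, ← div_le_iff₀ (by positivity)]
      refine (le_abs_self _).trans (le_trans ?_ hcS)
      exact le_add_of_nonneg_right (abs_nonneg _)
    · rw [mul_assoc, ← div_le_iff₀ (by positivity)]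
      refine (le_abs_self _).trans (le_trans ?_ hcS)
      exact le_add_of_nonneg_left (abs_nonneg _)

/-- For `n < 10` the factor `n ^ (-1/2)` is bounded below, so that the constant absorbs the bound
of `exists_polytope_low_dim`. -/
lemma exists_polytope_all_dim :
    ∃ C : ℝ, ∀ n N : ℕ, 2 ≤ n → n ^ n ≤ N → ∃ P ∈ polytopesWithAtMost n N,
      volDiff P (unitBall n) ≤ (constI + constII + C * (n : ℝ) ^ (-(1 / 2 : ℝ))) *
        rate n N * vol (unitBall n) ∧
      surfDev P (unitBall n) ≤ (2 * constI + constII + 1 / 2 + C * (n : ℝ) ^ (-(1 / 2 : ℝ))) *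
        rate n N * surfaceArea (unitBall n) := by
  obtain ⟨C, hC0, hC⟩ := exists_polytope_sharp
  obtain ⟨C', hC'0, hC'⟩ := exists_polytope_low_dim
  have hI := constI_nonneg
  have hII := constII_nonneg
  refine ⟨C + 10 * C', fun n N hn hN => ?_⟩
  have hN1 : 1 ≤ N := (Nat.one_le_pow _ _ (by omega)).trans hN
  have hR0 := rate_pos (n := n) hN1
  have hv0 := vol_unitBall_pos n
  have hs0 : 0 < surfaceArea (unitBall n) := by
    rw [surfaceArea_unitBall (by omega)]; positivity
  obtain ⟨hx0, -, hnx⟩ := rpow_neg_half_mem (n := n) (by omega)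
  set x := (n : ℝ) ^ (-(1 / 2 : ℝ))
  rcases le_or_gt 10 n with h10 | h10
  · obtain ⟨P, hP, hV, hS⟩ := hC n N h10 hN
    refine ⟨P, hP, hV.trans ?_, hS.trans ?_⟩ <;>
    · gcongr
      linarith
  · obtain ⟨P, hP, hV, hS⟩ := hC' n N hn h10 hN
    have hx10 : C' ≤ (C + 10 * C') * x := by
      have hn10 : (n : ℝ) ≤ 10 := by exact_mod_cast h10.le
      have h1 : (1 : ℝ) / 10 ≤ 1 / n := by
        have : (0 : ℝ) < n := by positivity
        gcongr
      have h2 : 1 / 10 ≤ x := h1.trans hnx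
      have h3 : 10 * C' * (1 / 10) ≤ 10 * C' * x := by gcongr
      have h4 : 0 ≤ C * x := by positivity
      linarith
    refine ⟨P, hP, hV.trans ?_, hS.trans ?_⟩ <;>
    · gcongr
      linarith

theorem theorem2p4 :
    (∃ C : ℝ, ∀ n N : ℕ, 2 ≤ n → n ^ n ≤ N →
      (∀ Q : Set (EuclideanSpace ℝ (Fin n)), IsBestSurfApprox n N Q →
        surfDev Q (unitBall n) ≤
          (2 * constI + constII + 1 / 2 + C * (n : ℝ) ^ (-(1 / 2 : ℝ))) *
            rate n N * surfaceArea (unitBall n)) ∧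
      (∃ P ∈ polytopesWithAtMost n N,
        volDiff P (unitBall n) ≤
          (constI + constII + C * (n : ℝ) ^ (-(1 / 2 : ℝ))) *
            rate n N * vol (unitBall n) ∧
        surfDev P (unitBall n) ≤
          (2 * constI + constII + 1 / 2 + C * (n : ℝ) ^ (-(1 / 2 : ℝ))) *
            rate n N * surfaceArea (unitBall n))) ∧
    (∃ C : ℝ, ∀ n N : ℕ, 2 ≤ n → 10 ^ n ≤ N →
      (∀ Q : Set (EuclideanSpace ℝ (Fin n)), IsBestSurfApprox n N Q →
        surfDev Q (unitBall n) ≤ 4 * C * rate n N * surfaceArea (unitBall n)) ∧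
      (∃ P ∈ polytopesWithAtMost n N,
        volDiff P (unitBall n) ≤ C * rate n N * vol (unitBall n) ∧
        surfDev P (unitBall n) ≤ 4 * C * rate n N * surfaceArea (unitBall n))) := by
  refine ⟨?_, ?_⟩
  · obtain ⟨C, hC⟩ := exists_polytope_all_dim
    refine ⟨C, fun n N hn hN => ?_⟩
    obtain ⟨P, hP, hV, hS⟩ := hC n N hn hN
    exact ⟨fun Q hQ => (hQ.2 P hP).trans hS, P, hP, hV, hS⟩
  · obtain ⟨C, hC0, hC⟩ := exists_polytope_const
    refine ⟨C, fun n N hn hN => ?_⟩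
    obtain ⟨P, hP, hV, hS⟩ := hC n N hn hN
    have hN1 : 1 ≤ N := (Nat.one_le_pow _ _ (by norm_num)).trans hN
    have hR0 := rate_pos (n := n) hN1
    have hs0 : 0 ≤ surfaceArea (unitBall n) := ENNReal.toReal_nonneg
    have hS4 : surfDev P (unitBall n) ≤ 4 * C * rate n N * surfaceArea (unitBall n) := by
      refine hS.trans ?_
      gcongr
      linarith
    exact ⟨fun Q hQ => (hQ.2 P hP).trans hS4, P, hP, hV, hS4⟩
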